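/- Let $\mathcal P'$ be the class of linear heat equations with time-independent potentials, $\mathcal P'_C\colon\ u_t=u_{xx}+C(x)u$, where $C$ is a smooth real-valued function of $x$ on a nonempty open subset of $\mathbb R$. A point transformation is a smooth local diffeomorphism $\Phi\colon(t,x,u)\mapsto(\tilde t,\tilde x,\tilde u)$ defined on a nonempty open subset of $\mathbb R^3$. An admissible transformation of $\mathcal P'$ is a triple $\mathcal T=(C,\Phi,\tilde C)$ such that $\Phi$ maps $\mathcal P'_C$ to $\mathcal P'_{\tilde C}$, i.e. the second prolongation of $\Phi$ maps the manifold defined by $\mathcal P'_C$ in the second-order jet space into that defined by $\mathcal P'_{\tilde C}$; here $C$ and $\tilde C$ are considered on the sets of values taken by $x$ on the domain of $\Phi$ and by $\tilde x$ on its image. The triples $(C,\Phi,\tilde C)$ and $(\tilde C,\Phi',\hat C)$ are composable, with the composition $(C,\Phi'\circ\Phi,\hat C)$. The admissible transformations form the equivalence groupoid $\mathcal G^\sim_{\mathcal P'}$. The equivalence group $G^\sim_{\mathcal P'}$ consists of the point transformations of the space with coordinates $(t,x,u,u_t,u_x,u_{tt},u_{tx},u_{xx},C)$ that are projectable to the space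 of $(t,x,u)$, whose jet components are the prolongation of this projection, and that map every equation of $\mathcal P'$ to an equation of $\mathcal P'$; the triples $(C,\Phi,\tilde C)$ that it induces form its action groupoid. Let $\mathcal G^{\rm lin}$ be the set of the triples $(C,\Phi,C)$ with $\Phi\colon \tilde t=t,\ \tilde x=x,\ \tilde u=u+f(t,x)$, where $f$ is a solution of $\mathcal P'_C$, and let $\mathcal U$ be the set of the compositions of elements of the action groupoid of $G^\sim_{\mathcal P'}$ with elements of $\mathcal G^{\rm lin}$. For a set $\mathcal B$ of admissible transformations, let $\hat{\mathcal B}$ be the set of inverses of its elements. The set $\mathcal B$ is called generating (up to the $G^\sim_{\mathcal P'}$-equivalence and the linear superposition of solutions) if every admissible transformation coincides, near each point of its domain, with a finite composition of (restrictions of) elements of $\mathcal B\cup\hat{\mathcal B}\cup\mathcal U$; self-consistent if for all $\mathcal T,\mathcal T'\in\mathcal B\cup\hat{\mathcal B}$ such that $\mathcal T_1\star\mathcal T\star\mathcal T_2$ is composable with $\mathcal T'$ for some $\mathcal T_1,\mathcal T_2\in\mathcal U$, the transformation $\mathcal T$ itself is composable with $\mathcal T'$; a generating set is minimal if no proper subset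 of it is generating. Theorem. A minimal self-consistent generating (up to the $G^\sim_{\mathcal P'}$-equivalence and the linear superposition of solutions) set of admissible transformations for the class $\mathcal P'$ is $\mathcal B=\{\mathcal T_{1\mu},\mathcal T_{2\mu},\mathcal T_3\mid\mu\in\mathbb R\}$, where \begin{gather*} \mathcal T_{1\mu}:=\left(\frac{\mu}{x^2}+x^2,\ \Phi_1,\ \frac{\mu}{\tilde x^2}\right),\quad \Phi_1\colon\ \tilde t=\tfrac12\tan 2t,\ \ \tilde x=\frac{x}{\cos 2t},\ \ \tilde u=|\cos 2t|^{1/2}e^{-\tan(2t)x^2/2}\,u;\\ \mathcal T_{2\mu}:=\left(\frac{\mu}{x^2}-x^2,\ \Phi_2,\ \frac{\mu}{\tilde x^2}\right),\quad \Phi_2\colon\ \tilde t=\tfrac14e^{4t},\ \ \tilde x=e^{2t}x,\ \ \tilde u=e^{-x^2/2-t}\,u;\\ \mathcal T_3:=(x,\ \Phi_3,\ 0),\quad \Phi_3\colon\ \tilde t=t,\ \ \tilde x=x+t^2,\ \ \tilde u=e^{-tx-t^3/3}\,u. \end{gather*} Here the potentials with $\mu\ne0$ are considered for $x\ne0$,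 those with $\mu=0$ for all $x\in\mathbb R$, and $\Phi_1$ is considered for $\cos 2t\ne0$. -/

import Mathlib

open scoped ContDiff

namespace HeatPot

noncomputable section

/-! ### Potentials: the arbitrary elements of the class `u_t = u_xx + C(x) u` -/

/-- An arbitrary element of the class: a smooth function `C` of `x` on a nonempty open set
of the real line. The value off the domain is irrelevant and is fixed to be `0`, so that
equality of potentials is equality of domains and of functions on them. -/
@[ext]
structure Potential where
  dom : Set ℝ
  fn : ℝ → ℝ
  isOpen_dom : IsOpen dom
  nonempty_dom : dom.Nonempty
  smooth_fn : ContDiffOn ℝ ∞ fn dom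
  fn_off : ∀ x, x ∉ dom → fn x = 0

/-- `C₀` is the restriction of `C` to a smaller open set. -/
def Potential.IsRestriction (C₀ C : Potential) : Prop :=
  C₀.dom ⊆ C.dom ∧ Set.EqOn C₀.fn C.fn C₀.dom

/-! ### Second-order jets and prolongation of point transformations -/

/-- The space with coordinates `(t, x, u)`. -/
abbrev Space := ℝ × ℝ × ℝ

/-- The second-order jet space with coordinates
`((t, x, u), (u_t, u_x, u_tt, u_tx, u_xx))`. -/
abbrev Jet := Space × (ℝ × ℝ × ℝ × ℝ × ℝ)

namespace Jet

def t (j : Jet) : ℝ := j.1.1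
def x (j : Jet) : ℝ := j.1.2.1
def u (j : Jet) : ℝ := j.1.2.2
def ut (j : Jet) : ℝ := j.2.1
def ux (j : Jet) : ℝ := j.2.2.1
def utt (j : Jet) : ℝ := j.2.2.2.1
def utx (j : Jet) : ℝ := j.2.2.2.2.1
def uxx (j : Jet) : ℝ := j.2.2.2.2.2

/-- The quadratic function of `(t, x)` whose 2-jet at `(j.t, j.x)` is `j`. -/
def taylor (j : Jet) (s y : ℝ) : ℝ :=
  j.u + j.ut * (s - j.t) + j.ux * (y - j.x) + j.utt * (s - j.t) ^ 2 / 2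
    + j.utx * (s - j.t) * (y - j.x) + j.uxx * (y - j.x) ^ 2 / 2

/-- The jet lies on the manifold defined by the equation `u_t = u_xx + C(x) u`. -/
def Satisfies (j : Jet) (C : Potential) : Prop :=
  j.x ∈ C.dom ∧ j.ut = j.uxx + C.fn j.x * j.u

end Jet

/-- Partial derivative with respect to the first argument `t`. -/
def pdt (g : ℝ → ℝ → ℝ) : ℝ → ℝ → ℝ := fun t x => deriv (fun s => g s x) t

/-- Partial derivative with respect to the second argument `x`. -/
def pdx (g : ℝ → ℝ → ℝ) : ℝ → ℝ → ℝ := fun t x => deriv (fun y => g t y) x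

/-- The `t`-, `x`- and `u`-components of `Φ` along the graph of `u = f(t, x)`. -/
def compT (Φ : Space → Space) (f : ℝ → ℝ → ℝ) : ℝ → ℝ → ℝ := fun t x => (Φ (t, x, f t x)).1
def compX (Φ : Space → Space) (f : ℝ → ℝ → ℝ) : ℝ → ℝ → ℝ := fun t x => (Φ (t, x, f t x)).2.1
def compU (Φ : Space → Space) (f : ℝ → ℝ → ℝ) : ℝ → ℝ → ℝ := fun t x => (Φ (t, x, f t x)).2.2

/-- `D_t T D_x X - D_x T D_t X` along the graph of `f`. -/
def jac (Φ : Space → Space) (f : ℝ → ℝ → ℝ) : ℝ → ℝ → ℝ := fun t x =>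
  pdt (compT Φ f) t x * pdx (compX Φ f) t x - pdx (compT Φ f) t x * pdt (compX Φ f) t x

/-- Total differentiation with respect to the new variable `t̃`, along the graph of `f`. -/
def newDt (Φ : Space → Space) (f : ℝ → ℝ → ℝ) (g : ℝ → ℝ → ℝ) : ℝ → ℝ → ℝ := fun t x =>
  (pdt g t x * pdx (compX Φ f) t x - pdx g t x * pdt (compX Φ f) t x) / jac Φ f t x

/-- Total differentiation with respect to the new variable `x̃`, along the graph of `f`. -/
def newDx (Φ : Space → Space) (f : ℝ → ℝ → ℝ) (g : ℝ → ℝ → ℝ) : ℝ → ℝ → ℝ := fun t x =>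
  (pdt (compT Φ f) t x * pdx g t x - pdx (compT Φ f) t x * pdt g t x) / jac Φ f t x

/-- The jets at which the prolongation of `Φ` is defined: those whose image is again
the jet of a function of `(t̃, x̃)`. -/
def Regular (Φ : Space → Space) (j : Jet) : Prop := jac Φ j.taylor j.t j.x ≠ 0

/-- The second prolongation of `Φ`. -/
def prolong (Φ : Space → Space) (j : Jet) : Jet :=
  let f := j.taylor
  (Φ j.1,
    newDt Φ f (compU Φ f) j.t j.x,
    newDx Φ f (compU Φ f) j.t j.x,
    newDt Φ f (newDt Φ f (compU Φ f)) j.t j.x,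
    newDt Φ f (newDx Φ f (compU Φ f)) j.t j.x,
    newDx Φ f (newDx Φ f (compU Φ f)) j.t j.x)

/-- `Φ` is a point transformation with domain `Ω`: a smooth local diffeomorphism. -/
structure IsPointTransformation (Ω : Set Space) (Φ : Space → Space) : Prop where
  isOpen : IsOpen Ω
  nonempty : Ω.Nonempty
  smooth : ContDiffOn ℝ ∞ Φ Ω
  bijective : ∀ z ∈ Ω, Function.Bijective (fderiv ℝ Φ z)

/-! ### Admissible transformations and the equivalence groupoid -/

/-- A triple `(C, Φ, C̃)`, where `Φ` is a map with a specified domain. -/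
structure Triple where
  src : Potential
  dom : Set Space
  map : Space → Space
  tgt : Potential

/-- The triple is an admissible transformation: `map` is a point transformation on `dom`, the
source and target potentials are given over the values that `x` takes on the domain and on the
image, respectively, and the prolongation of `map` sends the source equation to the target one. -/
structure IsAdmissible (T : Triple) : Prop where
  point : IsPointTransformation T.dom T.map
  src_dom : T.src.dom = (fun z : Space => z.2.1) '' T.dom
  tgt_dom : T.tgt.dom = (fun z : Space => (T.map z).2.1) '' T.dom
  maps : ∀ j : Jet, j.1 ∈ T.dom → Regular T.map j → j.Satisfies T.src →
    (prolong T.map j).Satisfies T.tgt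

/-- The equivalence groupoid of the class. -/
def equivGroupoid : Set Triple := {T | IsAdmissible T}

/-- `T` is composable with `T'`. -/
def Composable (T T' : Triple) : Prop := T.tgt = T'.src

/-- The composition `T ⋆ T'` (first `T`, then `T'`). -/
def comp (T T' : Triple) : Triple where
  src := T.src
  dom := T.dom ∩ T.map ⁻¹' T'.dom
  map := T'.map ∘ T.map
  tgt := T'.tgt

/-- `T'` is an inverse of `T`. Since point transformations are only local diffeomorphisms,
any branch of the inverse map is meant. -/
def IsInverse (T T' : Triple) : Prop :=
  T' ∈ equivGroupoid ∧ T'.src = T.tgt ∧ T'.tgt = T.src ∧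
    Set.MapsTo T'.map T'.dom T.dom ∧ ∀ w ∈ T'.dom, T.map (T'.map w) = w

/-- The admissible transformation `T₀` is a restriction of `T` to a smaller domain. -/
def IsRestriction (T₀ T : Triple) : Prop :=
  T₀ ∈ equivGroupoid ∧ T₀.dom ⊆ T.dom ∧ Set.EqOn T₀.map T.map T₀.dom ∧
    T₀.src.IsRestriction T.src ∧ T₀.tgt.IsRestriction T.tgt

/-! ### The equivalence group and its action groupoid -/

/-- Data of a transformation of the space with coordinates `(t, x, u, u_t, …, u_xx, C)` that is
projectable to the `(t, x, u)`-space and consistent with the contact structure: its jet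
components are the prolongation of `map`, and `pot` is its `C`-component. -/
structure ExtTransformation where
  dom : Set Space
  map : Space → Space
  pot : Jet × ℝ → ℝ

namespace ExtTransformation

/-- `C̃` is the pushforward of `C` as a function: the `C`-component of the transformation,
evaluated on the graph of `C`, is the value of `C̃` at the new point. -/
def PushesTo (E : ExtTransformation) (C C' : Potential) : Prop :=
  ∀ j : Jet, j.1 ∈ E.dom → j.x ∈ C.dom → Regular E.map j →
    E.pot (j, C.fn j.x) = C'.fn (E.map j.1).2.1

/-- The triple `(C, Φ, C̃)` given by the projection `Φ` of the transformation
to the `(t, x, u)`-space. -/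
def triple (E : ExtTransformation) (C C' : Potential) : Triple where
  src := C
  dom := {z ∈ E.dom | z.2.1 ∈ C.dom}
  map := E.map
  tgt := C'

/-- Potentials to which the transformation can be applied. -/
def Acts (E : ExtTransformation) (C : Potential) : Prop :=
  C.dom ⊆ (fun z : Space => z.2.1) '' E.dom

/-- The (usual) equivalence transformations of the class: point transformations of the extended
space that send each equation of the class to an equation of the class. -/
structure IsEquivalence (E : ExtTransformation) : Prop where
  point : IsPointTransformation E.dom E.map
  connected : IsConnected E.dom
  pot_smooth : ContDiffOn ℝ ∞ E.pot {w | w.1.1 ∈ E.dom ∧ Regular E.map w.1}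
  pot_deriv : ∀ w : Jet × ℝ, w.1.1 ∈ E.dom → Regular E.map w.1 →
    deriv (fun c => E.pot (w.1, c)) w.2 ≠ 0
  preserves : ∀ C : Potential, E.Acts C →
    ∃ C' : Potential, E.PushesTo C C' ∧ E.triple C C' ∈ equivGroupoid

end ExtTransformation

/-- The action groupoid of the equivalence group. -/
def actionGroupoid : Set Triple :=
  {T | T ∈ equivGroupoid ∧ ∃ E : ExtTransformation, E.IsEquivalence ∧
    E.Acts T.src ∧ E.PushesTo T.src T.tgt ∧ T = E.triple T.src T.tgt}

/-! ### Linear superposition -/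

/-- `f` is a smooth solution of `u_t = u_xx + C(x) u` on the set `D` of the `(t, x)`-plane. -/
def IsSolutionOn (C : Potential) (f : ℝ → ℝ → ℝ) (D : Set (ℝ × ℝ)) : Prop :=
  ContDiffOn ℝ ∞ (fun p : ℝ × ℝ => f p.1 p.2) D ∧
    ∀ p ∈ D, pdt f p.1 p.2 = pdx (pdx f) p.1 p.2 + C.fn p.2 * f p.1 p.2

/-- The admissible transformations `(C, Φ, C)`, where `Φ` is `t̃ = t`, `x̃ = x`,
`ũ = u + f(t, x)` with a solution `f` of the equation. -/
def linGroupoid : Set Triple :=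
  {T | T ∈ equivGroupoid ∧ T.tgt = T.src ∧ ∃ f : ℝ → ℝ → ℝ,
    IsSolutionOn T.src f ((fun z : Space => (z.1, z.2.1)) '' T.dom) ∧
    ∀ z ∈ T.dom, T.map z = (z.1, z.2.1, z.2.2 + f z.1 z.2.1)}

/-- The product of the action groupoid of the equivalence group and of the groupoid of
linear superposition. -/
def essLinGroupoid : Set Triple :=
  {T | T ∈ equivGroupoid ∧ ∃ T₁ ∈ actionGroupoid, ∃ T₂ ∈ linGroupoid,
    Composable T₁ T₂ ∧ T = comp T₁ T₂}

/-! ### Generating sets, self-consistency, minimality -/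

/-- The set of inverses of the elements of `B`. -/
def inverses (B : Set Triple) : Set Triple := {T' | ∃ T ∈ B, IsInverse T T'}

/-- Finite compositions of (restrictions of) elements of `M`. -/
inductive IsComposition (M : Set Triple) : Triple → Prop
  | of {T T₀ : Triple} : T ∈ M → IsRestriction T₀ T → IsComposition M T₀
  | comp {T T' : Triple} : IsComposition M T → IsComposition M T' → Composable T T' →
      IsComposition M (comp T T')

/-- `B` is a generating set of admissible transformations up to the `U`-equivalence: every
admissible transformation coincides, in a neighbourhood of each point of its domain, with a finite
composition of elements of `B`, of their inverses and of `U`. -/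
def IsGenerating (U B : Set Triple) : Prop :=
  B ⊆ equivGroupoid ∧ ∀ T ∈ equivGroupoid, ∀ z ∈ T.dom,
    ∃ T₀, IsRestriction T₀ T ∧ z ∈ T₀.dom ∧ IsComposition (B ∪ inverses B ∪ U) T₀

/-- `T` and `T'` are `U`-equivalent, `T' = T₁ ⋆ T ⋆ T₂` with `T₁` and `T₂` from `U`. -/
def UEquivalent (U : Set Triple) (T T' : Triple) : Prop :=
  ∃ T₁ ∈ U, ∃ T₂ ∈ U, Composable T₁ T ∧ Composable T T₂ ∧ T' = comp (comp T₁ T) T₂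

/-- `T` is composable with `T'` up to the `U`-equivalence. -/
def ComposableUpTo (U : Set Triple) (T T' : Triple) : Prop :=
  ∃ S, UEquivalent U T S ∧ Composable S T'

/-- `B` is self-consistent with respect to the `U`-equivalence. -/
def IsSelfConsistent (U B : Set Triple) : Prop :=
  ∀ T ∈ B ∪ inverses B, ∀ T' ∈ B ∪ inverses B, ComposableUpTo U T T' → Composable T T'

/-- `B` is a minimal self-consistent generating set up to the `U`-equivalence. -/
def IsMinimalSelfConsistentGenerating (U B : Set Triple) : Prop :=
  IsGenerating U B ∧ IsSelfConsistent U B ∧ ∀ B', B' ⊂ B → ¬ IsGenerating U B'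

/-! ### The three families -/

/-- The potential `μ / x² + a x²`, on `x ≠ 0` if `μ ≠ 0` and on the whole line if `μ = 0`. -/
def quadPotential (μ a : ℝ) : Potential where
  dom := {x | μ = 0 ∨ x ≠ 0}
  fn := fun x => μ / x ^ 2 + a * x ^ 2
  isOpen_dom := by
    by_cases h : μ = 0
    · simp [h]
    · simpa [h] using (isOpen_ne : IsOpen {x : ℝ | x ≠ 0})
  nonempty_dom := ⟨1, by simp⟩
  smooth_fn := by
    by_cases h : μ = 0
    · subst h
      simp only [zero_div, zero_add]
      fun_prop
    · intro x hx
      have hx0 : x ≠ 0 := by simpa [h] using hx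
      have h2 : x ^ 2 ≠ 0 := pow_ne_zero 2 hx0
      have h3 : ContDiffAt ℝ ∞ (fun y : ℝ => μ / y ^ 2) x :=
        contDiffAt_const.div (by fun_prop) h2
      exact (h3.add (by fun_prop)).contDiffWithinAt
  fn_off := by
    intro x hx
    have h0 : x = 0 := by
      by_contra h
      exact hx (Or.inr h)
    simp [h0]

/-- The potential `a x` on the whole line. -/
def linPotential (a : ℝ) : Potential where
  dom := Set.univ
  fn := fun x => a * x
  isOpen_dom := isOpen_univ
  nonempty_dom := Set.univ_nonempty
  smooth_fn := by fun_prop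
  fn_off := fun x hx => absurd (Set.mem_univ x) hx

/-- `μ/x² + x² → μ/x²`. -/
def T1 (μ : ℝ) : Triple where
  src := quadPotential μ 1
  dom := {z | Real.cos (2 * z.1) ≠ 0 ∧ (μ = 0 ∨ z.2.1 ≠ 0)}
  map := fun z => (Real.tan (2 * z.1) / 2, z.2.1 / Real.cos (2 * z.1),
    Real.sqrt |Real.cos (2 * z.1)| * Real.exp (-(Real.tan (2 * z.1) * z.2.1 ^ 2 / 2)) * z.2.2)
  tgt := quadPotential μ 0

/-- `μ/x² - x² → μ/x²`. -/
def T2 (μ : ℝ) : Triple where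
  src := quadPotential μ (-1)
  dom := {z | μ = 0 ∨ z.2.1 ≠ 0}
  map := fun z => (Real.exp (4 * z.1) / 4, Real.exp (2 * z.1) * z.2.1,
    Real.exp (-(z.2.1 ^ 2 / 2) - z.1) * z.2.2)
  tgt := quadPotential μ 0

/-- `x → 0`. -/
def T3 : Triple where
  src := linPotential 1
  dom := Set.univ
  map := fun z => (z.1, z.2.1 + z.1 ^ 2, Real.exp (-(z.1 * z.2.1) - z.1 ^ 3 / 3) * z.2.2)
  tgt := linPotential 0

/-- The union of the three families. -/
def generatingSet : Set Triple := Set.range T1 ∪ Set.range T2 ∪ {T3}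

end

end HeatPot

open scoped ContDiff

namespace HeatPot

noncomputable section

open Filter Topology Set

/-! ### Calculus of functions of `(t, x)` -/

/-! Locally an admissible transformation has the form `t̃ = τ(t)`, `x̃ = a(t) x + c(t)`, `ũ = σ
exp(A x² + B x + H) (u + f)` with `τ' = a²`, `a' = -4aA`, `c' = -2aB`, where `f` solves the source
equation (`IsAdmissible.exists_form`, `IsAdmissible.rel_of_form`). The potentials are related by `a²
C̃(a x + c) = C(x) + Q(t, x)` with `Q` quadratic in `x`. The shift by `f` is linear superposition
and the factor `σ` belongs to the equivalence group, so everything reduces to the functions `a` and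
`c`: two transformations of the same potential whose `a` and `c` differ by a constant affine change
of `x̃` differ by an affine equivalence transformation (`GenRel.of_affine`).

Generation. If `A` and `B` vanish, then `a` and `c` are constant and the transformation is affine.
Otherwise, differentiating the relation of potentials along the curves on which `x̃` is constant
gives, at a single time, a first-order linear ODE for `C` (`Rel.classifying`). Its solutions are
cubic polynomials, or `μ/(x-k)²` plus a quadratic polynomial. Comparison of coefficients at varying
times removes the cubic term, and for `μ ≠ 0` also the linear term, since either would force `A = B
= 0` (`Rel.exists_normalizable`). Affine changes and the three families carry what remains to
`μ/x²`, with one `μ` for source and target (`Normalizable.exists_isoRel`). Conjugation reduces the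
problem to self-transformations of `μ/x²`. For these `1/a` is affine in `t`, hence a multiple of
`cos 2β - 2t sin 2β`, the denominator that a time shift of `μ/x² + x²` acquires under conjugation by
`T1 μ`. For `μ = 0` there are also Galilean boosts, which are time shifts of the potential `x`
conjugated by `T3` (`Rel.genRel_symmetry`, `Rel.genRel_of_normalizable`).

Self-consistency and minimality. An equivalence transformation must act on `x⁴`, which admits only
affine transformations, so it changes every potential affinely (`affine_of_mem_actionGroupoid`).
Distinct potentials among the sources and targets of the families are affinely inequivalent
(`IsModel.eq_of_affEq`); this gives self-consistency. If `T` is removed, no remaining generator or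
inverse starts in the affine class of the source of `T`, so compositions that start in the class
stay in it (`IsComposition.affEq`), whereas `T` leaves it. -/

theorem tendsto_slice_left (s y : ℝ) : Tendsto (fun r : ℝ => (r, y)) (𝓝 s) (𝓝 (s, y)) :=
  (Continuous.prodMk_left y).tendsto s

theorem tendsto_slice_right (s y : ℝ) : Tendsto (fun r : ℝ => (s, r)) (𝓝 y) (𝓝 (s, y)) :=
  (Continuous.prodMk_right s).tendsto y

theorem pdt_congr {g h : ℝ → ℝ → ℝ} {q : ℝ × ℝ}
    (H : ∀ᶠ w : ℝ × ℝ in 𝓝 q, g w.1 w.2 = h w.1 w.2) :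
    ∀ᶠ w : ℝ × ℝ in 𝓝 q, pdt g w.1 w.2 = pdt h w.1 w.2 := by
  filter_upwards [H.eventually_nhds] with w hw
  exact EventuallyEq.deriv_eq ((tendsto_slice_left w.1 w.2).eventually hw)

theorem pdx_congr {g h : ℝ → ℝ → ℝ} {q : ℝ × ℝ}
    (H : ∀ᶠ w : ℝ × ℝ in 𝓝 q, g w.1 w.2 = h w.1 w.2) :
    ∀ᶠ w : ℝ × ℝ in 𝓝 q, pdx g w.1 w.2 = pdx h w.1 w.2 := by
  filter_upwards [H.eventually_nhds] with w hw
  exact EventuallyEq.deriv_eq ((tendsto_slice_right w.1 w.2).eventually hw)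

theorem eventually_fst {P : ℝ → Prop} {q : ℝ × ℝ} (h : ∀ᶠ t in 𝓝 q.1, P t) :
    ∀ᶠ w : ℝ × ℝ in 𝓝 q, P w.1 := continuous_fst.continuousAt.eventually h

theorem eventually_snd {P : ℝ → Prop} {q : ℝ × ℝ} (h : ∀ᶠ t in 𝓝 q.2, P t) :
    ∀ᶠ w : ℝ × ℝ in 𝓝 q, P w.2 := continuous_snd.continuousAt.eventually h

namespace Jet

theorem hasDerivAt_taylor_t (j : Jet) (s y : ℝ) :
    HasDerivAt (fun r => j.taylor r y) (j.ut + j.utt * (s - j.t) + j.utx * (y - j.x)) s := by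
  unfold taylor
  have h : HasDerivAt (fun r : ℝ => r - j.t) 1 s := (hasDerivAt_id s).sub_const _
  have := ((((((h.const_mul j.ut).const_add j.u).add_const (j.ux * (y - j.x))).add
    (((h.pow 2).const_mul j.utt).div_const 2)).add
    ((h.const_mul j.utx).mul_const (y - j.x))).add_const (j.uxx * (y - j.x) ^ 2 / 2))
  refine this.congr_deriv ?_
  simp; ring

theorem hasDerivAt_taylor_x (j : Jet) (s y : ℝ) :
    HasDerivAt (fun r => j.taylor s r) (j.ux + j.utx * (s - j.t) + j.uxx * (y - j.x)) y := by
  unfold taylor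
  have h : HasDerivAt (fun r : ℝ => r - j.x) 1 y := (hasDerivAt_id y).sub_const _
  have := ((((h.const_mul j.ux).const_add (j.u + j.ut * (s - j.t))).add_const
    (j.utt * (s - j.t) ^ 2 / 2)).add
    (h.const_mul (j.utx * (s - j.t)))).add (((h.pow 2).const_mul j.uxx).div_const 2)
  refine this.congr_deriv ?_
  simp; ring

@[simp] theorem taylor_self (j : Jet) : j.taylor j.t j.x = j.u := by simp [taylor]

end Jet

/-! ### Prolongation of transformations with `t̃ = τ(t)`, `x̃ = a(t) x + c(t)` -/

/-- The lift of the graph of the Taylor polynomial is continuous at the base point. -/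
theorem tendsto_graph (j : Jet) :
    Tendsto (fun w : ℝ × ℝ => ((w.1, w.2, j.taylor w.1 w.2) : Space)) (𝓝 (j.t, j.x))
      (𝓝 j.1) := by
  have h : Continuous (fun w : ℝ × ℝ => ((w.1, w.2, j.taylor w.1 w.2) : Space)) := by
    unfold Jet.taylor; fun_prop
  have := h.tendsto (j.t, j.x)
  rw [Jet.taylor_self] at this
  exact this

/-- Since `t̃` does not depend on `x` or `u`, the operator of total differentiation in `x̃` is `a⁻¹
∂_x`. The hypotheses hold on a neighbourhood and not only at the base point because `u_xx` applies
this operator twice. -/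
theorem prolong_fibred {Φ : Space → Space} {j : Jet} {τ a c : ℝ → ℝ} {a' c' : ℝ}
    {g : ℝ → ℝ → ℝ}
    (hT : ∀ᶠ w : ℝ × ℝ in 𝓝 (j.t, j.x), compT Φ j.taylor w.1 w.2 = τ w.1)
    (hX : ∀ᶠ w : ℝ × ℝ in 𝓝 (j.t, j.x), compX Φ j.taylor w.1 w.2 = a w.1 * w.2 + c w.1)
    (hU : ∀ᶠ w : ℝ × ℝ in 𝓝 (j.t, j.x), compU Φ j.taylor w.1 w.2 = g w.1 w.2)
    (hτ : ∀ᶠ t in 𝓝 j.t, deriv τ t ≠ 0) (ha0 : ∀ᶠ t in 𝓝 j.t, a t ≠ 0)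
    (ha : HasDerivAt a a' j.t) (hc : HasDerivAt c c' j.t) :
    Regular Φ j ∧
    (prolong Φ j).ut = (pdt g j.t j.x * a j.t - pdx g j.t j.x * (a' * j.x + c')) /
      (deriv τ j.t * a j.t) ∧
    (prolong Φ j).uxx = pdx (pdx g) j.t j.x / a j.t ^ 2 := by
  have hTt := pdt_congr (h := fun t _ => τ t) hT
  have hTx := pdx_congr (h := fun t _ => τ t) hT
  have hXt := pdt_congr (h := fun t x => a t * x + c t) hX
  have hXx := pdx_congr (h := fun t x => a t * x + c t) hX
  have hUt := pdt_congr hU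
  have hUx := pdx_congr hU
  have eTx : ∀ t x, pdx (fun t _ => τ t) t x = 0 := fun t x => by simp [pdx]
  have eTt : ∀ t x, pdt (fun t _ => τ t) t x = deriv τ t := fun t x => rfl
  have eXx : ∀ t x, pdx (fun t x => a t * x + c t) t x = a t := fun t x => by
    simp only [pdx]
    exact ((((hasDerivAt_id x).const_mul (a t)).add_const (c t)).congr_deriv (by simp)).deriv
  have eXt : pdt (fun t x => a t * x + c t) j.t j.x = a' * j.x + c' := by
    simp only [pdt]
    exact ((ha.mul_const j.x).add hc).deriv
  have hD : ∀ h : ℝ → ℝ → ℝ, ∀ᶠ w : ℝ × ℝ in 𝓝 (j.t, j.x),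
      newDx Φ j.taylor h w.1 w.2 = pdx h w.1 w.2 / a w.1 := by
    intro h
    filter_upwards [hTt, hTx, hXx, eventually_fst hτ, eventually_fst ha0] with w h1 h2 h3 h4 h5
    simp only [newDx, jac, h1, h2, h3, eTx, eTt, eXx]
    field_simp
    ring
  have h1 : pdt (compT Φ j.taylor) j.t j.x = deriv τ j.t := hTt.self_of_nhds
  have h2 : pdx (compT Φ j.taylor) j.t j.x = 0 := hTx.self_of_nhds.trans (eTx _ _)
  have h3 : pdx (compX Φ j.taylor) j.t j.x = a j.t := hXx.self_of_nhds.trans (eXx _ _)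
  have h4 : pdt (compX Φ j.taylor) j.t j.x = a' * j.x + c' := hXt.self_of_nhds.trans eXt
  have h5 : pdt (compU Φ j.taylor) j.t j.x = pdt g j.t j.x := hUt.self_of_nhds
  have h6 : pdx (compU Φ j.taylor) j.t j.x = pdx g j.t j.x := hUx.self_of_nhds
  refine ⟨?_, ?_, ?_⟩
  · simp only [Regular, jac, h1, h2, h3]
    simpa using ⟨hτ.self_of_nhds, ha0.self_of_nhds⟩
  · simp only [prolong, Jet.ut, newDt, jac, h1, h2, h3, h4, h5, h6]
    simp
  · have e1 : ∀ᶠ w : ℝ × ℝ in 𝓝 (j.t, j.x),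
        newDx Φ j.taylor (compU Φ j.taylor) w.1 w.2 = pdx g w.1 w.2 / a w.1 := by
      filter_upwards [hD (compU Φ j.taylor), hUx] with w h7 h8
      rw [h7, h8]
    have e2 := (hD (newDx Φ j.taylor (compU Φ j.taylor))).self_of_nhds
    have e3 := (pdx_congr (h := fun t x => pdx g t x / a t) e1).self_of_nhds
    have e4 : (prolong Φ j).uxx
      = newDx Φ j.taylor (newDx Φ j.taylor (compU Φ j.taylor)) j.t j.x := rfl
    rw [e4]
    dsimp only at e2 e3
    rw [e2, e3]
    simp only [pdx, deriv_div_const]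
    field_simp

/-! ### The parametrized transformations -/

/-- The functional parameters of a transformation
`t̃ = τ(t)`, `x̃ = a(t) x + c(t)`, `ũ = exp (A(t) x² + B(t) x + H(t)) u`. -/
structure Par where
  τ : ℝ → ℝ
  a : ℝ → ℝ
  c : ℝ → ℝ
  A : ℝ → ℝ
  B : ℝ → ℝ
  H : ℝ → ℝ

namespace Par

/-- The new space variable. -/
def X (p : Par) (t x : ℝ) : ℝ := p.a t * x + p.c t

/-- The exponent of the multiplier. -/
def P (p : Par) (t x : ℝ) : ℝ := p.A t * x ^ 2 + p.B t * x + p.H t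

/-- The transformation with an additional constant factor `σ` and a shift of `u` by `f(t, x)`. -/
def mapAff (p : Par) (σ : ℝ) (f : ℝ → ℝ → ℝ) (z : Space) : Space :=
  (p.τ z.1, p.X z.1 z.2.1, σ * Real.exp (p.P z.1 z.2.1) * (z.2.2 + f z.1 z.2.1))

/-- The transformation given by the parameters. -/
def map (p : Par) : Space → Space := p.mapAff 1 fun _ _ => 0

/-- The change of the potential, `a² C̃ = C + Q`. -/
def Q (p : Par) (t x : ℝ) : ℝ :=
  (deriv p.A t + 4 * p.A t ^ 2) * x ^ 2 + (deriv p.B t + 4 * p.A t * p.B t) * x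
    + (deriv p.H t + p.B t ^ 2 - 2 * p.A t)

/-- The parameters are smooth at `t` and satisfy the determining equations. -/
structure Good (p : Par) (t : ℝ) : Prop where
  sτ : ContDiffAt ℝ ∞ p.τ t
  sa : ContDiffAt ℝ ∞ p.a t
  sc : ContDiffAt ℝ ∞ p.c t
  sA : ContDiffAt ℝ ∞ p.A t
  sB : ContDiffAt ℝ ∞ p.B t
  sH : ContDiffAt ℝ ∞ p.H t
  a_ne : p.a t ≠ 0
  dτ : HasDerivAt p.τ (p.a t ^ 2) t
  da : HasDerivAt p.a (-4 * p.a t * p.A t) t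
  dc : HasDerivAt p.c (-2 * p.a t * p.B t) t

variable {p : Par}

theorem Good.dA {t : ℝ} (h : p.Good t) : HasDerivAt p.A (deriv p.A t) t :=
  (h.sA.differentiableAt (by simp)).hasDerivAt
theorem Good.dB {t : ℝ} (h : p.Good t) : HasDerivAt p.B (deriv p.B t) t :=
  (h.sB.differentiableAt (by simp)).hasDerivAt
theorem Good.dH {t : ℝ} (h : p.Good t) : HasDerivAt p.H (deriv p.H t) t :=
  (h.sH.differentiableAt (by simp)).hasDerivAt

theorem hasDerivAt_P_x (p : Par) (t x : ℝ) :
    HasDerivAt (fun y => p.P t y) (2 * p.A t * x + p.B t) x := by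
  unfold P
  have h := (((hasDerivAt_id x).pow 2).const_mul (p.A t)).add ((hasDerivAt_id x).const_mul (p.B t))
  refine (h.add_const (p.H t)).congr_deriv ?_
  simp; ring

theorem Good.hasDerivAt_P_t {t : ℝ} (h : p.Good t) (x : ℝ) :
    HasDerivAt (fun s => p.P s x) (deriv p.A t * x ^ 2 + deriv p.B t * x + deriv p.H t) t := by
  unfold P
  exact ((h.dA.mul_const _).add (h.dB.mul_const _)).add h.dH

end Par

theorem contDiffAt_slice_right {f : ℝ → ℝ → ℝ} {t x : ℝ}
    (h : ContDiffAt ℝ ∞ (fun w : ℝ × ℝ => f w.1 w.2) (t, x)) : ContDiffAt ℝ ∞ (f t) x :=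
  ContDiffAt.comp x (f := fun y : ℝ => (t, y)) h (by fun_prop)

theorem contDiffAt_slice_left {f : ℝ → ℝ → ℝ} {t x : ℝ}
    (h : ContDiffAt ℝ ∞ (fun w : ℝ × ℝ => f w.1 w.2) (t, x)) :
    ContDiffAt ℝ ∞ (fun s => f s x) t :=
  ContDiffAt.comp t (f := fun s : ℝ => (s, x)) h (by fun_prop)

theorem contDiffAt_deriv {f : ℝ → ℝ} {x : ℝ} (h : ContDiffAt ℝ ∞ f x) :
    ContDiffAt ℝ ∞ (deriv f) x := by
  simpa [derivWithin_univ] using h.derivWithin (m := ∞) (by simp)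

/-- The equations in `Par.Good` give `x̃_t = -2a P_x`, which is exactly what cancels the terms with
`u_x`; `τ' = a²` matches the scales of `u_t` and `u_xx`. What survives is the heat operator plus
multiplication by `Q`. -/
theorem prolong_mapAff {Φ : Space → Space} {j : Jet} {p : Par} {σ : ℝ} {f : ℝ → ℝ → ℝ}
    (hΦ : ∀ᶠ z in 𝓝 j.1, Φ z = p.mapAff σ f z) (hp : ∀ᶠ t in 𝓝 j.t, p.Good t)
    (hf : ∀ᶠ w : ℝ × ℝ in 𝓝 (j.t, j.x), ContDiffAt ℝ ∞ (fun w : ℝ × ℝ => f w.1 w.2) w) :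
    Regular Φ j ∧ (prolong Φ j).ut - (prolong Φ j).uxx =
      σ * Real.exp (p.P j.t j.x) / p.a j.t ^ 2 *
        (j.ut - j.uxx + (pdt f j.t j.x - pdx (pdx f) j.t j.x)
          + p.Q j.t j.x * (j.u + f j.t j.x)) := by
  have hg := (tendsto_graph j).eventually hΦ
  have gp := hp.self_of_nhds
  have ha0 := gp.a_ne
  obtain ⟨hreg, h1, h2⟩ := prolong_fibred (Φ := Φ) (j := j) (τ := p.τ) (a := p.a) (c := p.c)
    (g := fun t x => σ * Real.exp (p.P t x) * (j.taylor t x + f t x))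
    (hg.mono fun w hw => by simp [compT, hw, Par.mapAff])
    (hg.mono fun w hw => by simp [compX, hw, Par.mapAff, Par.X])
    (hg.mono fun w hw => by simp [compU, hw, Par.mapAff])
    (hp.mono fun t ht => by rw [ht.dτ.deriv]; exact pow_ne_zero 2 ht.a_ne)
    (hp.mono fun t ht => ht.a_ne) gp.da gp.dc
  refine ⟨hreg, ?_⟩
  have dft : HasDerivAt (fun s => f s j.x) (pdt f j.t j.x) j.t :=
    ((contDiffAt_slice_left hf.self_of_nhds).differentiableAt (by simp)).hasDerivAt
  have dfx : ∀ᶠ y in 𝓝 j.x, HasDerivAt (fun y => f j.t y) (pdx f j.t y) y := by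
    filter_upwards [(tendsto_slice_right j.t j.x).eventually hf] with y hy
    exact ((contDiffAt_slice_right hy).differentiableAt (by simp)).hasDerivAt
  have dfxx : HasDerivAt (fun y => pdx f j.t y) (pdx (pdx f) j.t j.x) j.x :=
    ((contDiffAt_deriv (contDiffAt_slice_right hf.self_of_nhds)).differentiableAt
      (by simp)).hasDerivAt
  have e1 : pdt (fun t x => σ * Real.exp (p.P t x) * (j.taylor t x + f t x)) j.t j.x
      = σ * Real.exp (p.P j.t j.x) * ((deriv p.A j.t * j.x ^ 2 + deriv p.B j.t * j.x
        + deriv p.H j.t) * (j.u + f j.t j.x) + (j.ut + pdt f j.t j.x)) := by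
    have := (((gp.hasDerivAt_P_t j.x).exp.const_mul σ).mul
      ((j.hasDerivAt_taylor_t j.t j.x).add dft)).deriv
    refine Eq.trans this ?_
    simp; ring
  have e2 : ∀ᶠ y in 𝓝 j.x,
      pdx (fun t x => σ * Real.exp (p.P t x) * (j.taylor t x + f t x)) j.t y
      = σ * Real.exp (p.P j.t y) * ((2 * p.A j.t * y + p.B j.t) * (j.taylor j.t y + f j.t y)
        + (j.ux + j.uxx * (y - j.x) + pdx f j.t y)) := by
    filter_upwards [dfx] with y hy
    have := (((p.hasDerivAt_P_x j.t y).exp.const_mul σ).mul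
      ((j.hasDerivAt_taylor_x j.t y).add hy)).deriv
    refine Eq.trans this ?_
    simp; ring
  have e3 : pdx (pdx (fun t x => σ * Real.exp (p.P t x) * (j.taylor t x + f t x))) j.t j.x
      = σ * Real.exp (p.P j.t j.x) * (((2 * p.A j.t * j.x + p.B j.t) ^ 2 + 2 * p.A j.t)
          * (j.u + f j.t j.x) + 2 * (2 * p.A j.t * j.x + p.B j.t) * (j.ux + pdx f j.t j.x)
          + (j.uxx + pdx (pdx f) j.t j.x)) := by
    have l1 : HasDerivAt (fun y : ℝ => 2 * p.A j.t * y + p.B j.t) (2 * p.A j.t) j.x :=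
      (((hasDerivAt_id j.x).const_mul (2 * p.A j.t)).add_const _).congr_deriv (by simp)
    have l2 : HasDerivAt (fun y : ℝ => j.ux + j.uxx * (y - j.x)) j.uxx j.x :=
      ((((hasDerivAt_id j.x).sub_const j.x).const_mul j.uxx).const_add _).congr_deriv (by simp)
    have := (((p.hasDerivAt_P_x j.t j.x).exp.const_mul σ).mul
      ((l1.mul ((j.hasDerivAt_taylor_x j.t j.x).add dfx.self_of_nhds)).add
        (l2.add dfxx))).deriv
    refine Eq.trans (EventuallyEq.deriv_eq e2) (Eq.trans this ?_)
    simp; ring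
  have e2' := e2.self_of_nhds
  simp only [Jet.taylor_self, sub_self, mul_zero, add_zero] at e2'
  rw [h1, h2, e1, e3, gp.dτ.deriv, e2']
  unfold Par.Q
  field_simp
  ring

/-! ### Partial derivatives on the space of `(t, x, u)` -/

def dT (K : Space → ℝ) (z : Space) : ℝ := fderiv ℝ K z (1, 0, 0)
def dX (K : Space → ℝ) (z : Space) : ℝ := fderiv ℝ K z (0, 1, 0)
def dU (K : Space → ℝ) (z : Space) : ℝ := fderiv ℝ K z (0, 0, 1)

theorem fderiv_apply_eq (K : Space → ℝ) (z v : Space) :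
    fderiv ℝ K z v = v.1 * dT K z + v.2.1 * dX K z + v.2.2 * dU K z := by
  have : v = v.1 • ((1, 0, 0) : Space) + v.2.1 • ((0, 1, 0) : Space)
      + v.2.2 • ((0, 0, 1) : Space) := by
    ext <;> simp
  conv_lhs => rw [this]
  simp only [map_add, map_smul, smul_eq_mul, dT, dX, dU]

section Smooth

variable {K : Space → ℝ} {z : Space}

theorem contDiffAt_fderiv_apply (h : ContDiffAt ℝ ∞ K z) (v : Space) :
    ContDiffAt ℝ ∞ (fun y => fderiv ℝ K y v) z :=
  (h.fderiv_right (m := ∞) (by simp)).clm_apply contDiffAt_const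

theorem contDiffAt_dT (h : ContDiffAt ℝ ∞ K z) : ContDiffAt ℝ ∞ (dT K) z :=
  contDiffAt_fderiv_apply h _
theorem contDiffAt_dX (h : ContDiffAt ℝ ∞ K z) : ContDiffAt ℝ ∞ (dX K) z :=
  contDiffAt_fderiv_apply h _
theorem contDiffAt_dU (h : ContDiffAt ℝ ∞ K z) : ContDiffAt ℝ ∞ (dU K) z :=
  contDiffAt_fderiv_apply h _

theorem fderiv_fderiv_comm (h : ContDiffAt ℝ ∞ K z) (v w : Space) :
    fderiv ℝ (fun y => fderiv ℝ K y v) z w = fderiv ℝ (fun y => fderiv ℝ K y w) z v := by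
  have hs : IsSymmSndFDerivAt ℝ K z := h.isSymmSndFDerivAt (by
    simpa using (WithTop.coe_le_coe.2 (le_top : (2 : ℕ∞) ≤ ⊤) : ((2 : ℕ∞) : WithTop ℕ∞) ≤ ∞))
  have hd : DifferentiableAt ℝ (fderiv ℝ K) z :=
    (h.fderiv_right (m := ∞) (by simp)).differentiableAt (by simp)
  have e : ∀ v w : Space, fderiv ℝ (fun y => fderiv ℝ K y v) z w
      = fderiv ℝ (fderiv ℝ K) z w v := by
    intro v w
    rw [fderiv_clm_apply hd (differentiableAt_const v)]
    simp
  rw [e, e, hs]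

theorem dU_dX (h : ContDiffAt ℝ ∞ K z) : dU (dX K) z = dX (dU K) z := fderiv_fderiv_comm h _ _
theorem dT_dX (h : ContDiffAt ℝ ∞ K z) : dT (dX K) z = dX (dT K) z := fderiv_fderiv_comm h _ _
theorem dU_dT (h : ContDiffAt ℝ ∞ K z) : dU (dT K) z = dT (dU K) z := fderiv_fderiv_comm h _ _

end Smooth

theorem hasDerivAt_along_t {K : Space → ℝ} {w : ℝ → ℝ} {w' s y : ℝ}
    (hK : ContDiffAt ℝ ∞ K (s, y, w s)) (hw : HasDerivAt w w' s) :
    HasDerivAt (fun r => K (r, y, w r)) (dT K (s, y, w s) + w' * dU K (s, y, w s)) s := by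
  have hc : HasDerivAt (fun r => ((r, y, w r) : Space)) ((1, 0, w') : Space) s :=
    (hasDerivAt_id s).prodMk ((hasDerivAt_const s y).prodMk hw)
  have := (hK.differentiableAt (by simp)).hasFDerivAt.comp_hasDerivAt s hc
  refine this.congr_deriv ?_
  rw [fderiv_apply_eq]; simp

theorem hasDerivAt_along_x {K : Space → ℝ} {w : ℝ → ℝ} {w' s y : ℝ}
    (hK : ContDiffAt ℝ ∞ K (s, y, w y)) (hw : HasDerivAt w w' y) :
    HasDerivAt (fun r => K (s, r, w r)) (dX K (s, y, w y) + w' * dU K (s, y, w y)) y := by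
  have hc : HasDerivAt (fun r => ((s, r, w r) : Space)) ((0, 1, w') : Space) y :=
    (hasDerivAt_const y s).prodMk ((hasDerivAt_id y).prodMk hw)
  have := (hK.differentiableAt (by simp)).hasFDerivAt.comp_hasDerivAt y hc
  refine this.congr_deriv ?_
  rw [fderiv_apply_eq]; simp

theorem hasDerivAt_along_u {K : Space → ℝ} {s y v : ℝ} (hK : ContDiffAt ℝ ∞ K (s, y, v)) :
    HasDerivAt (fun r => K (s, y, r)) (dU K (s, y, v)) v := by
  have hc : HasDerivAt (fun r => ((s, y, r) : Space)) ((0, 0, 1) : Space) v :=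
    (hasDerivAt_const v s).prodMk ((hasDerivAt_const v y).prodMk (hasDerivAt_id v))
  have := (hK.differentiableAt (by simp)).hasFDerivAt.comp_hasDerivAt v hc
  refine this.congr_deriv ?_
  rw [fderiv_apply_eq]; simp

theorem fderiv_zero_of_eventually {K : Space → ℝ} {z : Space} {k : ℝ} (h : ∀ᶠ y in 𝓝 z, K y = k)
    (v : Space) : fderiv ℝ K z v = 0 := by
  rw [EventuallyEq.fderiv_eq (f₁ := K) (f := fun _ => k) h]; simp

/-- The components of a map of the space. -/
def cT (Φ : Space → Space) (z : Space) : ℝ := (Φ z).1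
def cX (Φ : Space → Space) (z : Space) : ℝ := (Φ z).2.1
def cU (Φ : Space → Space) (z : Space) : ℝ := (Φ z).2.2

/-- The Jacobian determinant. -/
def jacDet (Φ : Space → Space) (z : Space) : ℝ :=
  dT (cT Φ) z * (dX (cX Φ) z * dU (cU Φ) z - dU (cX Φ) z * dX (cU Φ) z)
    - dX (cT Φ) z * (dT (cX Φ) z * dU (cU Φ) z - dU (cX Φ) z * dT (cU Φ) z)
    + dU (cT Φ) z * (dT (cX Φ) z * dX (cU Φ) z - dX (cX Φ) z * dT (cU Φ) z)

theorem IsPointTransformation.contDiffAt {Ω : Set Space} {Φ : Space → Space}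
    (h : IsPointTransformation Ω Φ) {z : Space} (hz : z ∈ Ω) : ContDiffAt ℝ ∞ Φ z :=
  (h.smooth z hz).contDiffAt (h.isOpen.mem_nhds hz)

/-- The preimages of the three basis vectors are the columns of a right inverse of the Jacobian
matrix, so its determinant cannot vanish. -/
theorem jacDet_ne_zero {Φ : Space → Space} {z : Space} (hs : ContDiffAt ℝ ∞ Φ z)
    (hb : Function.Bijective (fderiv ℝ Φ z)) : jacDet Φ z ≠ 0 := by
  have hd : DifferentiableAt ℝ Φ z := hs.differentiableAt (by simp)
  have eT : ∀ v, (fderiv ℝ Φ z v).1 = fderiv ℝ (cT Φ) z v := fun v => by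
    have := (hd.hasFDerivAt.fst).fderiv
    rw [show cT Φ = fun z => (Φ z).1 from rfl, this]; rfl
  have eX : ∀ v, (fderiv ℝ Φ z v).2.1 = fderiv ℝ (cX Φ) z v := fun v => by
    have := (hd.hasFDerivAt.snd.fst).fderiv
    rw [show cX Φ = fun z => (Φ z).2.1 from rfl, this]; rfl
  have eU : ∀ v, (fderiv ℝ Φ z v).2.2 = fderiv ℝ (cU Φ) z v := fun v => by
    have := (hd.hasFDerivAt.snd.snd).fderiv
    rw [show cU Φ = fun z => (Φ z).2.2 from rfl, this]; rfl
  simp only [fderiv_apply_eq] at eT eX eU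
  obtain ⟨v1, h1⟩ := hb.2 (1, 0, 0)
  obtain ⟨v2, h2⟩ := hb.2 (0, 1, 0)
  obtain ⟨v3, h3⟩ := hb.2 (0, 0, 1)
  have a1 := eT v1; have a2 := eX v1; have a3 := eU v1
  have b1 := eT v2; have b2 := eX v2; have b3 := eU v2
  have c1 := eT v3; have c2 := eX v3; have c3 := eU v3
  rw [h1] at a1 a2 a3
  rw [h2] at b1 b2 b3
  rw [h3] at c1 c2 c3
  simp only at a1 a2 a3 b1 b2 b3 c1 c2 c3
  intro h0
  unfold jacDet at h0
  have key : (!![dT (cT Φ) z, dX (cT Φ) z, dU (cT Φ) z; dT (cX Φ) z, dX (cX Φ) z, dU (cX Φ) z;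
      dT (cU Φ) z, dX (cU Φ) z, dU (cU Φ) z] : Matrix (Fin 3) (Fin 3) ℝ)
      * !![v1.1, v2.1, v3.1; v1.2.1, v2.2.1, v3.2.1; v1.2.2, v2.2.2, v3.2.2] = 1 := by
    ext i k
    fin_cases i <;> fin_cases k <;> simp [Matrix.mul_apply, Fin.sum_univ_three] <;> linarith
  have := congrArg Matrix.det key
  rw [Matrix.det_mul, Matrix.det_one, Matrix.det_fin_three] at this
  simp only [Matrix.of_apply, Matrix.cons_val', Matrix.cons_val_zero, Matrix.cons_val_one,
    Matrix.cons_val] at this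
  have h0' : dT (cT Φ) z * dX (cX Φ) z * dU (cU Φ) z - dT (cT Φ) z * dU (cX Φ) z * dX (cU Φ) z
      - dX (cT Φ) z * dT (cX Φ) z * dU (cU Φ) z + dX (cT Φ) z * dU (cX Φ) z * dT (cU Φ) z
      + dU (cT Φ) z * dT (cX Φ) z * dX (cU Φ) z - dU (cT Φ) z * dX (cX Φ) z * dT (cU Φ) z = 0 := by
    linear_combination h0
  rw [h0', zero_mul] at this
  exact zero_ne_one this

/-! ### The structure of admissible transformations -/

section Structure

variable {Ω : Set Space} {Φ : Space → Space}

theorem IsPointTransformation.cT (h : IsPointTransformation Ω Φ) {z : Space} (hz : z ∈ Ω) :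
    ContDiffAt ℝ ∞ (cT Φ) z := (h.contDiffAt hz).fst
theorem IsPointTransformation.cX (h : IsPointTransformation Ω Φ) {z : Space} (hz : z ∈ Ω) :
    ContDiffAt ℝ ∞ (cX Φ) z := (h.contDiffAt hz).snd.fst
theorem IsPointTransformation.cU (h : IsPointTransformation Ω Φ) {z : Space} (hz : z ∈ Ω) :
    ContDiffAt ℝ ∞ (cU Φ) z := (h.contDiffAt hz).snd.snd

/-- The derivatives of the Taylor polynomial of a jet. -/
def Jet.tayT (j : Jet) (w : ℝ × ℝ) : ℝ := j.ut + j.utt * (w.1 - j.t) + j.utx * (w.2 - j.x)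
def Jet.tayX (j : Jet) (w : ℝ × ℝ) : ℝ := j.ux + j.utx * (w.1 - j.t) + j.uxx * (w.2 - j.x)

/-- The lift of a point of the plane to the graph of the Taylor polynomial. -/
def Jet.lift (j : Jet) (w : ℝ × ℝ) : Space := (w.1, w.2, j.taylor w.1 w.2)

@[simp] theorem Jet.lift_self (j : Jet) : j.lift (j.t, j.x) = j.1 := by
  simp [Jet.lift]; rfl
@[simp] theorem Jet.tayT_self (j : Jet) : j.tayT (j.t, j.x) = j.ut := by simp [Jet.tayT]
@[simp] theorem Jet.tayX_self (j : Jet) : j.tayX (j.t, j.x) = j.ux := by simp [Jet.tayX]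

theorem pdt_along {K : Space → ℝ} {j : Jet} {w : ℝ × ℝ} (hK : ContDiffAt ℝ ∞ K (j.lift w)) :
    pdt (fun t x => K (t, x, j.taylor t x)) w.1 w.2
      = dT K (j.lift w) + j.tayT w * dU K (j.lift w) :=
  (hasDerivAt_along_t (w := fun s => j.taylor s w.2) hK (j.hasDerivAt_taylor_t w.1 w.2)).deriv

theorem pdx_along {K : Space → ℝ} {j : Jet} {w : ℝ × ℝ} (hK : ContDiffAt ℝ ∞ K (j.lift w)) :
    pdx (fun t x => K (t, x, j.taylor t x)) w.1 w.2
      = dX K (j.lift w) + j.tayX w * dU K (j.lift w) :=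
  (hasDerivAt_along_x (w := fun y => j.taylor w.1 y) hK (j.hasDerivAt_taylor_x w.1 w.2)).deriv

theorem eventually_lift {j : Jet} {P : Space → Prop} (h : ∀ᶠ z in 𝓝 j.1, P z) :
    ∀ᶠ w in 𝓝 (j.t, j.x), P (j.lift w) := (tendsto_graph j).eventually h

/-- The minors of a pair of gradients. -/
def mTX (K L : Space → ℝ) (z : Space) : ℝ := dT K z * dX L z - dX K z * dT L z
def mTU (K L : Space → ℝ) (z : Space) : ℝ := dT K z * dU L z - dU K z * dT L z
def mUX (K L : Space → ℝ) (z : Space) : ℝ := dU K z * dX L z - dX K z * dU L z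

/-- The Jacobian of a pair of functions along a graph, in terms of `u_t = p` and `u_x = q`. -/
def mTot (K L : Space → ℝ) (z : Space) (p q : ℝ) : ℝ := mTX K L z + q * mTU K L z + p * mUX K L z

/-- The part of the total derivatives of `mTot` that does not contain second derivatives. -/
def mTotT (K L : Space → ℝ) (z : Space) (p q : ℝ) : ℝ :=
  (dT (mTX K L) z + p * dU (mTX K L) z) + q * (dT (mTU K L) z + p * dU (mTU K L) z)
    + p * (dT (mUX K L) z + p * dU (mUX K L) z)
def mTotX (K L : Space → ℝ) (z : Space) (p q : ℝ) : ℝ :=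
  (dX (mTX K L) z + q * dU (mTX K L) z) + q * (dX (mTU K L) z + q * dU (mTU K L) z)
    + p * (dX (mUX K L) z + q * dU (mUX K L) z)

theorem hasDerivAt_mTot_t {K L : Space → ℝ} {j : Jet} (hK : ContDiffAt ℝ ∞ K j.1)
    (hL : ContDiffAt ℝ ∞ L j.1) :
    HasDerivAt (fun s => mTot K L (j.lift (s, j.x)) (j.tayT (s, j.x)) (j.tayX (s, j.x)))
      (mTotT K L j.1 j.ut j.ux + j.utx * mTU K L j.1 + j.utt * mUX K L j.1) j.t := by
  have hl : j.1 = ((j.t, j.x, j.taylor j.t j.x) : Space) := by rw [Jet.taylor_self]; rfl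
  have s1 : ContDiffAt ℝ ∞ (mTX K L) j.1 :=
    ((contDiffAt_dT hK).mul (contDiffAt_dX hL)).sub ((contDiffAt_dX hK).mul (contDiffAt_dT hL))
  have s2 : ContDiffAt ℝ ∞ (mTU K L) j.1 :=
    ((contDiffAt_dT hK).mul (contDiffAt_dU hL)).sub ((contDiffAt_dU hK).mul (contDiffAt_dT hL))
  have s3 : ContDiffAt ℝ ∞ (mUX K L) j.1 :=
    ((contDiffAt_dU hK).mul (contDiffAt_dX hL)).sub ((contDiffAt_dX hK).mul (contDiffAt_dU hL))
  have hw := j.hasDerivAt_taylor_t j.t j.x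
  have d : ∀ M : Space → ℝ, ContDiffAt ℝ ∞ M j.1 → HasDerivAt (fun s => M (j.lift (s, j.x)))
      (dT M j.1 + j.ut * dU M j.1) j.t := by
    intro M hM
    rw [hl] at hM
    have := hasDerivAt_along_t (w := fun s => j.taylor s j.x) hM hw
    rw [← hl] at this
    exact this.congr_deriv (by simp)
  have hq : HasDerivAt (fun s => j.tayX (s, j.x)) j.utx j.t := by
    unfold Jet.tayX
    have := ((((hasDerivAt_id j.t).sub_const j.t).const_mul j.utx).const_add j.ux).add_const
      (j.uxx * (j.x - j.x))
    exact this.congr_deriv (by simp)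
  have hp : HasDerivAt (fun s => j.tayT (s, j.x)) j.utt j.t := by
    unfold Jet.tayT
    have := ((((hasDerivAt_id j.t).sub_const j.t).const_mul j.utt).const_add j.ut).add_const
      (j.utx * (j.x - j.x))
    exact this.congr_deriv (by simp)
  have := ((d _ s1).add (hq.mul (d _ s2))).add (hp.mul (d _ s3))
  refine this.congr_deriv ?_
  simp only [Jet.lift_self, Jet.tayT_self, Jet.tayX_self, mTotT]
  ring

theorem hasDerivAt_mTot_x {K L : Space → ℝ} {j : Jet} (hK : ContDiffAt ℝ ∞ K j.1)
    (hL : ContDiffAt ℝ ∞ L j.1) :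
    HasDerivAt (fun y => mTot K L (j.lift (j.t, y)) (j.tayT (j.t, y)) (j.tayX (j.t, y)))
      (mTotX K L j.1 j.ut j.ux + j.uxx * mTU K L j.1 + j.utx * mUX K L j.1) j.x := by
  have hl : j.1 = ((j.t, j.x, j.taylor j.t j.x) : Space) := by rw [Jet.taylor_self]; rfl
  have s1 : ContDiffAt ℝ ∞ (mTX K L) j.1 :=
    ((contDiffAt_dT hK).mul (contDiffAt_dX hL)).sub ((contDiffAt_dX hK).mul (contDiffAt_dT hL))
  have s2 : ContDiffAt ℝ ∞ (mTU K L) j.1 :=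
    ((contDiffAt_dT hK).mul (contDiffAt_dU hL)).sub ((contDiffAt_dU hK).mul (contDiffAt_dT hL))
  have s3 : ContDiffAt ℝ ∞ (mUX K L) j.1 :=
    ((contDiffAt_dU hK).mul (contDiffAt_dX hL)).sub ((contDiffAt_dX hK).mul (contDiffAt_dU hL))
  have hw := j.hasDerivAt_taylor_x j.t j.x
  have d : ∀ M : Space → ℝ, ContDiffAt ℝ ∞ M j.1 → HasDerivAt (fun y => M (j.lift (j.t, y)))
      (dX M j.1 + j.ux * dU M j.1) j.x := by
    intro M hM
    rw [hl] at hM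
    have := hasDerivAt_along_x (w := fun y => j.taylor j.t y) hM hw
    rw [← hl] at this
    exact this.congr_deriv (by simp)
  have hq : HasDerivAt (fun y => j.tayX (j.t, y)) j.uxx j.x := by
    unfold Jet.tayX
    have := (((hasDerivAt_id j.x).sub_const j.x).const_mul j.uxx).const_add
      (j.ux + j.utx * (j.t - j.t))
    exact this.congr_deriv (by simp)
  have hp : HasDerivAt (fun y => j.tayT (j.t, y)) j.utx j.x := by
    unfold Jet.tayT
    have := (((hasDerivAt_id j.x).sub_const j.x).const_mul j.utx).const_add
      (j.ut + j.utt * (j.t - j.t))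
    exact this.congr_deriv (by simp)
  have := ((d _ s1).add (hq.mul (d _ s2))).add (hp.mul (d _ s3))
  refine this.congr_deriv ?_
  simp only [Jet.lift_self, Jet.tayT_self, Jet.tayX_self, mTotX]
  ring

/-- The products of `u_t` and `u_x` cancel in the two-by-two determinant, so the Jacobian along a
graph is affine in the first derivatives, with the minors as coefficients. -/
theorem jac_eq_mTot (hΦ : IsPointTransformation Ω Φ) {j : Jet} {w : ℝ × ℝ}
    (hw : j.lift w ∈ Ω) :
    jac Φ j.taylor w.1 w.2 = mTot (cT Φ) (cX Φ) (j.lift w) (j.tayT w) (j.tayX w) := by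
  unfold jac
  have h1 : pdt (compT Φ j.taylor) w.1 w.2 = _ := pdt_along (K := cT Φ) (hΦ.cT hw)
  have h2 : pdx (compT Φ j.taylor) w.1 w.2 = _ := pdx_along (K := cT Φ) (hΦ.cT hw)
  have h3 : pdt (compX Φ j.taylor) w.1 w.2 = _ := pdt_along (K := cX Φ) (hΦ.cX hw)
  have h4 : pdx (compX Φ j.taylor) w.1 w.2 = _ := pdx_along (K := cX Φ) (hΦ.cX hw)
  rw [h1, h2, h3, h4]
  unfold mTot mTX mTU mUX
  ring

theorem newDx_compU (hΦ : IsPointTransformation Ω Φ) {j : Jet} {w : ℝ × ℝ}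
    (hw : j.lift w ∈ Ω) :
    newDx Φ j.taylor (compU Φ j.taylor) w.1 w.2
      = mTot (cT Φ) (cU Φ) (j.lift w) (j.tayT w) (j.tayX w)
        / mTot (cT Φ) (cX Φ) (j.lift w) (j.tayT w) (j.tayX w) := by
  unfold newDx
  rw [jac_eq_mTot hΦ hw]
  have h1 : pdt (compT Φ j.taylor) w.1 w.2 = _ := pdt_along (K := cT Φ) (hΦ.cT hw)
  have h2 : pdx (compT Φ j.taylor) w.1 w.2 = _ := pdx_along (K := cT Φ) (hΦ.cT hw)
  have h3 : pdt (compU Φ j.taylor) w.1 w.2 = _ := pdt_along (K := cU Φ) (hΦ.cU hw)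
  have h4 : pdx (compU Φ j.taylor) w.1 w.2 = _ := pdx_along (K := cU Φ) (hΦ.cU hw)
  rw [h1, h2, h3, h4]
  congr 1
  unfold mTot mTX mTU mUX
  ring

theorem lift_mem_of_mem (hΦ : IsPointTransformation Ω Φ) {j : Jet} (hj : j.1 ∈ Ω) :
    ∀ᶠ w in 𝓝 (j.t, j.x), j.lift w ∈ Ω := eventually_lift (hΦ.isOpen.mem_nhds hj)

theorem regular_iff (hΦ : IsPointTransformation Ω Φ) {j : Jet} (hj : j.1 ∈ Ω) :
    Regular Φ j ↔ mTot (cT Φ) (cX Φ) j.1 j.ut j.ux ≠ 0 := by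
  have := jac_eq_mTot hΦ (j := j) (w := (j.t, j.x)) (by simpa using hj)
  simp only [Jet.lift_self, Jet.tayT_self, Jet.tayX_self] at this
  rw [Regular, this]

theorem prolong_ut_eq (hΦ : IsPointTransformation Ω Φ) {j : Jet} (hj : j.1 ∈ Ω) :
    (prolong Φ j).ut = ((dT (cU Φ) j.1 + j.ut * dU (cU Φ) j.1)
        * (dX (cX Φ) j.1 + j.ux * dU (cX Φ) j.1)
      - (dX (cU Φ) j.1 + j.ux * dU (cU Φ) j.1) * (dT (cX Φ) j.1 + j.ut * dU (cX Φ) j.1))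
      / mTot (cT Φ) (cX Φ) j.1 j.ut j.ux := by
  have hw : j.lift (j.t, j.x) ∈ Ω := by simpa using hj
  have e : (prolong Φ j).ut = newDt Φ j.taylor (compU Φ j.taylor) j.t j.x := rfl
  rw [e]
  unfold newDt
  have h0 := jac_eq_mTot hΦ hw
  have h1 : pdt (compX Φ j.taylor) j.t j.x = _ := pdt_along (w := (j.t, j.x)) (hΦ.cX hw)
  have h2 : pdx (compX Φ j.taylor) j.t j.x = _ := pdx_along (w := (j.t, j.x)) (hΦ.cX hw)
  have h3 : pdt (compU Φ j.taylor) j.t j.x = _ := pdt_along (w := (j.t, j.x)) (hΦ.cU hw)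
  have h4 : pdx (compU Φ j.taylor) j.t j.x = _ := pdx_along (w := (j.t, j.x)) (hΦ.cU hw)
  simp only [Jet.lift_self, Jet.tayT_self, Jet.tayX_self] at h0 h1 h2 h3 h4
  rw [h0, h1, h2, h3, h4]

/-- By `newDx_compU` the first derivative is a quotient of two values of `mTot`; the quotient rule
then displays how the result depends on `u_tt`, `u_tx`, `u_xx`, which is what the splitting of the
determining equations needs. -/
theorem prolong_uxx_eq (hΦ : IsPointTransformation Ω Φ) {j : Jet} (hj : j.1 ∈ Ω)
    {J N : ℝ} (hJ : mTot (cT Φ) (cX Φ) j.1 j.ut j.ux = J)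
    (hN : mTot (cT Φ) (cU Φ) j.1 j.ut j.ux = N) (hJ0 : J ≠ 0) :
    (prolong Φ j).uxx =
      ((dT (cT Φ) j.1 + j.ut * dU (cT Φ) j.1)
        * (((mTotX (cT Φ) (cU Φ) j.1 j.ut j.ux + j.uxx * mTU (cT Φ) (cU Φ) j.1
            + j.utx * mUX (cT Φ) (cU Φ) j.1) * J
          - N * (mTotX (cT Φ) (cX Φ) j.1 j.ut j.ux + j.uxx * mTU (cT Φ) (cX Φ) j.1
            + j.utx * mUX (cT Φ) (cX Φ) j.1)) / J ^ 2)
      - (dX (cT Φ) j.1 + j.ux * dU (cT Φ) j.1)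
        * (((mTotT (cT Φ) (cU Φ) j.1 j.ut j.ux + j.utx * mTU (cT Φ) (cU Φ) j.1
            + j.utt * mUX (cT Φ) (cU Φ) j.1) * J
          - N * (mTotT (cT Φ) (cX Φ) j.1 j.ut j.ux + j.utx * mTU (cT Φ) (cX Φ) j.1
            + j.utt * mUX (cT Φ) (cX Φ) j.1)) / J ^ 2)) / J := by
  have hw : j.lift (j.t, j.x) ∈ Ω := by simpa using hj
  have hG := (lift_mem_of_mem hΦ hj).mono fun w hw => newDx_compU hΦ hw
  have e : (prolong Φ j).uxx
      = newDx Φ j.taylor (newDx Φ j.taylor (compU Φ j.taylor)) j.t j.x := rfl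
  have h0 := jac_eq_mTot hΦ hw
  have h1 : pdt (compT Φ j.taylor) j.t j.x = _ := pdt_along (w := (j.t, j.x)) (hΦ.cT hw)
  have h2 : pdx (compT Φ j.taylor) j.t j.x = _ := pdx_along (w := (j.t, j.x)) (hΦ.cT hw)
  simp only [Jet.lift_self, Jet.tayT_self, Jet.tayX_self] at h0 h1 h2
  have h3 := (HasDerivAt.congr_of_eventuallyEq
    (f₁ := fun s => newDx Φ j.taylor (compU Φ j.taylor) s j.x)
    ((hasDerivAt_mTot_t (hΦ.cT hj) (hΦ.cU hj)).div
      (hasDerivAt_mTot_t (hΦ.cT hj) (hΦ.cX hj)) (by simpa [hJ] using hJ0))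
    ((tendsto_slice_left j.t j.x).eventually hG)).deriv
  have h4 := (HasDerivAt.congr_of_eventuallyEq
    (f₁ := fun y => newDx Φ j.taylor (compU Φ j.taylor) j.t y)
    ((hasDerivAt_mTot_x (hΦ.cT hj) (hΦ.cU hj)).div
      (hasDerivAt_mTot_x (hΦ.cT hj) (hΦ.cX hj)) (by simpa [hJ] using hJ0))
    ((tendsto_slice_right j.t j.x).eventually hG)).deriv
  change pdt (newDx Φ j.taylor (compU Φ j.taylor)) j.t j.x = _ at h3
  change pdx (newDx Φ j.taylor (compU Φ j.taylor)) j.t j.x = _ at h4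
  rw [e, newDx, h0, h1, h2, h3, h4]
  simp only [Jet.lift_self, Jet.tayT_self, Jet.tayX_self, hJ, hN]

/-- If a product of two affine functions of `(p, q)` vanishes identically, one of them is zero. -/
theorem exists_affine_ne_zero {a0 a1 b0 b1 b2 : ℝ} (ha : a0 ≠ 0 ∨ a1 ≠ 0)
    (hb : b0 ≠ 0 ∨ b1 ≠ 0 ∨ b2 ≠ 0) :
    ∃ p q : ℝ, a0 + q * a1 ≠ 0 ∧ b0 + q * b1 + p * b2 ≠ 0 := by
  by_contra! h
  have key : ∀ p q : ℝ, (a0 + q * a1) * (b0 + q * b1 + p * b2) = 0 := by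
    intro p q
    by_cases hq : a0 + q * a1 = 0
    · simp [hq]
    · simp [h p q hq]
  have k00 := key 0 0; have k01 := key 0 1; have k0m := key 0 (-1)
  have k10 := key 1 0; have k11 := key 1 1
  have k02 := key 0 2
  have e00 : a0 * b0 = 0 := by linear_combination k00
  have e11 : a1 * b1 = 0 := by linear_combination (k01 + k0m) / 2 - k00
  have e01 : a0 * b1 + a1 * b0 = 0 := by linear_combination (k01 - k0m) / 2
  have e02 : a0 * b2 = 0 := by linear_combination k10 - k00
  have e12 : a1 * b2 = 0 := by linear_combination k11 - k01 - (k10 - k00)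
  rcases ha with ha | ha
  · have hb0 : b0 = 0 := by simpa [ha] using e00
    have hb2 : b2 = 0 := by simpa [ha] using e02
    have hb1 : b1 = 0 := by rw [hb0] at e01; simpa [ha] using e01
    simp [hb0, hb1, hb2] at hb
  · have hb1 : b1 = 0 := by simpa [ha] using e11
    have hb2 : b2 = 0 := by simpa [ha] using e12
    have hb0 : b0 = 0 := by rw [hb1] at e01; simpa [ha] using e01
    simp [hb0, hb1, hb2] at hb

/-- `t̃` depends on `t` only. -/
theorem dX_dU_cT_eq_zero {T : Triple} (hT : IsAdmissible T) {z : Space} (hz : z ∈ T.dom) :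
    dX (cT T.map) z = 0 ∧ dU (cT T.map) z = 0 := by
  have hΦ := hT.point
  have hdet := jacDet_ne_zero (hΦ.contDiffAt hz) (hΦ.bijective z hz)
  by_contra hcon
  have ha : dX (cT T.map) z ≠ 0 ∨ dU (cT T.map) z ≠ 0 := by
    by_contra! h; exact hcon h
  have hb : mTX (cT T.map) (cX T.map) z ≠ 0 ∨ mTU (cT T.map) (cX T.map) z ≠ 0 ∨
      mUX (cT T.map) (cX T.map) z ≠ 0 := by
    by_contra! h
    obtain ⟨h1, h2, h3⟩ := h
    refine hdet ?_
    unfold mTX at h1; unfold mTU at h2; unfold mUX at h3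
    unfold jacDet
    linear_combination dU (cU T.map) z * h1 - dX (cU T.map) z * h2 - dT (cU T.map) z * h3
  -- Values of `u_t` and `u_x` at which `D_x t̃` is nonzero and the prolongation is defined; both
  -- conditions are affine in `(p, q)`.
  obtain ⟨p, q, hD, hJ0⟩ := exists_affine_ne_zero ha hb
  have hJ0' : mTot (cT T.map) (cX T.map) z p q ≠ 0 := hJ0
  set J := mTot (cT T.map) (cX T.map) z p q with hJ
  set N := mTot (cT T.map) (cU T.map) z p q with hN
  have hxs : z.2.1 ∈ T.src.dom := by rw [hT.src_dom]; exact ⟨z, hz, rfl⟩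
  -- The equation only ties `u_xx` to `u_t` and `u`, so `u_tt` and `u_tx` are free parameters of the
  -- jets on it. The left side `ũ_t̃` does not contain them, so their coefficients on the right must
  -- vanish.
  have main : ∀ utt utx : ℝ, _ := fun utt utx => by
    have hm := (hT.maps (z, (p, q, utt, utx, p - T.src.fn z.2.1 * z.2.2)) hz
      ((regular_iff hΦ hz).2 hJ0') ⟨hxs, by simp [Jet.ut, Jet.uxx, Jet.x, Jet.u]⟩).2
    rw [prolong_ut_eq hΦ hz, prolong_uxx_eq hΦ hz hJ.symm hN.symm hJ0'] at hm
    exact hm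
  have m00 := main 0 0; have m10 := main 1 0; have m01 := main 0 1
  simp only [Jet.ut, Jet.ux, Jet.utt, Jet.utx, Jet.uxx, Jet.x, Jet.u, prolong] at m00 m10 m01
  -- The coefficient of `u_tt`, divided by the nonzero `D_x t̃`.
  have r2 : mUX (cT T.map) (cU T.map) z * J - N * mUX (cT T.map) (cX T.map) z = 0 := by
    have : (dX (cT T.map) z + q * dU (cT T.map) z) *
      (mUX (cT T.map) (cU T.map) z * J - N * mUX (cT T.map) (cX T.map) z) = 0 := by
      have h := m10.symm.trans m00
      field_simp at h
      linear_combination -h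
    exact (mul_eq_zero.1 this).resolve_left hD
  have r1 : mTU (cT T.map) (cU T.map) z * J - N * mTU (cT T.map) (cX T.map) z = 0 := by
    have : (dX (cT T.map) z + q * dU (cT T.map) z) *
      (mTU (cT T.map) (cU T.map) z * J - N * mTU (cT T.map) (cX T.map) z) = 0 := by
      have h := m01.symm.trans m00
      field_simp at h
      linear_combination -h + (dT (cT T.map) z + p * dU (cT T.map) z) * r2
    exact (mul_eq_zero.1 this).resolve_left hD
  have r0 : mTX (cT T.map) (cU T.map) z * J - N * mTX (cT T.map) (cX T.map) z = 0 := by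
    have e1 : J = mTX (cT T.map) (cX T.map) z + q * mTU (cT T.map) (cX T.map) z
      + p * mUX (cT T.map) (cX T.map) z := hJ
    have e2 : N = mTX (cT T.map) (cU T.map) z + q * mTU (cT T.map) (cU T.map) z
      + p * mUX (cT T.map) (cU T.map) z := hN
    linear_combination -q * r1 - p * r2 + N * e1 - J * e2
  -- The relations `r0`, `r1`, `r2` say that the gradient of `t̃` is parallel to `J ∇ũ - N ∇x̃`;
  -- expanding the determinant against `∇x̃` leaves `J` times the full Jacobian.
  have : J * jacDet T.map z = 0 := by
    unfold mTX at r0; unfold mTU at r1; unfold mUX at r2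
    unfold jacDet
    linear_combination -dU (cX T.map) z * r0 + dX (cX T.map) z * r1 + dT (cX T.map) z * r2
  exact (mul_ne_zero hJ0' hdet) this

end Structure

/-! ### Splitting of the determining equations once `t̃` is a function of `t` -/

section Structure

theorem fderiv_mul_apply {K L : Space → ℝ} {z : Space} (hK : ContDiffAt ℝ ∞ K z)
    (hL : ContDiffAt ℝ ∞ L z) (v : Space) :
    fderiv ℝ (fun y => K y * L y) z v = K z * fderiv ℝ L z v + L z * fderiv ℝ K z v := by
  have := ((hK.differentiableAt (by simp)).hasFDerivAt.mul
    (hL.differentiableAt (by simp)).hasFDerivAt).fderiv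
  rw [show (fun y => K y * L y) = K * L from rfl, this]; simp

/-- When `A` depends on `t` only, its `x`- and `u`-derivatives vanish near `z`, hence so do those of
`A_t`, and all minors reduce to `A_t` times derivatives of `L`. -/
theorem mTotX_fibred {A L : Space → ℝ} {z : Space} (hA : ContDiffAt ℝ ∞ A z)
    (hL : ContDiffAt ℝ ∞ L z) (h0 : ∀ᶠ y in 𝓝 z, dX A y = 0 ∧ dU A y = 0) (p q : ℝ) :
    mTotX A L z p q
      = dT A z * (dX (dX L) z + 2 * q * dX (dU L) z + q ^ 2 * dU (dU L) z) := by
  have e1 : mTX A L =ᶠ[𝓝 z] fun y => dT A y * dX L y := by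
    filter_upwards [h0] with y hy; simp [mTX, hy.1]
  have e2 : mTU A L =ᶠ[𝓝 z] fun y => dT A y * dU L y := by
    filter_upwards [h0] with y hy; simp [mTU, hy.2]
  have e3 : ∀ᶠ y in 𝓝 z, mUX A L y = 0 := by
    filter_upwards [h0] with y hy; simp [mUX, hy.1, hy.2]
  have z1 : fderiv ℝ (dT A) z (0, 1, 0) = 0 :=
    (dT_dX hA).symm.trans (fderiv_zero_of_eventually (h0.mono fun y hy => hy.1) _)
  have z2 : fderiv ℝ (dT A) z (0, 0, 1) = 0 :=
    (dU_dT hA).trans (fderiv_zero_of_eventually (h0.mono fun y hy => hy.2) _)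
  have m1 : ∀ v, fderiv ℝ (mTX A L) z v
      = dT A z * fderiv ℝ (dX L) z v + dX L z * fderiv ℝ (dT A) z v := fun v => by
    rw [e1.fderiv_eq, fderiv_mul_apply (contDiffAt_dT hA) (contDiffAt_dX hL)]
  have m2 : ∀ v, fderiv ℝ (mTU A L) z v
      = dT A z * fderiv ℝ (dU L) z v + dU L z * fderiv ℝ (dT A) z v := fun v => by
    rw [e2.fderiv_eq, fderiv_mul_apply (contDiffAt_dT hA) (contDiffAt_dU hL)]
  have m3 := fderiv_zero_of_eventually e3
  have hc := dU_dX hL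
  unfold dX dU at hc ⊢
  unfold mTotX dX dU
  simp only [m1, m2, m3, z1, z2]
  unfold dX dU
  rw [hc]
  ring

variable {T : Triple}

theorem IsAdmissible.cT_const (hT : IsAdmissible T) {z : Space} (hz : z ∈ T.dom) :
    ∀ᶠ y in 𝓝 z, dX (cT T.map) y = 0 ∧ dU (cT T.map) y = 0 := by
  filter_upwards [hT.point.isOpen.mem_nhds hz] with y hy
  exact dX_dU_cT_eq_zero hT hy

theorem IsAdmissible.minor_ne_zero (hT : IsAdmissible T) {z : Space} (hz : z ∈ T.dom) :
    dT (cT T.map) z ≠ 0 ∧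
      dX (cX T.map) z * dU (cU T.map) z - dU (cX T.map) z * dX (cU T.map) z ≠ 0 := by
  have hdet := jacDet_ne_zero (hT.point.contDiffAt hz) (hT.point.bijective z hz)
  obtain ⟨h1, h2⟩ := dX_dU_cT_eq_zero hT hz
  unfold jacDet at hdet
  rw [h1, h2] at hdet
  simpa using hdet

/-- The determining equation before splitting. -/
theorem IsAdmissible.determining (hT : IsAdmissible T) {z : Space} (hz : z ∈ T.dom) (q r : ℝ)
    (hD : dX (cX T.map) z + q * dU (cX T.map) z ≠ 0) :
    ((dT (cU T.map) z + (r + T.src.fn z.2.1 * z.2.2) * dU (cU T.map) z)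
        * (dX (cX T.map) z + q * dU (cX T.map) z)
      - (dX (cU T.map) z + q * dU (cU T.map) z)
        * (dT (cX T.map) z + (r + T.src.fn z.2.1 * z.2.2) * dU (cX T.map) z))
      * (dX (cX T.map) z + q * dU (cX T.map) z) ^ 2
    = dT (cT T.map) z * ((dX (dX (cU T.map)) z + 2 * q * dX (dU (cU T.map)) z
        + q ^ 2 * dU (dU (cU T.map)) z + r * dU (cU T.map) z)
          * (dX (cX T.map) z + q * dU (cX T.map) z)
      - (dX (cU T.map) z + q * dU (cU T.map) z) * (dX (dX (cX T.map)) z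
        + 2 * q * dX (dU (cX T.map)) z + q ^ 2 * dU (dU (cX T.map)) z + r * dU (cX T.map) z)
      + T.tgt.fn (cX T.map z) * cU T.map z * (dX (cX T.map) z + q * dU (cX T.map) z) ^ 3) := by
  have hΦ := hT.point
  obtain ⟨hA, -⟩ := hT.minor_ne_zero hz
  have h0 := hT.cT_const hz
  obtain ⟨hx0, hu0⟩ := h0.self_of_nhds
  have hxs : z.2.1 ∈ T.src.dom := by rw [hT.src_dom]; exact ⟨z, hz, rfl⟩
  have hmTU : ∀ L, mTU (cT T.map) L z = dT (cT T.map) z * dU L z := fun L => by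
    simp [mTU, hu0]
  have hmUX : ∀ L, mUX (cT T.map) L z = 0 := fun L => by simp [mUX, hu0, hx0]
  have hmTot : ∀ L p, mTot (cT T.map) L z p q = dT (cT T.map) z * (dX L z + q * dU L z) := by
    intro L p; simp only [mTot, hmTU, hmUX, mTX, hx0]; ring
  have hJ0 : dT (cT T.map) z * (dX (cX T.map) z + q * dU (cX T.map) z) ≠ 0 := mul_ne_zero hA hD
  -- The derivatives `u_tt` and `u_tx` no longer contribute and are set to zero; `u_xx = r` is free
  -- and `u_t` is found from the equation.
  have hm := (hT.maps (z, (r + T.src.fn z.2.1 * z.2.2, q, 0, 0, r)) hz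
      ((regular_iff hΦ hz).2 fun h => hJ0 ((hmTot (cX T.map) _).symm.trans h))
      ⟨hxs, by simp [Jet.ut, Jet.uxx, Jet.x, Jet.u]⟩).2
  rw [prolong_ut_eq hΦ hz, prolong_uxx_eq hΦ hz (hmTot (cX T.map) _) (hmTot (cU T.map) _) hJ0] at hm
  simp only [Jet.ut, Jet.ux, Jet.utt, Jet.utx, Jet.uxx, Jet.x, Jet.u, prolong] at hm
  rw [hmTot, mTotX_fibred (hΦ.cT hz) (hΦ.cU hz) h0, mTotX_fibred (hΦ.cT hz) (hΦ.cX hz) h0] at hm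
  simp only [hmTU, hmUX, hx0, hu0] at hm
  change _ = _ + T.tgt.fn (cX T.map z) * cU T.map z at hm
  generalize hDD : dX (cX T.map) z + q * dU (cX T.map) z = D at *
  generalize dX (cU T.map) z + q * dU (cU T.map) z = E at *
  field_simp at hm
  refine mul_left_cancel₀ hA ?_
  linear_combination hm

/-- `x̃` is a function of `(t, x)` that is affine in `x`, and `t̃_t = x̃_x²`. -/
theorem IsAdmissible.cX_fibred (hT : IsAdmissible T) {z : Space} (hz : z ∈ T.dom) :
    dU (cX T.map) z = 0 ∧ dX (cX T.map) z ≠ 0 ∧ dT (cT T.map) z = dX (cX T.map) z ^ 2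
      ∧ dU (cU T.map) z ≠ 0 := by
  obtain ⟨hA, hΔ⟩ := hT.minor_ne_zero hz
  -- The coefficient of the free parameter `r = u_xx` in the determining equation.
  have key : ∀ q, dX (cX T.map) z + q * dU (cX T.map) z ≠ 0 →
      dT (cT T.map) z = (dX (cX T.map) z + q * dU (cX T.map) z) ^ 2 := by
    intro q hq
    have h0 := hT.determining hz q 0 hq
    have h1 := hT.determining hz q 1 hq
    have : (dX (cX T.map) z * dU (cU T.map) z - dU (cX T.map) z * dX (cU T.map) z) *
      (dT (cT T.map) z - (dX (cX T.map) z + q * dU (cX T.map) z) ^ 2) = 0 := by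
      linear_combination h0 - h1
    have := (mul_eq_zero.1 this).resolve_left hΔ
    linarith
  -- If `x̃_u` were nonzero, `q` could be chosen to give `D_x x̃` the values 1 and 2, making `t̃_t`
  -- equal to both 1 and 4.
  have hB : dU (cX T.map) z = 0 := by
    by_contra hB
    have e : ∀ r, dX (cX T.map) z + (r - dX (cX T.map) z) / dU (cX T.map) z * dU (cX T.map) z
      = r := fun r => by field_simp; ring
    have k1 := key ((1 - dX (cX T.map) z) / dU (cX T.map) z) (by rw [e]; norm_num)
    have k2 := key ((2 - dX (cX T.map) z) / dU (cX T.map) z) (by rw [e]; norm_num)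
    rw [e] at k1 k2
    norm_num [k1] at k2
  rw [hB] at hΔ key
  simp only [zero_mul, sub_zero, mul_ne_zero_iff] at hΔ
  exact ⟨hB, hΔ.1, by simpa using key 0 (by simpa using hΔ.1), hΔ.2⟩

/-- Differentiating `t̃_t = x̃_x²` in `x` gives `0 = 2 x̃_x x̃_xx`. -/
theorem IsAdmissible.cX_affine (hT : IsAdmissible T) {z : Space} (hz : z ∈ T.dom) :
    dX (dX (cX T.map)) z = 0 := by
  have hΦ := hT.point
  have hev : ∀ᶠ y in 𝓝 z, y ∈ T.dom := hΦ.isOpen.mem_nhds hz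
  have e : dT (cT T.map) =ᶠ[𝓝 z] fun y => dX (cX T.map) y * dX (cX T.map) y := by
    filter_upwards [hev] with y hy
    rw [(hT.cX_fibred hy).2.2.1]; ring
  have h1 : fderiv ℝ (dT (cT T.map)) z (0, 1, 0) = 0 :=
    (dT_dX (hΦ.cT hz)).symm.trans
      (fderiv_zero_of_eventually ((hT.cT_const hz).mono fun y hy => hy.1) _)
  rw [e.fderiv_eq, fderiv_mul_apply (contDiffAt_dX (hΦ.cX hz)) (contDiffAt_dX (hΦ.cX hz))] at h1
  have h2 := (hT.cX_fibred hz).2.1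
  have : dX (cX T.map) z * dX (dX (cX T.map)) z = 0 := by
    have e' : fderiv ℝ (dX (cX T.map)) z (0, 1, 0) = dX (dX (cX T.map)) z := rfl
    rw [e'] at h1; linarith
  exact (mul_eq_zero.1 this).resolve_left h2

/-- `ũ` is affine in `u`, and the coefficient of `u` satisfies a first-order equation. -/
theorem IsAdmissible.cU_affine (hT : IsAdmissible T) {z : Space} (hz : z ∈ T.dom) :
    dU (dU (cU T.map)) z = 0 ∧
      2 * dX (cX T.map) z * dX (dU (cU T.map)) z = - dT (cX T.map) z * dU (cU T.map) z := by
  have hΦ := hT.point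
  have hev : ∀ᶠ y in 𝓝 z, y ∈ T.dom := hΦ.isOpen.mem_nhds hz
  obtain ⟨hB, hX, hA, hU⟩ := hT.cX_fibred hz
  have hxx := hT.cX_affine hz
  have hz' : ∀ v, fderiv ℝ (dU (cX T.map)) z v = 0 :=
    fderiv_zero_of_eventually (hev.mono fun y hy => (hT.cX_fibred hy).1)
  have hxu : dX (dU (cX T.map)) z = 0 := hz' _
  have huu : dU (dU (cX T.map)) z = 0 := hz' _
  have key := fun q => hT.determining hz q 0 (by rw [hB]; simpa using hX)
  simp only [hB, hxx, hxu, huu, hA] at key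
  -- The determining equation is now a polynomial in `q = u_x`. Its values at 0, 1, -1 isolate the
  -- coefficient of `q²`, which is `ũ_uu` up to a factor, and that of `q`.
  have k0 := key 0; have k1 := key 1; have km := key (-1)
  have h3 : dX (cX T.map) z ^ 3 ≠ 0 := pow_ne_zero 3 hX
  have h2 : dX (cX T.map) z ^ 2 ≠ 0 := pow_ne_zero 2 hX
  constructor
  · have : dX (cX T.map) z ^ 3 * dU (dU (cU T.map)) z = 0 := by
      linear_combination -(k1 + km) / 2 + k0
    exact (mul_eq_zero.1 this).resolve_left h3
  · have : dX (cX T.map) z ^ 2 * (2 * dX (cX T.map) z * dX (dU (cU T.map)) z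
        + dT (cX T.map) z * dU (cU T.map) z) = 0 := by
      linear_combination -(k1 - km) / 2
    have := (mul_eq_zero.1 this).resolve_left h2
    linarith

end Structure

/-- Near `z₀`, the map `Φ` is `t̃ = τ`, `x̃ = a x + c`, `ũ = σ exp(A x² + B x + H) (u + f)`. -/
structure IsFormAt (Φ : Space → Space) (p : Par) (σ : ℝ) (f : ℝ → ℝ → ℝ) (z₀ : Space) : Prop where
  σ_ne : σ ≠ 0
  map_eq : ∀ᶠ z in 𝓝 z₀, Φ z = p.mapAff σ f z
  good : ∀ᶠ t in 𝓝 z₀.1, p.Good t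
  smooth : ∀ᶠ w : ℝ × ℝ in 𝓝 (z₀.1, z₀.2.1), ContDiffAt ℝ ∞ (fun w : ℝ × ℝ => f w.1 w.2) w

/-! ### Integration of the determining equations to the parametrized form -/

theorem const_of_hasDerivAt_zero {g : ℝ → ℝ} {x₀ ε : ℝ} (hε : 0 < ε)
    (h : ∀ y ∈ Metric.ball x₀ ε, HasDerivAt g 0 y) {y : ℝ} (hy : y ∈ Metric.ball x₀ ε) :
    g y = g x₀ := by
  refine Metric.isOpen_ball.is_const_of_deriv_eq_zero (convex_ball x₀ ε).isPreconnected
    (fun x hx => (h x hx).differentiableAt.differentiableWithinAt)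
    (fun x hx => (h x hx).deriv) hy (Metric.mem_ball_self hε)

theorem const_of_eventually_hasDerivAt_zero {g : ℝ → ℝ} {x₀ : ℝ}
    (h : ∀ᶠ y in 𝓝 x₀, HasDerivAt g 0 y) : ∀ᶠ y in 𝓝 x₀, g y = g x₀ := by
  obtain ⟨ε, hε, hb⟩ := Metric.eventually_nhds_iff_ball.1 h
  filter_upwards [Metric.ball_mem_nhds x₀ hε] with y hy
  exact const_of_hasDerivAt_zero hε hb hy

theorem hasDerivAt_slice_x {K : Space → ℝ} {s y v : ℝ} (hK : ContDiffAt ℝ ∞ K (s, y, v)) :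
    HasDerivAt (fun r => K (s, r, v)) (dX K (s, y, v)) y := by
  simpa using hasDerivAt_along_x (w := fun _ => v) hK (hasDerivAt_const y v)

theorem hasDerivAt_slice_t {K : Space → ℝ} {s y v : ℝ} (hK : ContDiffAt ℝ ∞ K (s, y, v)) :
    HasDerivAt (fun r => K (r, y, v)) (dT K (s, y, v)) s := by
  simpa using hasDerivAt_along_t (w := fun _ => v) hK (hasDerivAt_const s v)

theorem contDiffAt_slice_t {K : Space → ℝ} {s y v : ℝ} (hK : ContDiffAt ℝ ∞ K (s, y, v)) :
    ContDiffAt ℝ ∞ (fun r => K (r, y, v)) s :=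
  ContDiffAt.comp s (f := fun r : ℝ => ((r, y, v) : Space)) hK (by fun_prop)

theorem contDiffAt_slice_tx {K : Space → ℝ} {w : ℝ × ℝ} {v : ℝ}
    (hK : ContDiffAt ℝ ∞ K (w.1, w.2, v)) :
    ContDiffAt ℝ ∞ (fun w : ℝ × ℝ => K (w.1, w.2, v)) w :=
  ContDiffAt.comp w (f := fun w : ℝ × ℝ => ((w.1, w.2, v) : Space)) hK (by fun_prop)

/-- Every admissible transformation is locally of the parametrized form. -/
theorem IsAdmissible.exists_form {T : Triple} (hT : IsAdmissible T) {z₀ : Space}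
    (hz₀ : z₀ ∈ T.dom) : ∃ p σ f, IsFormAt T.map p σ f z₀ := by
  have hΦ := hT.point
  obtain ⟨t₀, x₀, u₀⟩ := z₀
  obtain ⟨ε, hε, hball⟩ := Metric.isOpen_iff.1 hΦ.isOpen _ hz₀
  have hm : ∀ t ∈ Metric.ball t₀ ε, ∀ x ∈ Metric.ball x₀ ε, ∀ u ∈ Metric.ball u₀ ε,
      ((t, x, u) : Space) ∈ T.dom := by
    intro t ht x hx u hu
    refine hball ?_
    rw [← ball_prod_same, ← ball_prod_same]
    exact ⟨ht, hx, hu⟩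
  have hx0 := Metric.mem_ball_self (x := x₀) hε
  have hu0 := Metric.mem_ball_self (x := u₀) hε
  have ht0 := Metric.mem_ball_self (x := t₀) hε
  set cT' := cT T.map with hcT
  set cX' := cX T.map with hcX
  set cU' := cU T.map with hcU
  set a : ℝ → ℝ := fun t => dX cX' (t, x₀, u₀) with ha
  set a1 : ℝ → ℝ := fun t => dT (dX cX') (t, x₀, u₀) with ha1
  set c1 : ℝ → ℝ := fun t => dT cX' (t, x₀, u₀) - a1 t * x₀ with hc1
  set V : ℝ → ℝ → ℝ := fun t x => dU cU' (t, x, u₀) with hV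
  set σ := V t₀ x₀ with hσ
  -- The choices of `A` and `B` solve `a' = -4aA` and `c' = -2aB`; here `a1` and `c1` are the
  -- derivatives of `a` and `c`.
  let A : ℝ → ℝ := fun t => -a1 t / (4 * a t)
  let B : ℝ → ℝ := fun t => -c1 t / (2 * a t)
  let p : Par :=
    { τ := fun t => cT' (t, x₀, u₀)
      a := a
      c := fun t => cX' (t, x₀, u₀) - a t * x₀
      A := A
      B := B
      -- Normalized so that `exp (P t x₀) = V t x₀ / σ`. The constant `σ = V t₀ x₀` absorbs the sign
      -- of `V`, so the argument of the logarithm is positive for `t` near `t₀`.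
      H := fun t => Real.log (V t x₀ / σ) - A t * x₀ ^ 2 - B t * x₀ }
  let f : ℝ → ℝ → ℝ := fun t x => cU' (t, x, u₀) / V t x - u₀
  have ane : ∀ t ∈ Metric.ball t₀ ε, a t ≠ 0 := fun t ht =>
    (hT.cX_fibred (hm t ht x₀ hx0 u₀ hu0)).2.1
  have Vne : ∀ t ∈ Metric.ball t₀ ε, ∀ x ∈ Metric.ball x₀ ε, V t x ≠ 0 := fun t ht x hx =>
    (hT.cX_fibred (hm t ht x hx u₀ hu0)).2.2.2
  have σne : σ ≠ 0 := Vne t₀ ht0 x₀ hx0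
  -- the first component
  have eT : ∀ t ∈ Metric.ball t₀ ε, ∀ x ∈ Metric.ball x₀ ε, ∀ u ∈ Metric.ball u₀ ε,
      cT' (t, x, u) = cT' (t, x₀, u₀) := by
    intro t ht x hx u hu
    have h1 := const_of_hasDerivAt_zero (g := fun v => cT' (t, x, v)) hε (fun v hv => by
      have := hasDerivAt_along_u (hΦ.cT (hm t ht x hx v hv))
      rwa [(dX_dU_cT_eq_zero hT (hm t ht x hx v hv)).2] at this) hu
    have h2 := const_of_hasDerivAt_zero (g := fun y => cT' (t, y, u₀)) hε (fun y hy => by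
      have := hasDerivAt_slice_x (hΦ.cT (hm t ht y hy u₀ hu0))
      rwa [(dX_dU_cT_eq_zero hT (hm t ht y hy u₀ hu0)).1] at this) hx
    exact h1.trans h2
  -- the second component
  have eXx : ∀ t ∈ Metric.ball t₀ ε, ∀ x ∈ Metric.ball x₀ ε, dX cX' (t, x, u₀) = a t := by
    intro t ht x hx
    exact const_of_hasDerivAt_zero (g := fun y => dX cX' (t, y, u₀)) hε (fun y hy => by
      have := hasDerivAt_slice_x (contDiffAt_dX (hΦ.cX (hm t ht y hy u₀ hu0)))
      rwa [hT.cX_affine (hm t ht y hy u₀ hu0)] at this) hx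
  have eX0 : ∀ t ∈ Metric.ball t₀ ε, ∀ x ∈ Metric.ball x₀ ε,
      cX' (t, x, u₀) = p.X t x := by
    intro t ht x hx
    have := const_of_hasDerivAt_zero (g := fun y => cX' (t, y, u₀) - a t * y) hε (fun y hy => by
      have := (hasDerivAt_slice_x (hΦ.cX (hm t ht y hy u₀ hu0))).sub
        ((hasDerivAt_id y).const_mul (a t))
      refine this.congr_deriv ?_
      have h := eXx t ht y hy
      simp only [hcX] at h ⊢
      rw [h]; simp) hx
    simp only [Par.X, p]
    linarith
  have eX : ∀ t ∈ Metric.ball t₀ ε, ∀ x ∈ Metric.ball x₀ ε, ∀ u ∈ Metric.ball u₀ ε,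
      cX' (t, x, u) = p.X t x := by
    intro t ht x hx u hu
    rw [← eX0 t ht x hx]
    exact const_of_hasDerivAt_zero (g := fun v => cX' (t, x, v)) hε (fun v hv => by
      have := hasDerivAt_along_u (hΦ.cX (hm t ht x hx v hv))
      rwa [(hT.cX_fibred (hm t ht x hx v hv)).1] at this) hu
  have da : ∀ t ∈ Metric.ball t₀ ε, HasDerivAt a (a1 t) t := fun t ht =>
    hasDerivAt_slice_t (contDiffAt_dX (hΦ.cX (hm t ht x₀ hx0 u₀ hu0)))
  have dc : ∀ t ∈ Metric.ball t₀ ε, HasDerivAt p.c (c1 t) t := fun t ht =>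
    (hasDerivAt_slice_t (hΦ.cX (hm t ht x₀ hx0 u₀ hu0))).sub ((da t ht).mul_const x₀)
  have eXt : ∀ t ∈ Metric.ball t₀ ε, ∀ x ∈ Metric.ball x₀ ε,
      dT cX' (t, x, u₀) = a1 t * x + c1 t := by
    intro t ht x hx
    have h1 := hasDerivAt_slice_t (hΦ.cX (hm t ht x hx u₀ hu0))
    have h2 : HasDerivAt (fun s => p.X s x) (a1 t * x + c1 t) t :=
      ((da t ht).mul_const x).add (dc t ht)
    refine h1.unique (h2.congr_of_eventuallyEq ?_)
    filter_upwards [Metric.isOpen_ball.mem_nhds ht] with s hs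
    exact eX0 s hs x hx
  -- the third component
  have eU : ∀ t ∈ Metric.ball t₀ ε, ∀ x ∈ Metric.ball x₀ ε, ∀ u ∈ Metric.ball u₀ ε,
      cU' (t, x, u) = V t x * (u + f t x) := by
    intro t ht x hx u hu
    have h1 : ∀ v ∈ Metric.ball u₀ ε, dU cU' (t, x, v) = V t x := fun v hv =>
      const_of_hasDerivAt_zero (g := fun v => dU cU' (t, x, v)) hε (fun v hv => by
        have := hasDerivAt_along_u (contDiffAt_dU (hΦ.cU (hm t ht x hx v hv)))
        rwa [(hT.cU_affine (hm t ht x hx v hv)).1] at this) hv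
    have h2 := const_of_hasDerivAt_zero (g := fun v => cU' (t, x, v) - V t x * v) hε
      (fun v hv => by
        have := (hasDerivAt_along_u (hΦ.cU (hm t ht x hx v hv))).sub
          ((hasDerivAt_id v).const_mul (V t x))
        refine this.congr_deriv ?_
        have h := h1 v hv
        simp only [hcU] at h ⊢
        rw [h]; simp) hu
    have := Vne t ht x hx
    simp only [f]
    field_simp
    linarith
  have eV : ∀ t ∈ Metric.ball t₀ ε, 0 < V t x₀ / σ → ∀ x ∈ Metric.ball x₀ ε,
      V t x = σ * Real.exp (p.P t x) := by
    intro t ht hpos x hx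
    have hane := ane t ht
    -- By `cU_affine`, `V_x = P_x V`, so `V exp(-P)` does not depend on `x`.
    have h1 := const_of_hasDerivAt_zero (g := fun y => V t y * Real.exp (-p.P t y)) hε
      (fun y hy => by
        have := (hasDerivAt_slice_x (contDiffAt_dU (hΦ.cU (hm t ht y hy u₀ hu0)))).mul
          (p.hasDerivAt_P_x t y).neg.exp
        refine this.congr_deriv ?_
        have h := (hT.cU_affine (hm t ht y hy u₀ hu0)).2
        have h3 := eXx t ht y hy
        have h4 := eXt t ht y hy
        simp only [hcX] at h3 h4
        rw [h3, h4] at h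
        have h5 : dX (dU (cU T.map)) (t, y, u₀)
            = (2 * p.A t * y + p.B t) * dU (cU T.map) (t, y, u₀) := by
          simp only [p, A, B]
          field_simp
          linear_combination 4 * h
        rw [h5]; ring) hx
    have h2 : p.P t x₀ = Real.log (V t x₀ / σ) := by simp only [Par.P, p]; ring
    have h3 : V t x₀ * Real.exp (-p.P t x₀) = σ := by
      rw [h2, Real.exp_neg, Real.exp_log hpos]
      have := Vne t ht x₀ hx0
      field_simp
    rw [h3, Real.exp_neg] at h1
    have := Real.exp_pos (p.P t x)
    field_simp at h1
    rw [h1, mul_comm]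
  have hposev : ∀ᶠ t in 𝓝 t₀, 0 < V t x₀ / σ := by
    have hc : ContinuousAt (fun t => V t x₀ / σ) t₀ :=
      ((contDiffAt_slice_t (contDiffAt_dU (hΦ.cU hz₀))).div_const σ).continuousAt
    refine hc.eventually (lt_mem_nhds ?_)
    change 0 < σ / σ
    rw [div_self σne]; exact one_pos
  have hbt : ∀ᶠ t in 𝓝 t₀, t ∈ Metric.ball t₀ ε := Metric.ball_mem_nhds t₀ hε
  refine ⟨p, σ, f, σne, ?_, ?_, ?_⟩
  · have h1 : ∀ᶠ z : Space in 𝓝 (t₀, x₀, u₀), 0 < V z.1 x₀ / σ :=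
      (continuous_fst.tendsto ((t₀, x₀, u₀) : Space)).eventually hposev
    filter_upwards [Metric.ball_mem_nhds ((t₀, x₀, u₀) : Space) hε, h1] with z hz hpos
    rw [← ball_prod_same, ← ball_prod_same] at hz
    obtain ⟨ht, hx, hu⟩ := hz
    have e1 := eT z.1 ht z.2.1 hx z.2.2 hu
    have e2 := eX z.1 ht z.2.1 hx z.2.2 hu
    have e3 := eU z.1 ht z.2.1 hx z.2.2 hu
    rw [eV z.1 ht hpos z.2.1 hx] at e3
    exact Prod.ext e1 (Prod.ext e2 e3)
  · filter_upwards [hbt, hposev] with t ht hpos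
    have hz := hm t ht x₀ hx0 u₀ hu0
    have hane := ane t ht
    have sa : ContDiffAt ℝ ∞ a t := contDiffAt_slice_t (contDiffAt_dX (hΦ.cX hz))
    have sa1 : ContDiffAt ℝ ∞ a1 t := contDiffAt_slice_t (contDiffAt_dT (contDiffAt_dX (hΦ.cX hz)))
    have sc1 : ContDiffAt ℝ ∞ c1 t :=
      (contDiffAt_slice_t (contDiffAt_dT (hΦ.cX hz))).sub (sa1.mul contDiffAt_const)
    have sV : ContDiffAt ℝ ∞ (fun t => V t x₀) t :=
      contDiffAt_slice_t (contDiffAt_dU (hΦ.cU hz))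
    have sA : ContDiffAt ℝ ∞ A t := sa1.neg.div (contDiffAt_const.mul sa) (by simpa using hane)
    have sB : ContDiffAt ℝ ∞ B t := sc1.neg.div (contDiffAt_const.mul sa) (by simpa using hane)
    refine ⟨contDiffAt_slice_t (hΦ.cT hz), sa,
      (contDiffAt_slice_t (hΦ.cX hz)).sub (sa.mul contDiffAt_const), sA, sB,
      (((sV.div_const σ).log hpos.ne').sub (sA.mul contDiffAt_const)).sub
        (sB.mul contDiffAt_const), hane, ?_, ?_, ?_⟩
    · have := hasDerivAt_slice_t (hΦ.cT hz)
      rwa [(hT.cX_fibred hz).2.2.1] at this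
    · refine (da t ht).congr_deriv ?_
      simp only [p, A]; field_simp
    · refine (dc t ht).congr_deriv ?_
      simp only [p, B]; field_simp
  · have h1 : ∀ᶠ w : ℝ × ℝ in 𝓝 (t₀, x₀), w ∈ Metric.ball (t₀, x₀) ε :=
      Metric.ball_mem_nhds _ hε
    filter_upwards [h1] with w hw
    rw [← ball_prod_same] at hw
    have hz := hm w.1 hw.1 w.2 hw.2 u₀ hu0
    exact ((contDiffAt_slice_tx (hΦ.cU hz)).div (contDiffAt_slice_tx (contDiffAt_dU (hΦ.cU hz)))
      (Vne w.1 hw.1 w.2 hw.2)).sub contDiffAt_const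

/-- The relation between the potentials, and the equation for `f`. -/
theorem IsAdmissible.rel_of_form {T : Triple} (hT : IsAdmissible T) {z₀ : Space}
    (hz₀ : z₀ ∈ T.dom) {p : Par} {σ : ℝ} {f : ℝ → ℝ → ℝ} (hf : IsFormAt T.map p σ f z₀) :
    p.a z₀.1 ^ 2 * T.tgt.fn (p.X z₀.1 z₀.2.1) = T.src.fn z₀.2.1 + p.Q z₀.1 z₀.2.1 ∧
      pdt f z₀.1 z₀.2.1 = pdx (pdx f) z₀.1 z₀.2.1 + T.src.fn z₀.2.1 * f z₀.1 z₀.2.1 := by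
  obtain ⟨t₀, x₀, u₀⟩ := z₀
  have hev : ∀ᶠ u in 𝓝 u₀, ((t₀, x₀, u) : Space) ∈ T.dom ∧
      ∀ᶠ z in 𝓝 ((t₀, x₀, u) : Space), T.map z = p.mapAff σ f z := by
    have hc : Tendsto (fun u : ℝ => ((t₀, x₀, u) : Space)) (𝓝 u₀) (𝓝 (t₀, x₀, u₀)) :=
      Continuous.tendsto (by fun_prop) u₀
    have hd : ∀ᶠ z in 𝓝 ((t₀, x₀, u₀) : Space), z ∈ T.dom := hT.point.isOpen.mem_nhds hz₀
    exact hc.eventually (hd.and hf.map_eq.eventually_nhds)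
  have ga := hf.good.self_of_nhds
  have hane := ga.a_ne
  dsimp only at ga hane
  have main : ∀ u, (((t₀, x₀, u) : Space) ∈ T.dom ∧
      ∀ᶠ z in 𝓝 ((t₀, x₀, u) : Space), T.map z = p.mapAff σ f z) →
      T.src.fn x₀ * u + (pdt f t₀ x₀ - pdx (pdx f) t₀ x₀) + p.Q t₀ x₀ * (u + f t₀ x₀)
        = p.a t₀ ^ 2 * T.tgt.fn (p.X t₀ x₀) * (u + f t₀ x₀) := by
    rintro u ⟨hu, hmap⟩
    let j : Jet := ((t₀, x₀, u), (T.src.fn x₀ * u, 0, 0, 0, 0))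
    obtain ⟨hreg, he⟩ := prolong_mapAff (Φ := T.map) (j := j) hmap hf.good hf.smooth
    have hxs : x₀ ∈ T.src.dom := by rw [hT.src_dom]; exact ⟨_, hu, rfl⟩
    have hs := (hT.maps j hu hreg ⟨hxs, by simp [j, Jet.ut, Jet.uxx, Jet.x, Jet.u]⟩).2
    have e1 : (prolong T.map j).x = p.X t₀ x₀ := by
      change (T.map (t₀, x₀, u)).2.1 = _
      rw [hmap.self_of_nhds]; rfl
    have e2 : (prolong T.map j).u = σ * Real.exp (p.P t₀ x₀) * (u + f t₀ x₀) := by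
      change (T.map (t₀, x₀, u)).2.2 = _
      rw [hmap.self_of_nhds]; rfl
    rw [e1, e2] at hs
    rw [hs] at he
    simp only [j, Jet.ut, Jet.uxx, Jet.x, Jet.u, Jet.t] at he
    have hσ := hf.σ_ne
    have hexp := (Real.exp_pos (p.P t₀ x₀)).ne'
    field_simp at he
    refine mul_left_cancel₀ (mul_ne_zero hσ hexp) ?_
    linear_combination -he
  -- The identity `main` is affine in `u`; a second value of `u` in the domain separates the
  -- coefficient of `u`, which relates the potentials, from the free term, which is the equation for
  -- `f`.
  obtain ⟨u₁, hu₁, hne⟩ : ∃ u₁, (((t₀, x₀, u₁) : Space) ∈ T.dom ∧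
      ∀ᶠ z in 𝓝 ((t₀, x₀, u₁) : Space), T.map z = p.mapAff σ f z) ∧ u₁ ≠ u₀ := by
    obtain ⟨ε, hε, hb⟩ := Metric.eventually_nhds_iff_ball.1 hev
    refine ⟨u₀ + ε / 2, hb _ ?_, by linarith⟩
    rw [Metric.mem_ball, Real.dist_eq]
    rw [show u₀ + ε / 2 - u₀ = ε / 2 by ring, abs_of_pos (by linarith)]
    linarith
  have m0 := main u₀ hev.self_of_nhds
  have m1 := main u₁ hu₁
  have k : p.a t₀ ^ 2 * T.tgt.fn (p.X t₀ x₀) = T.src.fn x₀ + p.Q t₀ x₀ := by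
    have : (u₁ - u₀) * (p.a t₀ ^ 2 * T.tgt.fn (p.X t₀ x₀) - (T.src.fn x₀ + p.Q t₀ x₀)) = 0 := by
      linear_combination m0 - m1
    have := (mul_eq_zero.1 this).resolve_left (sub_ne_zero.2 hne)
    linarith
  refine ⟨k, ?_⟩
  dsimp only
  rw [k] at m0
  linear_combination m0

/-! ### Transformations of the parametrized form are admissible -/

theorem IsFormAt.contDiffAt {Φ : Space → Space} {p : Par} {σ : ℝ} {f : ℝ → ℝ → ℝ} {z : Space}
    (h : IsFormAt Φ p σ f z) : ContDiffAt ℝ ∞ Φ z := by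
  have g := h.good.self_of_nhds
  have hfst : ContDiffAt ℝ ∞ (fun y : Space => y.1) z := contDiffAt_fst
  have hx : ContDiffAt ℝ ∞ (fun y : Space => y.2.1) z := contDiffAt_snd.fst
  have hu : ContDiffAt ℝ ∞ (fun y : Space => y.2.2) z := contDiffAt_snd.snd
  have c : ∀ {r : ℝ → ℝ}, ContDiffAt ℝ ∞ r z.1 → ContDiffAt ℝ ∞ (fun y : Space => r y.1) z :=
    fun hr => hr.comp z hfst
  have hf : ContDiffAt ℝ ∞ (fun y : Space => f y.1 y.2.1) z :=
    h.smooth.self_of_nhds.comp z (f := fun y : Space => (y.1, y.2.1)) (hfst.prodMk hx)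
  have hm : ContDiffAt ℝ ∞ (p.mapAff σ f) z := by
    refine (c g.sτ).prodMk ((((c g.sa).mul hx).add (c g.sc)).prodMk ?_)
    exact (contDiffAt_const.mul ((((c g.sA).mul (hx.pow 2)).add ((c g.sB).mul hx)).add
      (c g.sH)).exp).mul (hu.add hf)
  exact hm.congr_of_eventuallyEq h.map_eq

theorem fderiv_components {Φ : Space → Space} {z : Space} (hd : DifferentiableAt ℝ Φ z)
    (v : Space) : fderiv ℝ Φ z v
      = (fderiv ℝ (cT Φ) z v, fderiv ℝ (cX Φ) z v, fderiv ℝ (cU Φ) z v) := by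
  refine Prod.ext ?_ (Prod.ext ?_ ?_)
  · rw [show cT Φ = fun z => (Φ z).1 from rfl, (hd.hasFDerivAt.fst).fderiv]; rfl
  · rw [show cX Φ = fun z => (Φ z).2.1 from rfl, (hd.hasFDerivAt.snd.fst).fderiv]; rfl
  · rw [show cU Φ = fun z => (Φ z).2.2 from rfl, (hd.hasFDerivAt.snd.snd).fderiv]; rfl

/-- The Jacobian matrix is triangular with diagonal `a²`, `a`, `σ exp P`, and in finite dimension
injectivity is enough. -/
theorem IsFormAt.bijective {Φ : Space → Space} {p : Par} {σ : ℝ} {f : ℝ → ℝ → ℝ} {z : Space}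
    (h : IsFormAt Φ p σ f z) : Function.Bijective (fderiv ℝ Φ z) := by
  have hs := h.contDiffAt
  obtain ⟨t, x, u⟩ := z
  have g := h.good.self_of_nhds
  dsimp only at g
  have hsT : ContDiffAt ℝ ∞ (cT Φ) (t, x, u) := hs.fst
  have hsX : ContDiffAt ℝ ∞ (cX Φ) (t, x, u) := hs.snd.fst
  have hsU : ContDiffAt ℝ ∞ (cU Φ) (t, x, u) := hs.snd.snd
  have l1 : Tendsto (fun s : ℝ => ((s, x, u) : Space)) (𝓝 t) (𝓝 (t, x, u)) :=
    Continuous.tendsto (by fun_prop) t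
  have l2 : Tendsto (fun y : ℝ => ((t, y, u) : Space)) (𝓝 x) (𝓝 (t, x, u)) :=
    Continuous.tendsto (by fun_prop) x
  have l3 : Tendsto (fun v : ℝ => ((t, x, v) : Space)) (𝓝 u) (𝓝 (t, x, u)) :=
    Continuous.tendsto (by fun_prop) u
  have e1 : dT (cT Φ) (t, x, u) = p.a t ^ 2 :=
    (hasDerivAt_slice_t hsT).unique (g.dτ.congr_of_eventuallyEq
      ((l1.eventually h.map_eq).mono fun s hs => by simp [cT, hs, Par.mapAff]))
  have e2 : dX (cT Φ) (t, x, u) = 0 :=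
    (hasDerivAt_slice_x hsT).unique ((hasDerivAt_const x (p.τ t)).congr_of_eventuallyEq
      ((l2.eventually h.map_eq).mono fun s hs => by simp [cT, hs, Par.mapAff]))
  have e3 : dU (cT Φ) (t, x, u) = 0 :=
    (hasDerivAt_along_u hsT).unique ((hasDerivAt_const u (p.τ t)).congr_of_eventuallyEq
      ((l3.eventually h.map_eq).mono fun s hs => by simp [cT, hs, Par.mapAff]))
  have e4 : dX (cX Φ) (t, x, u) = p.a t := by
    have := ((hasDerivAt_id x).const_mul (p.a t)).add_const (p.c t)
    rw [mul_one] at this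
    exact (hasDerivAt_slice_x hsX).unique (this.congr_of_eventuallyEq
      ((l2.eventually h.map_eq).mono fun s hs => by simp [cX, hs, Par.mapAff, Par.X]))
  have e5 : dU (cX Φ) (t, x, u) = 0 :=
    (hasDerivAt_along_u hsX).unique ((hasDerivAt_const u (p.X t x)).congr_of_eventuallyEq
      ((l3.eventually h.map_eq).mono fun s hs => by simp [cX, hs, Par.mapAff]))
  have e6 : dU (cU Φ) (t, x, u) = σ * Real.exp (p.P t x) := by
    have := ((hasDerivAt_id u).add_const (f t x)).const_mul (σ * Real.exp (p.P t x))
    rw [mul_one] at this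
    exact (hasDerivAt_along_u hsU).unique (this.congr_of_eventuallyEq
      ((l3.eventually h.map_eq).mono fun s hs => by simp [cU, hs, Par.mapAff]))
  have hinj : Function.Injective (fderiv ℝ Φ (t, x, u)) := by
    rw [injective_iff_map_eq_zero]
    intro v hv
    rw [fderiv_components (hs.differentiableAt (by simp))] at hv
    simp only [fderiv_apply_eq, e1, e2, e3, e4, e5, e6, Prod.mk_eq_zero, mul_zero, add_zero] at hv
    obtain ⟨h1, h2, h3⟩ := hv
    have v1 : v.1 = 0 := (mul_eq_zero.1 h1).resolve_right (pow_ne_zero 2 g.a_ne)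
    rw [v1, zero_mul, zero_add] at h2 h3
    have v2 : v.2.1 = 0 := (mul_eq_zero.1 h2).resolve_right g.a_ne
    rw [v2, zero_mul, zero_add] at h3
    have v3 : v.2.2 = 0 :=
      (mul_eq_zero.1 h3).resolve_right (mul_ne_zero h.σ_ne (Real.exp_pos _).ne')
    exact Prod.ext v1 (Prod.ext v2 v3)
  refine ⟨hinj, ?_⟩
  exact (LinearMap.injective_iff_surjective (f := (fderiv ℝ Φ (t, x, u) : Space →ₗ[ℝ] Space))).1
    hinj

theorem IsFormAt.satisfies {Φ : Space → Space} {p : Par} {σ : ℝ} {f : ℝ → ℝ → ℝ} {j : Jet}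
    (h : IsFormAt Φ p σ f j.1) {C C' : ℝ → ℝ}
    (hrel : p.a j.t ^ 2 * C' (p.X j.t j.x) = C j.x + p.Q j.t j.x)
    (hf : pdt f j.t j.x = pdx (pdx f) j.t j.x + C j.x * f j.t j.x)
    (hj : j.ut = j.uxx + C j.x * j.u) :
    (prolong Φ j).ut = (prolong Φ j).uxx + C' (prolong Φ j).x * (prolong Φ j).u := by
  obtain ⟨-, he⟩ := prolong_mapAff h.map_eq h.good h.smooth
  have hane := h.good.self_of_nhds.a_ne
  have e1 : (prolong Φ j).x = p.X j.t j.x := by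
    change (Φ j.1).2.1 = _
    rw [h.map_eq.self_of_nhds]; rfl
  have e2 : (prolong Φ j).u = σ * Real.exp (p.P j.t j.x) * (j.u + f j.t j.x) := by
    change (Φ j.1).2.2 = _
    rw [h.map_eq.self_of_nhds]; rfl
  change p.a j.t ≠ 0 at hane
  rw [e1, e2, ← sub_eq_iff_eq_add', he, hj, hf]
  have e3 : p.Q j.t j.x = p.a j.t ^ 2 * C' (p.X j.t j.x) - C j.x := by linarith
  rw [e3]
  field_simp
  ring

/-- The parameters may change from point to point, because smoothness, bijectivity of the derivative
and the condition on prolonged jets are all local. -/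
theorem isAdmissible_of_form {T : Triple} (ho : IsOpen T.dom) (hne : T.dom.Nonempty)
    (hsrc : T.src.dom = (fun z : Space => z.2.1) '' T.dom)
    (htgt : T.tgt.dom = (fun z : Space => (T.map z).2.1) '' T.dom)
    (h : ∀ z ∈ T.dom, ∃ p σ f, IsFormAt T.map p σ f z ∧
      p.a z.1 ^ 2 * T.tgt.fn (p.X z.1 z.2.1) = T.src.fn z.2.1 + p.Q z.1 z.2.1 ∧
      pdt f z.1 z.2.1 = pdx (pdx f) z.1 z.2.1 + T.src.fn z.2.1 * f z.1 z.2.1) :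
    IsAdmissible T where
  point :=
    { isOpen := ho
      nonempty := hne
      smooth := fun z hz => by
        obtain ⟨p, σ, f, hf, -⟩ := h z hz
        exact hf.contDiffAt.contDiffWithinAt
      bijective := fun z hz => by
        obtain ⟨p, σ, f, hf, -⟩ := h z hz
        exact hf.bijective }
  src_dom := hsrc
  tgt_dom := htgt
  maps := fun j hj _ hs => by
    obtain ⟨p, σ, f, hf, h1, h2⟩ := h j.1 hj
    refine ⟨?_, hf.satisfies h1 h2 hs.2⟩
    rw [htgt]
    exact ⟨j.1, hj, rfl⟩

theorem IsPointTransformation.isOpen_image {Ω W : Set Space} {Φ : Space → Space}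
    (h : IsPointTransformation Ω Φ) (hW : IsOpen W) (hWΩ : W ⊆ Ω) : IsOpen (Φ '' W) := by
  rw [isOpen_iff_mem_nhds]
  rintro _ ⟨z, hz, rfl⟩
  have hs : HasStrictFDerivAt Φ (fderiv ℝ Φ z) z :=
    (h.contDiffAt (hWΩ hz)).hasStrictFDerivAt (by simp)
  have hsurj : (fderiv ℝ Φ z).range = ⊤ :=
    LinearMap.range_eq_top.2 (h.bijective z (hWΩ hz)).2
  rw [← hs.map_nhds_eq_of_surj hsurj]
  exact image_mem_map (hW.mem_nhds hz)

/-! ### Potentials given by functions -/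

/-- The potential given by a function that is smooth on an open set. -/
def mkPot (S : Set ℝ) (C : ℝ → ℝ) (ho : IsOpen S) (hne : S.Nonempty)
    (hC : ContDiffOn ℝ ∞ C S) : Potential where
  dom := S
  fn := S.indicator C
  isOpen_dom := ho
  nonempty_dom := hne
  smooth_fn := hC.congr fun _ hx => indicator_of_mem hx C
  fn_off := fun _ hx => indicator_of_notMem hx C

theorem Potential.ext_on {C C' : Potential} (hd : C.dom = C'.dom)
    (hf : ∀ x ∈ C.dom, C.fn x = C'.fn x) : C = C' := by
  refine Potential.ext hd (funext fun x => ?_)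
  by_cases hx : x ∈ C.dom
  · exact hf x hx
  · rw [C.fn_off x hx, C'.fn_off x (hd ▸ hx)]

theorem Potential.contDiffAt (C : Potential) {x : ℝ} (hx : x ∈ C.dom) : ContDiffAt ℝ ∞ C.fn x :=
  (C.smooth_fn x hx).contDiffAt (C.isOpen_dom.mem_nhds hx)

theorem isOpenMap_projX : IsOpenMap (fun z : Space => z.2.1) :=
  isOpenMap_fst.comp isOpenMap_snd

/-! ### Affine transformations belong to the equivalence group -/

theorem pdt_zero (t x : ℝ) : pdt (fun _ _ => 0) t x = 0 := by simp [pdt]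
theorem pdx_pdx_zero (t x : ℝ) : pdx (pdx fun _ _ => 0) t x = 0 := by simp [pdx]

/-- The parameters of `t̃ = k² t + b`, `x̃ = k x + κ`, `ũ = exp (D t + l) u`. -/
def affPar (k b κ D l : ℝ) : Par where
  τ := fun t => k ^ 2 * t + b
  a := fun _ => k
  c := fun _ => κ
  A := fun _ => 0
  B := fun _ => 0
  H := fun t => D * t + l

theorem affPar_good {k b κ D l : ℝ} (hk : k ≠ 0) (t : ℝ) : (affPar k b κ D l).Good t where
  sτ := by unfold affPar; fun_prop
  sa := by unfold affPar; fun_prop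
  sc := by unfold affPar; fun_prop
  sA := by unfold affPar; fun_prop
  sB := by unfold affPar; fun_prop
  sH := by unfold affPar; fun_prop
  a_ne := hk
  dτ := (((hasDerivAt_id t).const_mul (k ^ 2)).add_const b).congr_deriv (by simp [affPar])
  da := (hasDerivAt_const t k).congr_deriv (by simp [affPar])
  dc := (hasDerivAt_const t κ).congr_deriv (by simp [affPar])

@[simp] theorem affPar_Q (k b κ D l t x : ℝ) : (affPar k b κ D l).Q t x = D := by
  have : deriv (fun t => D * t + l) t = D :=
    (((hasDerivAt_id t).const_mul D).add_const l).deriv.trans (by simp)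
  simp [Par.Q, affPar, this]

theorem isFormAt_of_good {p : Par} {σ : ℝ} {z : Space} (hσ : σ ≠ 0)
    (h : ∀ᶠ t in 𝓝 z.1, p.Good t) :
    IsFormAt (p.mapAff σ fun _ _ => 0) p σ (fun _ _ => 0) z :=
  ⟨hσ, Eventually.of_forall fun _ => rfl, h, Eventually.of_forall fun _ => contDiffAt_const⟩

/-- The push-forward of a potential by an affine transformation. -/
def affTarget (k κ D : ℝ) (hk : k ≠ 0) (C : Potential) : Potential :=
  mkPot ((fun y => (y - κ) / k) ⁻¹' C.dom) (fun y => (C.fn ((y - κ) / k) + D) / k ^ 2)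
    (C.isOpen_dom.preimage (by fun_prop))
    (C.nonempty_dom.imp' (fun x => k * x + κ) fun x hx => by
      simpa [mul_div_cancel_left₀ x hk] using hx)
    fun y hy => by
      have h1 : ContDiffAt ℝ ∞ (fun y => C.fn ((y - κ) / k)) y :=
        ContDiffAt.comp y (f := fun y => (y - κ) / k) (C.contDiffAt hy) (by fun_prop)
      exact ((h1.add contDiffAt_const).div_const (k ^ 2)).contDiffWithinAt

theorem affTarget_dom {k κ D : ℝ} {hk : k ≠ 0} {C : Potential} {x : ℝ} :
    k * x + κ ∈ (affTarget k κ D hk C).dom ↔ x ∈ C.dom := by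
  change (k * x + κ - κ) / k ∈ C.dom ↔ _
  rw [add_sub_cancel_right, mul_div_cancel_left₀ x hk]

theorem affTarget_fn {k κ D : ℝ} {hk : k ≠ 0} {C : Potential} {x : ℝ} (hx : x ∈ C.dom) :
    (affTarget k κ D hk C).fn (k * x + κ) = (C.fn x + D) / k ^ 2 := by
  refine (indicator_of_mem ((affTarget_dom (D := D) (hk := hk)).2 hx)
    fun y => (C.fn ((y - κ) / k) + D) / k ^ 2).trans ?_
  simp only [add_sub_cancel_right, mul_div_cancel_left₀ x hk]

/-- The affine equivalence transformations. -/
def affExt (k b κ D K : ℝ) : ExtTransformation where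
  dom := univ
  map := (affPar k b κ D 0).mapAff K fun _ _ => 0
  pot := fun w => (w.2 + D) / k ^ 2

theorem affExt_admissible {k b κ D K : ℝ} (hk : k ≠ 0) (hK : K ≠ 0) (C : Potential) :
    IsAdmissible ((affExt k b κ D K).triple C (affTarget k κ D hk C)) := by
  have hd : ((affExt k b κ D K).triple C (affTarget k κ D hk C)).dom
      = {z | z.2.1 ∈ C.dom} := by simp [ExtTransformation.triple, affExt]
  refine isAdmissible_of_form ?_ ?_ ?_ ?_ ?_
  · rw [hd]; exact C.isOpen_dom.preimage (by fun_prop)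
  · rw [hd]; exact C.nonempty_dom.imp' (fun x => (0, x, 0)) fun x hx => hx
  · rw [hd]
    ext x
    exact ⟨fun hx => ⟨(0, x, 0), hx, rfl⟩, fun ⟨z, hz, h⟩ => h ▸ hz⟩
  · rw [hd]
    ext y
    constructor
    · intro hy
      refine ⟨(0, (y - κ) / k, 0), hy, ?_⟩
      simp only [ExtTransformation.triple, affExt, Par.mapAff, Par.X, affPar]
      field_simp
      ring
    · rintro ⟨z, hz, rfl⟩
      exact (affTarget_dom (k := k) (κ := κ) (D := D) (hk := hk)).2 hz
  · intro z hz
    rw [hd] at hz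
    refine ⟨affPar k b κ D 0, K, fun _ _ => 0,
      isFormAt_of_good hK (Eventually.of_forall fun t => affPar_good hk t), ?_, ?_⟩
    · have := affTarget_fn (D := D) (κ := κ) (hk := hk) hz
      rw [affPar_Q]
      change k ^ 2 * (affTarget k κ D hk C).fn (k * z.2.1 + κ) = C.fn z.2.1 + D
      rw [this]
      field_simp
    · rw [pdt_zero, pdx_pdx_zero]; simp

theorem affExt_pushesTo {k b κ D K : ℝ} (hk : k ≠ 0) (C : Potential) :
    (affExt k b κ D K).PushesTo C (affTarget k κ D hk C) :=
  fun _ _ hx _ => (affTarget_fn hx).symm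

theorem affExt_isEquivalence {k b κ D K : ℝ} (hk : k ≠ 0) (hK : K ≠ 0) :
    (affExt k b κ D K).IsEquivalence where
  point :=
    { isOpen := isOpen_univ
      nonempty := univ_nonempty
      smooth := fun z _ => ((isFormAt_of_good hK (Eventually.of_forall fun t =>
        affPar_good hk t) : IsFormAt _ _ _ _ z)).contDiffAt.contDiffWithinAt
      bijective := fun z _ => ((isFormAt_of_good hK (Eventually.of_forall fun t =>
        affPar_good hk t) : IsFormAt _ _ _ _ z)).bijective }
  connected := isConnected_univ
  pot_smooth := by unfold affExt; fun_prop
  pot_deriv := fun w _ _ => by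
    have : HasDerivAt (fun c : ℝ => (c + D) / k ^ 2) (1 / k ^ 2) w.2 :=
      ((hasDerivAt_id w.2).add_const D).div_const _
    change deriv (fun c : ℝ => (c + D) / k ^ 2) w.2 ≠ 0
    rw [this.deriv]
    positivity
  preserves := fun C _ => ⟨affTarget k κ D hk C, affExt_pushesTo hk C, affExt_admissible hk hK C⟩

theorem affExt_mem_actionGroupoid {k b κ D K : ℝ} (hk : k ≠ 0) (hK : K ≠ 0) (C : Potential) :
    (affExt k b κ D K).triple C (affTarget k κ D hk C) ∈ actionGroupoid :=
  ⟨affExt_admissible hk hK C, affExt k b κ D K, affExt_isEquivalence hk hK,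
    fun x _ => ⟨(0, x, 0), trivial, rfl⟩, affExt_pushesTo hk C, rfl⟩

/-! ### Linear superposition -/

/-- The triple `(C, ũ = u + f, C)`. -/
def linTriple (C : Potential) (W : Set Space) (f : ℝ → ℝ → ℝ) : Triple where
  src := C
  dom := W
  map := fun z => (z.1, z.2.1, z.2.2 + f z.1 z.2.1)
  tgt := C

theorem linTriple_isFormAt {f : ℝ → ℝ → ℝ} {z : Space}
    (hf : ∀ᶠ w : ℝ × ℝ in 𝓝 (z.1, z.2.1), ContDiffAt ℝ ∞ (fun w : ℝ × ℝ => f w.1 w.2) w) :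
    IsFormAt (fun z : Space => ((z.1, z.2.1, z.2.2 + f z.1 z.2.1) : Space))
      (affPar 1 0 0 0 0) 1 f z :=
  ⟨one_ne_zero, Eventually.of_forall fun z => by simp [Par.mapAff, affPar, Par.X, Par.P],
    Eventually.of_forall fun t => affPar_good one_ne_zero t, hf⟩

theorem isOpen_planar {W : Set Space} (hW : IsOpen W) :
    IsOpen ((fun z : Space => (z.1, z.2.1)) '' W) := by
  have : IsOpenMap (fun z : Space => (z.1, z.2.1)) :=
    IsOpenMap.id.prodMap isOpenMap_fst
  exact this _ hW

theorem linTriple_admissible {C : Potential} {W : Set Space} {f : ℝ → ℝ → ℝ} (ho : IsOpen W)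
    (hne : W.Nonempty) (hC : C.dom = (fun z : Space => z.2.1) '' W)
    (hf : IsSolutionOn C f ((fun z : Space => (z.1, z.2.1)) '' W)) :
    IsAdmissible (linTriple C W f) := by
  refine isAdmissible_of_form ho hne hC hC ?_
  intro z hz
  have hev : ∀ᶠ w in 𝓝 (z.1, z.2.1), w ∈ (fun z : Space => (z.1, z.2.1)) '' W :=
    (isOpen_planar ho).mem_nhds ⟨z, hz, rfl⟩
  refine ⟨affPar 1 0 0 0 0, 1, f, linTriple_isFormAt (hev.mono fun w hw =>
    (hf.1 w hw).contDiffAt ((isOpen_planar ho).mem_nhds hw)), ?_, hf.2 _ ⟨z, hz, rfl⟩⟩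
  rw [affPar_Q]
  simp [affPar, Par.X, linTriple]

theorem isSolutionOn_zero (C : Potential) (D : Set (ℝ × ℝ)) :
    IsSolutionOn C (fun _ _ => 0) D :=
  ⟨contDiffOn_const, fun p _ => by rw [pdt_zero, pdx_pdx_zero]; simp⟩

/-- Elements of `essLinGroupoid` are compositions with a superposition, so the affine transformation
is followed by the trivial one, `f = 0`, over the whole range of the new variable. -/
theorem exists_affine_mem {k b κ D K : ℝ} (hk : k ≠ 0) (hK : K ≠ 0) (C : Potential) :
    ∃ T ∈ essLinGroupoid, T.src = C ∧ T.tgt = affTarget k κ D hk C ∧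
      T.dom = {z | z.2.1 ∈ C.dom} ∧ T.map = (affPar k b κ D 0).mapAff K fun _ _ => 0 := by
  set T₁ := (affExt k b κ D K).triple C (affTarget k κ D hk C) with hT₁
  set C' := affTarget k κ D hk C with hC'
  set T₂ := linTriple C' {z | z.2.1 ∈ C'.dom} fun _ _ => 0 with hT₂
  have hdom2 : C'.dom = (fun z : Space => z.2.1) '' {z : Space | z.2.1 ∈ C'.dom} := by
    ext x
    exact ⟨fun hx => ⟨(0, x, 0), hx, rfl⟩, fun ⟨z, hz, h⟩ => h ▸ hz⟩
  have a1 : IsAdmissible T₁ := affExt_admissible hk hK C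
  have a2 : IsAdmissible T₂ := linTriple_admissible
    (C'.isOpen_dom.preimage (by fun_prop)) (C'.nonempty_dom.imp' (fun x => (0, x, 0))
      fun x hx => hx) hdom2 (isSolutionOn_zero _ _)
  have hd : (comp T₁ T₂).dom = T₁.dom := by
    ext z
    simp only [comp, mem_inter_iff, mem_preimage, and_iff_left_iff_imp]
    intro hz
    exact (affTarget_dom (k := k) (κ := κ) (D := D) (hk := hk)).2 hz.2
  have hm : (comp T₁ T₂).map = T₁.map := by
    funext z
    simp [comp, T₂, linTriple]
  have hT : comp T₁ T₂ = T₁ := by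
    have e : comp T₁ T₂ = ⟨C, (comp T₁ T₂).dom, (comp T₁ T₂).map, C'⟩ := rfl
    rw [e, hd, hm]; rfl
  refine ⟨comp T₁ T₂, ⟨?_, T₁, affExt_mem_actionGroupoid hk hK C, T₂,
    ⟨a2, rfl, fun _ _ => 0, isSolutionOn_zero _ _, fun z _ => rfl⟩, rfl, rfl⟩, rfl, rfl, ?_, hm⟩
  · rw [hT]; exact a1
  · rw [hd]; simp [T₁, ExtTransformation.triple, affExt]

theorem affTarget_one (C : Potential) : affTarget 1 0 0 one_ne_zero C = C := by
  refine Potential.ext_on ?_ ?_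
  · ext x
    have := affTarget_dom (k := 1) (κ := 0) (D := 0) (hk := one_ne_zero) (C := C) (x := x)
    simpa using this
  · intro x hx
    have h1 := affTarget_dom (k := 1) (κ := 0) (D := 0) (hk := one_ne_zero) (C := C) (x := x)
    simp only [one_mul, add_zero] at h1
    have := affTarget_fn (k := 1) (κ := 0) (D := 0) (hk := one_ne_zero) (h1.1 hx)
    simpa using this

/-- The superposition is preceded by the identity of the equivalence group. Agreement of potentials
in the composition is `affTarget_one`. -/
theorem linTriple_mem {C : Potential} {W : Set Space} {f : ℝ → ℝ → ℝ} (ho : IsOpen W)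
    (hne : W.Nonempty) (hC : C.dom = (fun z : Space => z.2.1) '' W)
    (hf : IsSolutionOn C f ((fun z : Space => (z.1, z.2.1)) '' W)) :
    linTriple C W f ∈ essLinGroupoid := by
  have a2 := linTriple_admissible ho hne hC hf
  set T₁ := (affExt 1 0 0 0 1).triple C (affTarget 1 0 0 one_ne_zero C) with hT₁
  have hid : ∀ z, T₁.map z = z := fun z => by
    simp [T₁, ExtTransformation.triple, affExt, Par.mapAff, Par.X, Par.P, affPar]
  refine ⟨a2, T₁, affExt_mem_actionGroupoid one_ne_zero one_ne_zero C, linTriple C W f,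
    ⟨a2, rfl, f, hf, fun z _ => rfl⟩, affTarget_one C, ?_⟩
  have hd : T₁.dom ∩ T₁.map ⁻¹' W = W := by
    ext z
    simp only [mem_inter_iff, mem_preimage, hid, and_iff_right_iff_imp]
    intro hz
    refine ⟨trivial, ?_⟩
    rw [hC]
    exact ⟨z, hz, rfl⟩
  have hm : (linTriple C W f).map ∘ T₁.map = (linTriple C W f).map := by
    funext z; simp [hid]
  have e : comp T₁ (linTriple C W f)
      = ⟨C, T₁.dom ∩ T₁.map ⁻¹' W, (linTriple C W f).map ∘ T₁.map, C⟩ := rfl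
  rw [e, hd, hm]; rfl

/-! ### Locally generated transformations -/

/-- Admissibility requires the potentials to live exactly on the values of `x` and `x̃`, so
shrinking the domain forces both potentials to be cut down as well; the new target domain is open
because the map is open. -/
theorem IsAdmissible.exists_restriction {T : Triple} (hT : IsAdmissible T) {W : Set Space}
    (ho : IsOpen W) (hne : W.Nonempty) (hW : W ⊆ T.dom) :
    ∃ T₀, IsRestriction T₀ T ∧ T₀.dom = W ∧ T₀.map = T.map ∧
      T₀.src.dom = (fun z : Space => z.2.1) '' W ∧
      T₀.tgt.dom = (fun z : Space => (T.map z).2.1) '' W := by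
  have hs : (fun z : Space => z.2.1) '' W ⊆ T.src.dom := by
    rw [hT.src_dom]; exact image_mono hW
  have ht : (fun z : Space => (T.map z).2.1) '' W ⊆ T.tgt.dom := by
    rw [hT.tgt_dom]; exact image_mono hW
  have hot : IsOpen ((fun z : Space => (T.map z).2.1) '' W) := by
    have := isOpenMap_projX _ (hT.point.isOpen_image ho hW)
    rwa [image_image] at this
  let T₀ : Triple :=
    { src := mkPot _ T.src.fn (isOpenMap_projX _ ho) (hne.image _) (T.src.smooth_fn.mono hs)
      dom := W
      map := T.map
      tgt := mkPot _ T.tgt.fn hot (hne.image _) (T.tgt.smooth_fn.mono ht) }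
  refine ⟨T₀, ⟨?_, hW, fun _ _ => rfl,
    ⟨hs, fun x hx => indicator_of_mem hx T.src.fn⟩,
    ⟨ht, fun x hx => indicator_of_mem hx T.tgt.fn⟩⟩, rfl, rfl, rfl, rfl⟩
  refine ⟨⟨ho, hne, hT.point.smooth.mono hW, fun z hz => hT.point.bijective z (hW hz)⟩,
    rfl, rfl, ?_⟩
  rintro j hj hreg ⟨hx, hs'⟩
  have e1 : T₀.src.fn j.x = T.src.fn j.x := indicator_of_mem hx T.src.fn
  rw [e1] at hs'
  obtain ⟨-, h2⟩ := hT.maps j (hW hj) hreg ⟨hs hx, hs'⟩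
  have hmem : (prolong T.map j).x ∈ (fun z : Space => (T.map z).2.1) '' W := ⟨j.1, hj, rfl⟩
  refine ⟨hmem, ?_⟩
  have e2 : T₀.tgt.fn (prolong T.map j).x = T.tgt.fn (prolong T.map j).x :=
    indicator_of_mem hmem T.tgt.fn
  change (prolong T.map j).ut = (prolong T.map j).uxx + T₀.tgt.fn (prolong T.map j).x * _
  rw [e2]; exact h2

/-- The transformations that are composed. -/
def generators : Set Triple := generatingSet ∪ inverses generatingSet ∪ essLinGroupoid

/-- Over small open sets in a neighbourhood of `q`, the map `Φ` with the potentials `C` and `C'`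
is a composition of generators. -/
def Gen (Φ : Space → Space) (C C' : ℝ → ℝ) (q : ℝ × ℝ) : Prop :=
  ∃ N ∈ 𝓝 q, ∀ W : Set Space, IsOpen W → W.Nonempty → (∀ z ∈ W, (z.1, z.2.1) ∈ N) →
    ∃ T₀, IsComposition generators T₀ ∧ T₀.dom = W ∧ EqOn T₀.map Φ W ∧
      T₀.src.dom = (fun z : Space => z.2.1) '' W ∧ (∀ z ∈ W, T₀.src.fn z.2.1 = C z.2.1) ∧
      T₀.tgt.dom = (fun z : Space => (Φ z).2.1) '' W ∧
      ∀ z ∈ W, T₀.tgt.fn (Φ z).2.1 = C' (Φ z).2.1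

theorem Gen.congr {Φ Φ' : Space → Space} {C C' C₁ C₁' : ℝ → ℝ} {q : ℝ × ℝ} (h : Gen Φ C C' q)
    (hΦ : ∀ᶠ w : ℝ × ℝ in 𝓝 q, ∀ u, Φ (w.1, w.2, u) = Φ' (w.1, w.2, u))
    (hC : ∀ᶠ w : ℝ × ℝ in 𝓝 q, C w.2 = C₁ w.2)
    (hC' : ∀ᶠ w : ℝ × ℝ in 𝓝 q, ∀ u, C' (Φ (w.1, w.2, u)).2.1 = C₁' (Φ (w.1, w.2, u)).2.1) :
    Gen Φ' C₁ C₁' q := by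
  obtain ⟨N, hN, h⟩ := h
  refine ⟨N ∩ {w | (∀ u, Φ (w.1, w.2, u) = Φ' (w.1, w.2, u)) ∧ C w.2 = C₁ w.2 ∧
    ∀ u, C' (Φ (w.1, w.2, u)).2.1 = C₁' (Φ (w.1, w.2, u)).2.1},
    inter_mem hN (hΦ.and (hC.and hC')), fun W ho hne hW => ?_⟩
  obtain ⟨T₀, h1, h2, h3, h4, h5, h6, h7⟩ := h W ho hne fun z hz => (hW z hz).1
  have e1 : ∀ z ∈ W, Φ z = Φ' z := fun z hz => (hW z hz).2.1 z.2.2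
  have e2 : ∀ z ∈ W, C z.2.1 = C₁ z.2.1 := fun z hz => (hW z hz).2.2.1
  have e3 : ∀ z ∈ W, C' (Φ z).2.1 = C₁' (Φ z).2.1 := fun z hz => (hW z hz).2.2.2 z.2.2
  refine ⟨T₀, h1, h2, fun z hz => (h3 hz).trans (e1 z hz), h4,
    fun z hz => (h5 z hz).trans (e2 z hz), ?_, fun z hz => ?_⟩
  · rw [h6]
    exact image_congr fun z hz => by rw [e1 z hz]
  · rw [← e1 z hz, h7 z hz, e3 z hz]

theorem gen_of_mem {T : Triple} (hM : T ∈ generators) (hT : IsAdmissible T) {D : Set (ℝ × ℝ)}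
    (hD : IsOpen D) (hdom : ∀ z : Space, (z.1, z.2.1) ∈ D → z ∈ T.dom) {q : ℝ × ℝ} (hq : q ∈ D) :
    Gen T.map T.src.fn T.tgt.fn q := by
  refine ⟨D, hD.mem_nhds hq, fun W ho hne hW => ?_⟩
  obtain ⟨T₀, h1, h2, h3, h4, h5⟩ := hT.exists_restriction ho hne fun z hz => hdom z (hW z hz)
  refine ⟨T₀, .of hM h1, h2, fun z _ => by rw [h3], h4, fun z hz => ?_, h5, fun z hz => ?_⟩
  · exact h1.2.2.2.1.2 (by rw [h4]; exact ⟨z, hz, rfl⟩)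
  · exact h1.2.2.2.2.2 (by rw [h5]; exact ⟨z, hz, rfl⟩)

/-- The planar part of a parametrized transformation. -/
def Par.pt (p : Par) (q : ℝ × ℝ) : ℝ × ℝ := (p.τ q.1, p.X q.1 q.2)

theorem Par.continuousAt_pt {p : Par} {q : ℝ × ℝ} (h : p.Good q.1) : ContinuousAt p.pt q := by
  have c : ∀ {r : ℝ → ℝ}, ContDiffAt ℝ ∞ r q.1 → ContinuousAt (fun w : ℝ × ℝ => r w.1) q :=
    fun hr => ContinuousAt.comp (f := Prod.fst) hr.continuousAt continuousAt_fst
  exact (c h.sτ).prodMk (((c h.sa).mul continuousAt_snd).add (c h.sc))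

/-- Composability asks for equal potentials, domains included. Because `Gen` provides a composition
over every small open set, the second factor can be taken over exactly the image of `W` under the
first one, which is open. -/
theorem Gen.comp {p : Par} {σ : ℝ} {f : ℝ → ℝ → ℝ} {Φ' : Space → Space} {C C' C'' : ℝ → ℝ}
    {q : ℝ × ℝ} (hσ : σ ≠ 0) (hp : ∀ᶠ t in 𝓝 q.1, p.Good t)
    (hf : ∀ᶠ w : ℝ × ℝ in 𝓝 q, ContDiffAt ℝ ∞ (fun w : ℝ × ℝ => f w.1 w.2) w)
    (h : Gen (p.mapAff σ f) C C' q) (h' : Gen Φ' C' C'' (p.pt q)) :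
    Gen (Φ' ∘ p.mapAff σ f) C C'' q := by
  obtain ⟨N, hN, h⟩ := h
  obtain ⟨N', hN', h'⟩ := h'
  have hcont := Par.continuousAt_pt hp.self_of_nhds
  have hgood := (eventually_fst hp.eventually_nhds).and (hf.eventually_nhds)
  refine ⟨N ∩ (p.pt ⁻¹' N' ∩ _), inter_mem hN (inter_mem (hcont hN') hgood),
    fun W ho hne hW => ?_⟩
  set Φ := p.mapAff σ f with hΦ
  have hform : ∀ z ∈ W, IsFormAt Φ p σ f z := fun z hz =>
    ⟨hσ, Eventually.of_forall fun _ => rfl, (hW z hz).2.2.1, (hW z hz).2.2.2⟩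
  have hpt : IsPointTransformation W Φ := ⟨ho, hne,
    fun z hz => (hform z hz).contDiffAt.contDiffWithinAt, fun z hz => (hform z hz).bijective⟩
  obtain ⟨T₁, c1, d1, m1, s1, s1', t1, t1'⟩ := h W ho hne fun z hz => (hW z hz).1
  obtain ⟨T₂, c2, d2, m2, s2, s2', t2, t2'⟩ := h' (Φ '' W) (hpt.isOpen_image ho Subset.rfl)
    (hne.image _) (by rintro _ ⟨z, hz, rfl⟩; exact (hW z hz).2.1)
  have hcomp : Composable T₁ T₂ := by
    refine Potential.ext_on ?_ ?_
    · rw [t1, s2, image_image]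
    · rw [t1]
      rintro _ ⟨z, hz, rfl⟩
      exact (t1' z hz).trans (s2' (Φ z) ⟨z, hz, rfl⟩).symm
  refine ⟨HeatPot.comp T₁ T₂, .comp c1 c2 hcomp, ?_, ?_, s1, s1', ?_, ?_⟩
  · simp only [HeatPot.comp, d1, d2]
    ext z
    refine ⟨fun hz => hz.1, fun hz => ⟨hz, z, hz, (m1 hz).symm⟩⟩
  · intro z hz
    change T₂.map (T₁.map z) = Φ' (Φ z)
    rw [m1 hz]
    exact m2 ⟨z, hz, rfl⟩
  · change T₂.tgt.dom = _
    rw [t2, image_image]; rfl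
  · intro z hz
    exact t2' (Φ z) ⟨z, hz, rfl⟩

/-- `C` is smooth in a neighbourhood of `x`. -/
def SmoothNear (C : ℝ → ℝ) (x : ℝ) : Prop := ∀ᶠ y in 𝓝 x, ContDiffAt ℝ ∞ C y

theorem gen_affine {k b κ D K : ℝ} (hk : k ≠ 0) (hK : K ≠ 0) {C C' : ℝ → ℝ} {q : ℝ × ℝ}
    (hC : SmoothNear C q.2) (hrel : ∀ᶠ x in 𝓝 q.2, k ^ 2 * C' (k * x + κ) = C x + D) :
    Gen ((affPar k b κ D 0).mapAff K fun _ _ => 0) C C' q := by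
  refine ⟨_, eventually_snd (hC.and hrel), fun W ho hne hW => ?_⟩
  let S : Potential := mkPot ((fun z : Space => z.2.1) '' W) C (isOpenMap_projX _ ho)
    (hne.image _) (by rintro _ ⟨z, hz, rfl⟩; exact (hW z hz).1.contDiffWithinAt)
  obtain ⟨T, hT, e1, e2, e3, e4⟩ := exists_affine_mem (b := b) (κ := κ) (D := D) hk hK S
  obtain ⟨T₀, h1, h2, h3, h4, h5⟩ := IsAdmissible.exists_restriction hT.1 ho hne (fun z hz => by
    rw [e3]; exact ⟨z, hz, rfl⟩)
  rw [e4] at h3 h5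
  refine ⟨T₀, .of (Or.inr hT) h1, h2, fun z _ => by rw [h3], h4, fun z hz => ?_, h5,
    fun z hz => ?_⟩
  · have hm : z.2.1 ∈ (fun z : Space => z.2.1) '' W := ⟨z, hz, rfl⟩
    have := h1.2.2.2.1.2 (by rw [h4]; exact hm)
    rw [this, e1]
    exact indicator_of_mem hm C
  · have hm : z.2.1 ∈ (fun z : Space => z.2.1) '' W := ⟨z, hz, rfl⟩
    have := h1.2.2.2.2.2 (by rw [h5]; exact ⟨z, hz, rfl⟩)
    rw [this, e2]
    have h6 : (affTarget k κ D hk S).fn (k * z.2.1 + κ) = _ := affTarget_fn hm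
    refine Eq.trans h6 ?_
    have h7 : S.fn z.2.1 = C z.2.1 := indicator_of_mem hm C
    rw [h7, ← (hW z hz).2]
    change k ^ 2 * C' (k * z.2.1 + κ) / k ^ 2 = C' (k * z.2.1 + κ)
    field_simp

theorem isRestriction_self {T : Triple} (h : T ∈ equivGroupoid) : IsRestriction T T :=
  ⟨h, Subset.rfl, fun _ _ => rfl, ⟨Subset.rfl, fun _ _ => rfl⟩, ⟨Subset.rfl, fun _ _ => rfl⟩⟩

theorem gen_lin {C : ℝ → ℝ} {f : ℝ → ℝ → ℝ} {q : ℝ × ℝ} (hC : SmoothNear C q.2)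
    (hf : ∀ᶠ w : ℝ × ℝ in 𝓝 q, ContDiffAt ℝ ∞ (fun w : ℝ × ℝ => f w.1 w.2) w)
    (hs : ∀ᶠ w : ℝ × ℝ in 𝓝 q, pdt f w.1 w.2 = pdx (pdx f) w.1 w.2 + C w.2 * f w.1 w.2) :
    Gen ((affPar 1 0 0 0 0).mapAff 1 f) C C q := by
  refine ⟨_, (eventually_snd hC).and (hf.and hs), fun W ho hne hW => ?_⟩
  let S : Potential := mkPot ((fun z : Space => z.2.1) '' W) C (isOpenMap_projX _ ho)
    (hne.image _) (by rintro _ ⟨z, hz, rfl⟩; exact (hW z hz).1.contDiffWithinAt)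
  have hS : ∀ z ∈ W, S.fn z.2.1 = C z.2.1 := fun z hz => indicator_of_mem (mem_image_of_mem _ hz) C
  have hsol : IsSolutionOn S f ((fun z : Space => (z.1, z.2.1)) '' W) := by
    constructor
    · rintro _ ⟨z, hz, rfl⟩
      exact (hW z hz).2.1.contDiffWithinAt
    · rintro _ ⟨z, hz, rfl⟩
      dsimp only
      rw [hS z hz]
      exact (hW z hz).2.2
  have hmem := linTriple_mem (C := S) ho hne rfl hsol
  have hmap : (linTriple S W f).map = (affPar 1 0 0 0 0).mapAff 1 f := by
    funext z; simp [linTriple, Par.mapAff, Par.X, Par.P, affPar]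
  have hx : ∀ z : Space, ((affPar 1 0 0 0 0).mapAff 1 f z).2.1 = z.2.1 := fun z => by
    simp [Par.mapAff, Par.X, affPar]
  refine ⟨linTriple S W f, .of (Or.inr hmem) (isRestriction_self hmem.1), rfl,
    fun z _ => by rw [hmap], rfl, hS, ?_, ?_⟩
  · simp only [hx]; rfl
  · intro z hz
    rw [hx]; exact hS z hz

/-! ### The groupoid of parametrized transformations -/

/-- The parametrized transformation maps the potential `C` to `C'` near `q`. -/
structure Rel (p : Par) (C C' : ℝ → ℝ) (q : ℝ × ℝ) : Prop where
  good : ∀ᶠ t in 𝓝 q.1, p.Good t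
  src : SmoothNear C q.2
  tgt : SmoothNear C' (p.X q.1 q.2)
  rel : ∀ᶠ w : ℝ × ℝ in 𝓝 q, p.a w.1 ^ 2 * C' (p.X w.1 w.2) = C w.2 + p.Q w.1 w.2

/-- The parameters of a composition. -/
def Par.comp (p r : Par) : Par where
  τ := fun t => r.τ (p.τ t)
  a := fun t => r.a (p.τ t) * p.a t
  c := fun t => r.a (p.τ t) * p.c t + r.c (p.τ t)
  A := fun t => p.A t + p.a t ^ 2 * r.A (p.τ t)
  B := fun t => p.B t + 2 * p.a t * p.c t * r.A (p.τ t) + p.a t * r.B (p.τ t)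
  H := fun t => p.H t + p.c t ^ 2 * r.A (p.τ t) + p.c t * r.B (p.τ t) + r.H (p.τ t)

theorem Par.comp_X (p r : Par) (t x : ℝ) : (p.comp r).X t x = r.X (p.τ t) (p.X t x) := by
  simp only [comp, X]; ring

theorem Par.comp_map (p r : Par) : (p.comp r).map = r.map ∘ p.map := by
  funext z
  refine Prod.ext rfl (Prod.ext (p.comp_X r _ _) ?_)
  have : (p.comp r).P z.1 z.2.1 = r.P (p.τ z.1) (p.X z.1 z.2.1) + p.P z.1 z.2.1 := by
    simp only [comp, X, P]; ring
  simp only [map, mapAff, Function.comp, this, Real.exp_add]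
  ring

section Comp

variable {p r : Par} {t : ℝ}

theorem Par.Good.comp_deriv {g : ℝ → ℝ} (hp : p.Good t) (hg : ContDiffAt ℝ ∞ g (p.τ t)) :
    HasDerivAt (fun s => g (p.τ s)) (deriv g (p.τ t) * p.a t ^ 2) t :=
  (hg.differentiableAt (by simp)).hasDerivAt.comp t hp.dτ

theorem Par.Good.dA_comp (hp : p.Good t) (hr : r.Good (p.τ t)) :
    HasDerivAt (p.comp r).A (deriv p.A t + 2 * p.a t * (-4 * p.a t * p.A t) * r.A (p.τ t)
      + p.a t ^ 2 * (deriv r.A (p.τ t) * p.a t ^ 2)) t := by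
  refine (hp.dA.add ((hp.da.pow 2).mul (hp.comp_deriv hr.sA))).congr_deriv ?_
  simp; ring

theorem Par.Good.dB_comp (hp : p.Good t) (hr : r.Good (p.τ t)) :
    HasDerivAt (p.comp r).B (deriv p.B t
      + 2 * ((-4 * p.a t * p.A t) * p.c t + p.a t * (-2 * p.a t * p.B t)) * r.A (p.τ t)
      + 2 * p.a t * p.c t * (deriv r.A (p.τ t) * p.a t ^ 2)
      + (-4 * p.a t * p.A t) * r.B (p.τ t) + p.a t * (deriv r.B (p.τ t) * p.a t ^ 2)) t := by
  refine ((hp.dB.add (((hp.da.const_mul 2).mul hp.dc).mul (hp.comp_deriv hr.sA))).add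
    (hp.da.mul (hp.comp_deriv hr.sB))).congr_deriv ?_
  simp; ring

theorem Par.Good.dH_comp (hp : p.Good t) (hr : r.Good (p.τ t)) :
    HasDerivAt (p.comp r).H (deriv p.H t + 2 * p.c t * (-2 * p.a t * p.B t) * r.A (p.τ t)
      + p.c t ^ 2 * (deriv r.A (p.τ t) * p.a t ^ 2) + (-2 * p.a t * p.B t) * r.B (p.τ t)
      + p.c t * (deriv r.B (p.τ t) * p.a t ^ 2) + deriv r.H (p.τ t) * p.a t ^ 2) t := by
  refine (((hp.dH.add ((hp.dc.pow 2).mul (hp.comp_deriv hr.sA))).add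
    (hp.dc.mul (hp.comp_deriv hr.sB))).add (hp.comp_deriv hr.sH)).congr_deriv ?_
  simp; ring

theorem Par.Good.comp (hp : p.Good t) (hr : r.Good (p.τ t)) : (p.comp r).Good t := by
  have c : ∀ {g : ℝ → ℝ}, ContDiffAt ℝ ∞ g (p.τ t) → ContDiffAt ℝ ∞ (fun s => g (p.τ s)) t :=
    fun hg => hg.comp t hp.sτ
  refine ⟨c hr.sτ, (c hr.sa).mul hp.sa, ((c hr.sa).mul hp.sc).add (c hr.sc),
    hp.sA.add ((hp.sa.pow 2).mul (c hr.sA)),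
    (hp.sB.add (((contDiffAt_const.mul hp.sa).mul hp.sc).mul (c hr.sA))).add
      (hp.sa.mul (c hr.sB)),
    ((hp.sH.add ((hp.sc.pow 2).mul (c hr.sA))).add (hp.sc.mul (c hr.sB))).add (c hr.sH),
    mul_ne_zero hr.a_ne hp.a_ne, ?_, ?_, ?_⟩
  · refine (hr.dτ.comp t hp.dτ).congr_deriv ?_
    simp only [Par.comp]; ring
  · refine ((hr.da.comp t hp.dτ).mul hp.da).congr_deriv ?_
    simp only [Par.comp, Function.comp]; ring
  · refine (((hr.da.comp t hp.dτ).mul hp.dc).add (hr.dc.comp t hp.dτ)).congr_deriv ?_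
    simp only [Par.comp, Function.comp]; ring

/-- The cocycle identity for `Q`; it is what makes the relation of potentials transitive under
composition. -/
theorem Par.Good.comp_Q (hp : p.Good t) (hr : r.Good (p.τ t)) (x : ℝ) :
    (p.comp r).Q t x = p.Q t x + p.a t ^ 2 * r.Q (p.τ t) (p.X t x) := by
  unfold Par.Q
  rw [(hp.dA_comp hr).deriv, (hp.dB_comp hr).deriv, (hp.dH_comp hr).deriv]
  simp only [Par.comp, Par.X]
  ring

end Comp

section

variable {p r : Par} {C C' C'' : ℝ → ℝ} {q : ℝ × ℝ}

theorem Rel.comp (hp : Rel p C C' q) (hr : Rel r C' C'' (p.pt q)) : Rel (p.comp r) C C'' q := by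
  have hτ : ContinuousAt p.τ q.1 := hp.good.self_of_nhds.sτ.continuousAt
  have hcont := Par.continuousAt_pt hp.good.self_of_nhds
  refine ⟨?_, hp.src, ?_, ?_⟩
  · filter_upwards [hp.good, hτ.eventually hr.good] with t h1 h2 using h1.comp h2
  · rw [Par.comp_X]; exact hr.tgt
  · filter_upwards [hp.rel, hcont.eventually hr.rel, eventually_fst hp.good,
      eventually_fst (hτ.eventually hr.good)] with w h1 h2 h3 h4
    rw [h3.comp_Q h4, Par.comp_X]
    simp only [Par.pt] at h2
    simp only [Par.comp]
    linear_combination p.a w.1 ^ 2 * h2 + h1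

/-- The parametrized transformation is generated and maps `C` to another potential near `q`. -/
structure GenRel (p : Par) (C C' : ℝ → ℝ) (q : ℝ × ℝ) : Prop where
  rel : Rel p C C' q
  gen : Gen p.map C C' q

theorem GenRel.comp (hp : GenRel p C C' q) (hr : GenRel r C' C'' (p.pt q)) :
    GenRel (p.comp r) C C'' q := by
  refine ⟨hp.rel.comp hr.rel, ?_⟩
  rw [Par.comp_map]
  exact Gen.comp one_ne_zero hp.rel.good (Eventually.of_forall fun _ => contDiffAt_const)
    hp.gen hr.gen

theorem Rel.eventually_tgt (hp : Rel p C C' q) {P : ℝ → Prop}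
    (h : ∀ᶠ y in 𝓝 (p.X q.1 q.2), P y) : ∀ᶠ w : ℝ × ℝ in 𝓝 q, P (p.X w.1 w.2) := by
  have hcont := Par.continuousAt_pt hp.good.self_of_nhds
  exact hcont.eventually (eventually_snd (q := p.pt q) h)

theorem GenRel.congr_par {p' : Par} (h : GenRel p C C' q) (h' : Rel p' C C' q)
    (hτ : ∀ᶠ t in 𝓝 q.1, p'.τ t = p.τ t) (ha : ∀ᶠ t in 𝓝 q.1, p'.a t = p.a t)
    (hc : ∀ᶠ t in 𝓝 q.1, p'.c t = p.c t) (hA : ∀ᶠ t in 𝓝 q.1, p'.A t = p.A t)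
    (hB : ∀ᶠ t in 𝓝 q.1, p'.B t = p.B t) (hH : ∀ᶠ t in 𝓝 q.1, p'.H t = p.H t) :
    GenRel p' C C' q := by
  refine ⟨h', h.gen.congr ?_ (Eventually.of_forall fun _ => rfl)
    (Eventually.of_forall fun _ _ => rfl)⟩
  filter_upwards [eventually_fst hτ, eventually_fst ha, eventually_fst hc, eventually_fst hA,
    eventually_fst hB, eventually_fst hH] with w h1 h2 h3 h4 h5 h6 u
  simp only [Par.map, Par.mapAff, Par.X, Par.P, h1, h2, h3, h4, h5, h6]

theorem SmoothNear.congr {C C₁ : ℝ → ℝ} {x : ℝ} (h : SmoothNear C x)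
    (he : ∀ᶠ y in 𝓝 x, C y = C₁ y) : SmoothNear C₁ x := by
  filter_upwards [h, he.eventually_nhds] with y h1 h2
  exact h1.congr_of_eventuallyEq (h2.mono fun _ h => h.symm)

theorem Rel.congr_pot {C₁ C₁' : ℝ → ℝ} (h : Rel p C C' q)
    (hC : ∀ᶠ x in 𝓝 q.2, C x = C₁ x) (hC' : ∀ᶠ x in 𝓝 (p.X q.1 q.2), C' x = C₁' x) :
    Rel p C₁ C₁' q := by
  refine ⟨h.good, h.src.congr hC, h.tgt.congr hC', ?_⟩
  filter_upwards [h.rel, eventually_snd hC, h.eventually_tgt hC'] with w h1 h2 h3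
  rw [← h2, ← h3, h1]

theorem GenRel.congr_pot {C₁ C₁' : ℝ → ℝ} (h : GenRel p C C' q)
    (hC : ∀ᶠ x in 𝓝 q.2, C x = C₁ x) (hC' : ∀ᶠ x in 𝓝 (p.X q.1 q.2), C' x = C₁' x) :
    GenRel p C₁ C₁' q :=
  ⟨h.rel.congr_pot hC hC', h.gen.congr (Eventually.of_forall fun _ _ => rfl) (eventually_snd hC)
    ((h.rel.eventually_tgt hC').mono fun _ h _ => h)⟩

/-- Affine transformations are generated. -/
theorem genRel_affine {k b κ D l : ℝ} (hk : k ≠ 0) (hC : SmoothNear C q.2)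
    (hC' : SmoothNear C' (k * q.2 + κ))
    (hrel : ∀ᶠ x in 𝓝 q.2, k ^ 2 * C' (k * x + κ) = C x + D) :
    GenRel (affPar k b κ D l) C C' q := by
  refine ⟨⟨Eventually.of_forall fun t => affPar_good hk t, hC, hC', ?_⟩, ?_⟩
  · filter_upwards [eventually_snd hrel] with w hw
    rw [affPar_Q]; exact hw
  · refine (gen_affine hk (Real.exp_pos l).ne' (b := b) hC hrel).congr
      (Eventually.of_forall fun w u => ?_) (Eventually.of_forall fun _ => rfl)
      (Eventually.of_forall fun _ _ => rfl)
    simp only [Par.map, Par.mapAff, affPar, Par.P, Par.X]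
    refine Prod.ext rfl (Prod.ext rfl ?_)
    dsimp only
    rw [one_mul, ← Real.exp_add]
    congr 2
    ring

/-- If the space parts of two transformations of `C` differ by an affine change of variables,
and one of them is generated, then so is the other. -/
theorem GenRel.of_affine {p' : Par} {C₁ : ℝ → ℝ} (hp : Rel p C C' q) (h : GenRel p' C C₁ q)
    {k κ : ℝ} (ha : ∀ᶠ t in 𝓝 q.1, p.a t = k * p'.a t)
    (hc : ∀ᶠ t in 𝓝 q.1, p.c t = k * p'.c t + κ) : GenRel p C C' q := by
  have hk : k ≠ 0 := by
    rintro rfl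
    have := ha.self_of_nhds
    rw [zero_mul] at this
    exact hp.good.self_of_nhds.a_ne this
  -- The functions `a` and `c` determine `A` and `B` through `a' = -4aA` and `c' = -2aB`, and these
  -- equations are insensitive to the constants `k` and `κ`.
  have hA : ∀ᶠ t in 𝓝 q.1, p.A t = p'.A t := by
    filter_upwards [ha.eventually_nhds, hp.good, h.rel.good] with t h1 h2 h3
    have := (h2.da.congr_of_eventuallyEq (EventuallyEq.symm h1)).unique (h3.da.const_mul k)
    have e := h1.self_of_nhds
    have hne := h2.a_ne
    have : p.a t * (p.A t - p'.A t) = 0 := by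
      linear_combination -this / 4 - p'.A t * e
    have := (mul_eq_zero.1 this).resolve_left hne
    linarith
  have hB : ∀ᶠ t in 𝓝 q.1, p.B t = p'.B t := by
    filter_upwards [hc.eventually_nhds, ha, hp.good, h.rel.good] with t h1 e h2 h3
    have := (h2.dc.congr_of_eventuallyEq (EventuallyEq.symm h1)).unique
      ((h3.dc.const_mul k).add_const κ)
    have hne := h2.a_ne
    have : p.a t * (p.B t - p'.B t) = 0 := by
      linear_combination -this / 2 - p'.B t * e
    have := (mul_eq_zero.1 this).resolve_left hne
    linarith
  obtain ⟨b, hτ⟩ : ∃ b, ∀ᶠ t in 𝓝 q.1, p.τ t = k ^ 2 * p'.τ t + b := by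
    refine ⟨p.τ q.1 - k ^ 2 * p'.τ q.1, ?_⟩
    have : ∀ᶠ t in 𝓝 q.1, HasDerivAt (fun t => p.τ t - k ^ 2 * p'.τ t) 0 t := by
      filter_upwards [ha, hp.good, h.rel.good] with t e h2 h3
      refine (h2.dτ.sub (h3.dτ.const_mul (k ^ 2))).congr_deriv ?_
      rw [e]; ring
    filter_upwards [const_of_eventually_hasDerivAt_zero this] with t ht
    linarith
  -- the difference of the exponents
  have key : ∀ᶠ w : ℝ × ℝ in 𝓝 q, k ^ 2 * C' (k * p'.X w.1 w.2 + κ) - C₁ (p'.X w.1 w.2)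
      = (deriv p.H w.1 - deriv p'.H w.1) / p'.a w.1 ^ 2 := by
    filter_upwards [hp.rel, h.rel.rel, eventually_fst ha, eventually_fst hc,
      eventually_fst hA.eventually_nhds, eventually_fst hB.eventually_nhds,
      eventually_fst h.rel.good] with w h1 h2 h3 h4 h5 h6 h7
    have hne := h7.a_ne
    have eX : p.X w.1 w.2 = k * p'.X w.1 w.2 + κ := by
      simp only [Par.X, h3, h4]; ring
    have eQ : p.Q w.1 w.2 - p'.Q w.1 w.2 = deriv p.H w.1 - deriv p'.H w.1 := by
      unfold Par.Q
      rw [EventuallyEq.deriv_eq h5, EventuallyEq.deriv_eq h6, h5.self_of_nhds, h6.self_of_nhds]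
      ring
    rw [eX, h3] at h1
    field_simp
    linear_combination h1 - h2 + eQ
  -- In `key` the left side is a function of `x̃` and the right side a function of `t`. Varying `x`
  -- at the time `q.1` shows that the left side is a constant `D`, and then the right side equals
  -- `D` at all nearby times.
  set D := (deriv p.H q.1 - deriv p'.H q.1) / p'.a q.1 ^ 2 with hD
  have hane := h.rel.good.self_of_nhds.a_ne
  have hφ : ∀ᶠ y in 𝓝 (p'.X q.1 q.2), k ^ 2 * C' (k * y + κ) = C₁ y + D := by
    have ht : Tendsto (fun y => (q.1, (y - p'.c q.1) / p'.a q.1)) (𝓝 (p'.X q.1 q.2)) (𝓝 q) := by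
      have hcont : Continuous (fun y => (q.1, (y - p'.c q.1) / p'.a q.1)) := by fun_prop
      have := hcont.tendsto (p'.X q.1 q.2)
      have e : (p'.X q.1 q.2 - p'.c q.1) / p'.a q.1 = q.2 := by
        simp only [Par.X]; field_simp; ring
      rwa [e] at this
    filter_upwards [ht.eventually key] with y hy
    have e : p'.X q.1 ((y - p'.c q.1) / p'.a q.1) = y := by
      simp only [Par.X]; field_simp; ring
    simp only [e] at hy
    linarith
  have hδ : ∀ᶠ t in 𝓝 q.1, deriv p.H t - deriv p'.H t = D * p'.a t ^ 2 := by
    have h1 := (tendsto_slice_left q.1 q.2).eventually key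
    have h2 := (tendsto_slice_left q.1 q.2).eventually (h.rel.eventually_tgt hφ)
    filter_upwards [h1, h2, h.rel.good] with t h1 h2 h3
    have hne := h3.a_ne
    have : (deriv p.H t - deriv p'.H t) / p'.a t ^ 2 = D := by
      rw [← h1]; linarith
    rw [← this]; field_simp
  obtain ⟨l, hH⟩ : ∃ l, ∀ᶠ t in 𝓝 q.1, p.H t = p'.H t + D * p'.τ t + l := by
    refine ⟨p.H q.1 - p'.H q.1 - D * p'.τ q.1, ?_⟩
    have : ∀ᶠ t in 𝓝 q.1, HasDerivAt (fun t => p.H t - p'.H t - D * p'.τ t) 0 t := by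
      filter_upwards [hδ, hp.good, h.rel.good] with t e h2 h3
      refine ((h2.dH.sub h3.dH).sub (h3.dτ.const_mul D)).congr_deriv ?_
      rw [e]; ring
    filter_upwards [const_of_eventually_hasDerivAt_zero this] with t ht
    linarith
  have hX : p.X q.1 q.2 = k * p'.X q.1 q.2 + κ := by
    simp only [Par.X, ha.self_of_nhds, hc.self_of_nhds]; ring
  -- The affine transformation by which `p` and `p'` differ; its time rate in the exponent is the
  -- separation constant `D`.
  have hE : GenRel (affPar k b κ D l) C₁ C' (p'.pt q) :=
    genRel_affine hk h.rel.tgt (by rw [Par.pt, ← hX]; exact hp.tgt) hφ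
  refine (h.comp hE).congr_par hp ?_ ?_ ?_ ?_ ?_ ?_
  · exact hτ
  · exact ha
  · exact hc
  · filter_upwards [hA] with t ht
    simp [Par.comp, affPar, ht]
  · filter_upwards [hB] with t ht
    simp [Par.comp, affPar, ht]
  · filter_upwards [hH] with t ht
    simp only [Par.comp, affPar, ht]; ring

end

/-! ### The elements of the generating set and their inverses -/

section Cylinder

variable {T : Triple} {p : Par} {D : Set (ℝ × ℝ)}

/-- The triple is given over the planar set `D` by the parameters `p`. -/
structure IsGivenBy (T : Triple) (p : Par) (D : Set (ℝ × ℝ)) : Prop where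
  isOpen : IsOpen D
  nonempty : D.Nonempty
  dom : T.dom = {z | (z.1, z.2.1) ∈ D}
  src : ∀ x, x ∈ T.src.dom ↔ ∃ t, (t, x) ∈ D
  tgt : ∀ y, y ∈ T.tgt.dom ↔ ∃ t x, (t, x) ∈ D ∧ p.X t x = y
  map : ∀ z : Space, (z.1, z.2.1) ∈ D → T.map z = p.map z
  good : ∀ t x, (t, x) ∈ D → p.Good t
  rel : ∀ t x, (t, x) ∈ D → p.a t ^ 2 * T.tgt.fn (p.X t x) = T.src.fn x + p.Q t x

theorem IsGivenBy.good_near (h : IsGivenBy T p D) {q : ℝ × ℝ} (hq : q ∈ D) :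
    ∀ᶠ t in 𝓝 q.1, p.Good t := by
  have : ∀ᶠ w in 𝓝 (q.1, q.2), w ∈ D := h.isOpen.mem_nhds hq
  filter_upwards [(tendsto_slice_left q.1 q.2).eventually this] with t ht
  exact h.good t q.2 ht

theorem IsGivenBy.isAdmissible (h : IsGivenBy T p D) : IsAdmissible T := by
  refine isAdmissible_of_form ?_ ?_ ?_ ?_ ?_
  · rw [h.dom]; exact h.isOpen.preimage (by fun_prop)
  · obtain ⟨w, hw⟩ := h.nonempty
    rw [h.dom]; exact ⟨(w.1, w.2, 0), hw⟩
  · ext x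
    rw [h.src, h.dom]
    exact ⟨fun ⟨t, ht⟩ => ⟨(t, x, 0), ht, rfl⟩, fun ⟨z, hz, hx⟩ => ⟨z.1, hx ▸ hz⟩⟩
  · ext y
    rw [h.tgt, h.dom]
    constructor
    · rintro ⟨t, x, ht, rfl⟩
      exact ⟨(t, x, 0), ht, by dsimp only; rw [h.map _ ht]; rfl⟩
    · rintro ⟨z, hz, rfl⟩
      exact ⟨z.1, z.2.1, hz, by dsimp only; rw [h.map z hz]; rfl⟩
  · intro z hz
    rw [h.dom] at hz
    refine ⟨p, 1, fun _ _ => 0, ⟨one_ne_zero, ?_, h.good_near hz,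
      Eventually.of_forall fun _ => contDiffAt_const⟩, h.rel _ _ hz, ?_⟩
    · have ho : IsOpen {z : Space | (z.1, z.2.1) ∈ D} := h.isOpen.preimage (by fun_prop)
      filter_upwards [ho.mem_nhds hz] with y hy using h.map y hy
    · rw [pdt_zero, pdx_pdx_zero]; simp

theorem Potential.smoothNear (C : Potential) {x : ℝ} (hx : x ∈ C.dom) : SmoothNear C.fn x := by
  filter_upwards [C.isOpen_dom.mem_nhds hx] with y hy using C.contDiffAt hy

theorem IsGivenBy.genRel (h : IsGivenBy T p D) (hT : T ∈ generators) {q : ℝ × ℝ} (hq : q ∈ D) :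
    GenRel p T.src.fn T.tgt.fn q := by
  have hev : ∀ᶠ w in 𝓝 q, w ∈ D := h.isOpen.mem_nhds hq
  refine ⟨⟨h.good_near hq, T.src.smoothNear ((h.src _).2 ⟨q.1, hq⟩),
    T.tgt.smoothNear ((h.tgt _).2 ⟨q.1, q.2, hq, rfl⟩), hev.mono fun w hw => h.rel _ _ hw⟩, ?_⟩
  refine (gen_of_mem hT h.isAdmissible h.isOpen (fun z hz => by rw [h.dom]; exact hz) hq).congr
    (hev.mono fun w hw u => h.map (w.1, w.2, u) hw) (Eventually.of_forall fun _ => rfl)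
    (Eventually.of_forall fun _ _ => rfl)

/-- The parameters act trivially at `t`. -/
structure Par.IsId (p : Par) (t : ℝ) : Prop where
  τ : p.τ t = t
  a : p.a t = 1
  c : p.c t = 0
  A : p.A t = 0
  B : p.B t = 0
  H : p.H t = 0

theorem Par.IsId.map_eq {z : Space} (h : p.IsId z.1) : p.map z = z := by
  simp [Par.map, Par.mapAff, Par.X, Par.P, h.τ, h.a, h.c, h.A, h.B, h.H]

theorem IsGivenBy.isInverse {T' : Triple} {p' : Par} {D' : Set (ℝ × ℝ)} (h : IsGivenBy T p D)
    (h' : IsGivenBy T' p' D') (hs : T'.src = T.tgt) (ht : T'.tgt = T.src)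
    (hD : ∀ t x, (t, x) ∈ D' → p'.pt (t, x) ∈ D)
    (hid : ∀ t x, (t, x) ∈ D' → (p'.comp p).IsId t) : IsInverse T T' := by
  refine ⟨h'.isAdmissible, hs, ht, ?_, ?_⟩
  · intro w hw
    rw [h'.dom] at hw
    rw [h'.map w hw, h.dom]
    exact hD _ _ hw
  · intro w hw
    rw [h'.dom] at hw
    rw [h'.map w hw, h.map _ (hD _ _ hw)]
    have := (hid _ _ hw).map_eq
    rwa [Par.comp_map] at this

end Cylinder

/-- The inverse square is scale-invariant with weight `a²`, while `x²` acquires `a⁴`. For `μ = 0`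
the point `x = 0` is allowed, as `0 / 0 = 0`. -/
theorem quad_scale {μ a x b : ℝ} (ha : a ≠ 0) (hx : μ = 0 ∨ x ≠ 0) :
    a ^ 2 * (μ / (a * x) ^ 2 + b * (a * x) ^ 2) = μ / x ^ 2 + b * a ^ 4 * x ^ 2 := by
  rcases hx with rfl | hx
  · simp; ring
  · field_simp

/-- The parameters of `Φ₁`. -/
def par1 : Par where
  τ := fun t => Real.tan (2 * t) / 2
  a := fun t => (Real.cos (2 * t))⁻¹
  c := fun _ => 0
  A := fun t => -(Real.tan (2 * t) / 2)
  B := fun _ => 0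
  H := fun t => Real.log (Real.cos (2 * t)) / 2

/-- The branch with new time in `(-π/4, π/4)`, where the cosine is positive; it is defined for every
`t`. -/
def par1Inv : Par where
  τ := fun t => Real.arctan (2 * t) / 2
  a := fun t => Real.cos (Real.arctan (2 * t))
  c := fun _ => 0
  A := fun t => t / (1 + 4 * t ^ 2)
  B := fun _ => 0
  H := fun t => -(Real.log (Real.cos (Real.arctan (2 * t))) / 2)

def par2 : Par where
  τ := fun t => Real.exp (4 * t) / 4
  a := fun t => Real.exp (2 * t)
  c := fun _ => 0
  A := fun _ => -(1 / 2)
  B := fun _ => 0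
  H := fun t => -t

/-- Meaningful for `t > 0` only, the range of `exp (4t) / 4`. -/
def par2Inv : Par where
  τ := fun t => Real.log (4 * t) / 4
  a := fun t => Real.exp (-(Real.log (4 * t) / 2))
  c := fun _ => 0
  A := fun t => 1 / (8 * t)
  B := fun _ => 0
  H := fun t => Real.log (4 * t) / 4

def par3 : Par where
  τ := fun t => t
  a := fun _ => 1
  c := fun t => t ^ 2
  A := fun _ => 0
  B := fun t => -t
  H := fun t => -(t ^ 3 / 3)

def par3Inv : Par where
  τ := fun t => t
  a := fun _ => 1
  c := fun t => -t ^ 2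
  A := fun _ => 0
  B := fun t => t
  H := fun t => -(2 * t ^ 3 / 3)

/-! ### Determining equations and `Q` for the explicit parameters -/

theorem hasDerivAt_two_mul (t : ℝ) : HasDerivAt (fun t : ℝ => 2 * t) 2 t :=
  ((hasDerivAt_id t).const_mul 2).congr_deriv (by simp)

theorem hasDerivAt_four_mul (t : ℝ) : HasDerivAt (fun t : ℝ => 4 * t) 4 t :=
  ((hasDerivAt_id t).const_mul 4).congr_deriv (by simp)

theorem hasDerivAt_tan_two_mul {t : ℝ} (h : Real.cos (2 * t) ≠ 0) :
    HasDerivAt (fun t => Real.tan (2 * t)) (2 / Real.cos (2 * t) ^ 2) t :=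
  ((Real.hasDerivAt_tan h).comp t (hasDerivAt_two_mul t)).congr_deriv (by ring)

theorem hasDerivAt_cos_two_mul (t : ℝ) :
    HasDerivAt (fun t => Real.cos (2 * t)) (-(2 * Real.sin (2 * t))) t :=
  ((Real.hasDerivAt_cos _).comp t (hasDerivAt_two_mul t)).congr_deriv (by ring)

theorem par1_good {t : ℝ} (h : Real.cos (2 * t) ≠ 0) : par1.Good t := by
  have s2 : ContDiffAt ℝ ∞ (fun t : ℝ => 2 * t) t := by fun_prop
  have st : ContDiffAt ℝ ∞ (fun t => Real.tan (2 * t)) t :=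
    (Real.contDiffAt_tan.2 h).comp t (f := fun t : ℝ => 2 * t) s2
  have sc : ContDiffAt ℝ ∞ (fun t => Real.cos (2 * t)) t :=
    Real.contDiff_cos.contDiffAt.comp t (f := fun t : ℝ => 2 * t) s2
  refine ⟨st.div_const 2, sc.inv h, contDiffAt_const, (st.div_const 2).neg, contDiffAt_const,
    (sc.log h).div_const 2, inv_ne_zero h, ?_, ?_, ?_⟩
  · refine ((hasDerivAt_tan_two_mul h).div_const 2).congr_deriv ?_
    simp only [par1]; field_simp
  · refine ((hasDerivAt_cos_two_mul t).inv h).congr_deriv ?_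
    simp only [par1, Real.tan_eq_sin_div_cos]; field_simp; ring
  · refine (hasDerivAt_const t (0 : ℝ)).congr_deriv ?_
    simp [par1]

/-- The coefficient of `x²` in `Q` is the Riccati expression `A' + 4A²`, and `A = -tan(2t)/2` makes
it `-1`; `H` is the solution of `H' = 2A` that removes the free term. -/
theorem par1_Q {t : ℝ} (h : Real.cos (2 * t) ≠ 0) (x : ℝ) : par1.Q t x = -x ^ 2 := by
  have dA : deriv par1.A t = -(2 / Real.cos (2 * t) ^ 2 / 2) :=
    ((hasDerivAt_tan_two_mul h).div_const 2).neg.deriv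
  have dH : deriv par1.H t = -(2 * Real.sin (2 * t)) / Real.cos (2 * t) / 2 :=
    (((hasDerivAt_cos_two_mul t).log h).div_const 2).deriv
  have dB : deriv par1.B t = 0 := (hasDerivAt_const t (0 : ℝ)).deriv
  unfold Par.Q
  rw [dA, dB, dH]
  simp only [par1, Real.tan_eq_sin_div_cos]
  have hs : Real.sin (2 * t) ^ 2 = 1 - Real.cos (2 * t) ^ 2 := Real.sin_sq _
  field_simp
  linear_combination 4 * x ^ 2 * hs

theorem cos_arctan_ne (s : ℝ) : Real.cos (Real.arctan s) ≠ 0 := (Real.cos_arctan_pos s).ne'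

theorem hasDerivAt_arctan_two_mul (t : ℝ) :
    HasDerivAt (fun t => Real.arctan (2 * t)) (2 / (1 + 4 * t ^ 2)) t := by
  refine ((Real.hasDerivAt_arctan _).comp t (hasDerivAt_two_mul t)).congr_deriv ?_
  ring_nf

theorem hasDerivAt_cos_arctan_two_mul (t : ℝ) :
    HasDerivAt (fun t => Real.cos (Real.arctan (2 * t)))
      (-4 * Real.cos (Real.arctan (2 * t)) * (t / (1 + 4 * t ^ 2))) t := by
  refine ((Real.hasDerivAt_cos _).comp t (hasDerivAt_arctan_two_mul t)).congr_deriv ?_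
  have h := Real.tan_arctan (2 * t)
  have h0 := cos_arctan_ne (2 * t)
  rw [Real.tan_eq_sin_div_cos, div_eq_iff h0] at h
  rw [h]
  ring

theorem par1Inv_a_sq (t : ℝ) : par1Inv.a t ^ 2 = 1 / (1 + 4 * t ^ 2) := by
  simp only [par1Inv, Real.cos_sq_arctan]
  ring_nf

theorem par1Inv_good (t : ℝ) : par1Inv.Good t := by
  have s2 : ContDiffAt ℝ ∞ (fun t : ℝ => 2 * t) t := by fun_prop
  have hpos : (1 + 4 * t ^ 2) ≠ 0 := by positivity
  have st : ContDiffAt ℝ ∞ (fun t => Real.arctan (2 * t)) t :=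
    Real.contDiff_arctan.contDiffAt.comp t (f := fun t : ℝ => 2 * t) s2
  have sc : ContDiffAt ℝ ∞ (fun t => Real.cos (Real.arctan (2 * t))) t := st.cos
  refine ⟨st.div_const 2, sc, contDiffAt_const, contDiffAt_id.div (by fun_prop) hpos,
    contDiffAt_const, ((sc.log (cos_arctan_ne _)).div_const 2).neg, cos_arctan_ne _, ?_, ?_, ?_⟩
  · refine ((hasDerivAt_arctan_two_mul t).div_const 2).congr_deriv ?_
    rw [par1Inv_a_sq]; field_simp
  · exact hasDerivAt_cos_arctan_two_mul t
  · refine (hasDerivAt_const t (0 : ℝ)).congr_deriv ?_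
    simp [par1Inv]

/-- The value `a⁴ x²` is the potential `x̃²` pulled back with weight `a²`, so the transformation
adds exactly this term to the target. -/
theorem par1Inv_Q (t x : ℝ) : par1Inv.Q t x = par1Inv.a t ^ 4 * x ^ 2 := by
  have hpos : (1 + 4 * t ^ 2) ≠ 0 := by positivity
  have hden : HasDerivAt (fun t : ℝ => 1 + 4 * t ^ 2) (8 * t) t :=
    ((((hasDerivAt_id t).pow 2).const_mul 4).const_add 1).congr_deriv (by simp; ring)
  have dA : deriv par1Inv.A t = (1 * (1 + 4 * t ^ 2) - t * (8 * t)) / (1 + 4 * t ^ 2) ^ 2 :=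
    ((hasDerivAt_id t).div hden hpos).deriv
  have dH : deriv par1Inv.H t = -(-4 * Real.cos (Real.arctan (2 * t)) * (t / (1 + 4 * t ^ 2))
      / Real.cos (Real.arctan (2 * t)) / 2) :=
    (((hasDerivAt_cos_arctan_two_mul t).log (cos_arctan_ne _)).div_const 2).neg.deriv
  have dB : deriv par1Inv.B t = 0 := (hasDerivAt_const t (0 : ℝ)).deriv
  have h4 : par1Inv.a t ^ 4 = (1 / (1 + 4 * t ^ 2)) ^ 2 := by rw [← par1Inv_a_sq]; ring
  unfold Par.Q
  rw [dA, dB, dH, h4]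
  have h0 := cos_arctan_ne (2 * t)
  simp only [par1Inv]
  field_simp
  ring

theorem par2_good (t : ℝ) : par2.Good t := by
  refine ⟨by unfold par2; fun_prop, by unfold par2; fun_prop, by unfold par2; fun_prop,
    by unfold par2; fun_prop, by unfold par2; fun_prop, by unfold par2; fun_prop,
    (Real.exp_pos _).ne', ?_, ?_, ?_⟩
  · refine ((hasDerivAt_four_mul t).exp.div_const 4).congr_deriv ?_
    simp only [par2, ← Real.exp_nat_mul]
    rw [mul_div_assoc, div_self four_ne_zero, mul_one]
    congr 1
    push_cast; ring
  · refine (hasDerivAt_two_mul t).exp.congr_deriv ?_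
    simp only [par2]; ring
  · refine (hasDerivAt_const t (0 : ℝ)).congr_deriv ?_
    simp [par2]

theorem par2_Q (t x : ℝ) : par2.Q t x = x ^ 2 := by
  have dA : deriv par2.A t = 0 := (hasDerivAt_const t _).deriv
  have dH : deriv par2.H t = -1 := (hasDerivAt_id t).neg.deriv
  have dB : deriv par2.B t = 0 := (hasDerivAt_const t (0 : ℝ)).deriv
  unfold Par.Q
  rw [dA, dB, dH]
  simp only [par2]
  ring

theorem hasDerivAt_log_four_mul {t : ℝ} (ht : 0 < t) :
    HasDerivAt (fun t => Real.log (4 * t)) (1 / t) t := by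
  refine ((hasDerivAt_four_mul t).log (by positivity)).congr_deriv ?_
  field_simp

theorem par2Inv_a_sq {t : ℝ} (ht : 0 < t) : par2Inv.a t ^ 2 = 1 / (4 * t) := by
  simp only [par2Inv, ← Real.exp_nat_mul]
  rw [show ((2 : ℕ) : ℝ) * -(Real.log (4 * t) / 2) = -Real.log (4 * t) by push_cast; ring,
    Real.exp_neg, Real.exp_log (by positivity), one_div]

theorem par2Inv_good {t : ℝ} (ht : 0 < t) : par2Inv.Good t := by
  have s4 : ContDiffAt ℝ ∞ (fun t : ℝ => 4 * t) t := by fun_prop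
  have sl : ContDiffAt ℝ ∞ (fun t => Real.log (4 * t)) t := s4.log (by positivity)
  refine ⟨sl.div_const 4, (sl.div_const 2).neg.exp, contDiffAt_const,
    contDiffAt_const.div (by fun_prop) (by positivity), contDiffAt_const, sl.div_const 4,
    (Real.exp_pos _).ne', ?_, ?_, ?_⟩
  · refine ((hasDerivAt_log_four_mul ht).div_const 4).congr_deriv ?_
    rw [par2Inv_a_sq ht]; field_simp
  · refine ((hasDerivAt_log_four_mul ht).div_const 2).neg.exp.congr_deriv ?_
    simp only [par2Inv, Pi.neg_apply]; field_simp; ring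
  · refine (hasDerivAt_const t (0 : ℝ)).congr_deriv ?_
    simp [par2Inv]

theorem par2Inv_Q {t : ℝ} (ht : 0 < t) (x : ℝ) :
    par2Inv.Q t x = -par2Inv.a t ^ 4 * x ^ 2 := by
  have h8 : HasDerivAt (fun t : ℝ => 8 * t) 8 t :=
    ((hasDerivAt_id t).const_mul 8).congr_deriv (by simp)
  have dA : deriv par2Inv.A t = (0 * (8 * t) - 1 * 8) / (8 * t) ^ 2 :=
    ((hasDerivAt_const t (1 : ℝ)).div h8 (by positivity)).deriv
  have dH : deriv par2Inv.H t = 1 / t / 4 := ((hasDerivAt_log_four_mul ht).div_const 4).deriv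
  have dB : deriv par2Inv.B t = 0 := (hasDerivAt_const t (0 : ℝ)).deriv
  have h4 : par2Inv.a t ^ 4 = (1 / (4 * t)) ^ 2 := by rw [← par2Inv_a_sq ht]; ring
  unfold Par.Q
  rw [dA, dB, dH, h4]
  simp only [par2Inv]
  field_simp
  ring

theorem par3_good (t : ℝ) : par3.Good t := by
  refine ⟨by unfold par3; fun_prop, by unfold par3; fun_prop, by unfold par3; fun_prop,
    by unfold par3; fun_prop, by unfold par3; fun_prop, by unfold par3; fun_prop,
    one_ne_zero, ?_, ?_, ?_⟩
  · exact (hasDerivAt_id t).congr_deriv (by simp [par3])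
  · exact (hasDerivAt_const t (1 : ℝ)).congr_deriv (by simp [par3])
  · exact ((hasDerivAt_id t).pow 2).congr_deriv (by simp [par3])

theorem par3_Q (t x : ℝ) : par3.Q t x = -x := by
  have dA : deriv par3.A t = 0 := (hasDerivAt_const t (0 : ℝ)).deriv
  have dB : deriv par3.B t = -1 := (hasDerivAt_id t).neg.deriv
  have dH : deriv par3.H t = -t ^ 2 :=
    (((hasDerivAt_id t).pow 3).div_const 3).neg.deriv.trans (by simp)
  unfold Par.Q
  rw [dA, dB, dH]
  simp only [par3]
  ring

theorem par3Inv_good (t : ℝ) : par3Inv.Good t := by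
  refine ⟨by unfold par3Inv; fun_prop, by unfold par3Inv; fun_prop, by unfold par3Inv; fun_prop,
    by unfold par3Inv; fun_prop, by unfold par3Inv; fun_prop, by unfold par3Inv; fun_prop,
    one_ne_zero, ?_, ?_, ?_⟩
  · exact (hasDerivAt_id t).congr_deriv (by simp [par3Inv])
  · exact (hasDerivAt_const t (1 : ℝ)).congr_deriv (by simp [par3Inv])
  · exact ((hasDerivAt_id t).pow 2).neg.congr_deriv (by simp [par3Inv])

theorem par3Inv_Q (t x : ℝ) : par3Inv.Q t x = x - t ^ 2 := by
  have dA : deriv par3Inv.A t = 0 := (hasDerivAt_const t (0 : ℝ)).deriv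
  have dB : deriv par3Inv.B t = 1 := (hasDerivAt_id t).deriv
  have dH : deriv par3Inv.H t = -(2 * (3 * t ^ 2) / 3) :=
    ((((hasDerivAt_id t).pow 3).const_mul 2).div_const 3).neg.deriv.trans (by simp)
  unfold Par.Q
  rw [dA, dB, dH]
  simp only [par3Inv]
  ring

/-! ### The triples of the three families, their inverses, and their local generation -/

theorem isOpen_quad_dom (μ : ℝ) : IsOpen {x : ℝ | μ = 0 ∨ x ≠ 0} := (quadPotential μ 0).isOpen_dom

theorem mul_mem_quad_dom {μ a x : ℝ} (ha : a ≠ 0) (hx : μ = 0 ∨ x ≠ 0) : μ = 0 ∨ a * x ≠ 0 :=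
  hx.imp_right fun h => mul_ne_zero ha h

theorem T1_isGivenBy (μ : ℝ) :
    IsGivenBy (T1 μ) par1 {w | Real.cos (2 * w.1) ≠ 0 ∧ (μ = 0 ∨ w.2 ≠ 0)} where
  isOpen := by
    refine IsOpen.inter ?_ ((isOpen_quad_dom μ).preimage continuous_snd)
    exact isOpen_ne_fun (by fun_prop) continuous_const
  nonempty := ⟨(0, 1), by simp⟩
  dom := rfl
  src := fun x => ⟨fun hx => ⟨0, by simp, hx⟩, fun ⟨t, ht⟩ => ht.2⟩
  tgt := fun y => by
    constructor
    · intro hy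
      exact ⟨0, y, ⟨by simp, hy⟩, by simp [Par.X, par1]⟩
    · rintro ⟨t, x, ⟨ht, hx⟩, rfl⟩
      simp only [Par.X, par1, add_zero]
      exact mul_mem_quad_dom (inv_ne_zero ht) hx
  map := fun z hz => by
    simp only [T1, Par.map, Par.mapAff, Par.X, Par.P, par1]
    refine Prod.ext rfl (Prod.ext ?_ ?_)
    · simp only [add_zero]; rw [div_eq_inv_mul]
    -- The real logarithm sees only `|cos 2t|`, so the single formula for `par1.H` serves both signs
    -- of the cosine.
    · have hs : Real.sqrt |Real.cos (2 * z.1)| = Real.exp (Real.log (Real.cos (2 * z.1)) / 2) := by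
        rw [Real.sqrt_eq_rpow, Real.rpow_def_of_pos (abs_pos.2 hz.1), Real.log_abs]
        congr 1; ring
      simp only [add_zero, one_mul, zero_mul]
      rw [hs, ← Real.exp_add]
      congr 2; ring
  good := fun t x h => par1_good h.1
  rel := fun t x h => by
    rw [par1_Q h.1]
    change (Real.cos (2 * t))⁻¹ ^ 2 * (μ / ((Real.cos (2 * t))⁻¹ * x + 0) ^ 2
      + 0 * ((Real.cos (2 * t))⁻¹ * x + 0) ^ 2) = μ / x ^ 2 + 1 * x ^ 2 + -x ^ 2
    rw [add_zero, quad_scale (inv_ne_zero h.1) h.2]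
    ring

/-- The inverse of `T1 μ`. -/
def T1Inv (μ : ℝ) : Triple where
  src := quadPotential μ 0
  dom := {z | μ = 0 ∨ z.2.1 ≠ 0}
  map := par1Inv.map
  tgt := quadPotential μ 1

theorem T1Inv_isGivenBy (μ : ℝ) : IsGivenBy (T1Inv μ) par1Inv {w | μ = 0 ∨ w.2 ≠ 0} where
  isOpen := (isOpen_quad_dom μ).preimage continuous_snd
  nonempty := ⟨(0, 1), by simp⟩
  dom := rfl
  src := fun x => ⟨fun hx => ⟨0, hx⟩, fun ⟨t, ht⟩ => ht⟩
  tgt := fun y => by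
    constructor
    · intro hy
      exact ⟨0, y, hy, by simp [Par.X, par1Inv]⟩
    · rintro ⟨t, x, hx, rfl⟩
      simp only [Par.X, par1Inv, add_zero]
      exact mul_mem_quad_dom (cos_arctan_ne _) hx
  map := fun z _ => rfl
  good := fun t _ _ => par1Inv_good t
  rel := fun t x h => by
    rw [par1Inv_Q]
    change par1Inv.a t ^ 2 * (μ / (par1Inv.a t * x + 0) ^ 2
      + 1 * (par1Inv.a t * x + 0) ^ 2) = μ / x ^ 2 + 0 * x ^ 2 + _
    rw [add_zero, quad_scale (x := x) (par1Inv_good t).a_ne h]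
    ring

theorem T2_isGivenBy (μ : ℝ) : IsGivenBy (T2 μ) par2 {w | μ = 0 ∨ w.2 ≠ 0} where
  isOpen := (isOpen_quad_dom μ).preimage continuous_snd
  nonempty := ⟨(0, 1), by simp⟩
  dom := rfl
  src := fun x => ⟨fun hx => ⟨0, hx⟩, fun ⟨t, ht⟩ => ht⟩
  tgt := fun y => by
    constructor
    · intro hy
      exact ⟨0, y, hy, by simp [Par.X, par2]⟩
    · rintro ⟨t, x, hx, rfl⟩
      simp only [Par.X, par2, add_zero]
      exact mul_mem_quad_dom (Real.exp_pos _).ne' hx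
  map := fun z _ => by
    simp only [T2, Par.map, Par.mapAff, Par.X, Par.P, par2]
    refine Prod.ext rfl (Prod.ext (by simp) ?_)
    simp only [add_zero, one_mul, zero_mul]
    congr 2; ring
  good := fun t _ _ => par2_good t
  rel := fun t x h => by
    rw [par2_Q]
    change par2.a t ^ 2 * (μ / (par2.a t * x + 0) ^ 2
      + 0 * (par2.a t * x + 0) ^ 2) = μ / x ^ 2 + -1 * x ^ 2 + _
    rw [add_zero, quad_scale (x := x) (par2_good t).a_ne h]
    ring

/-- The inverse of `T2 μ`. -/
def T2Inv (μ : ℝ) : Triple where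
  src := quadPotential μ 0
  dom := {z | 0 < z.1 ∧ (μ = 0 ∨ z.2.1 ≠ 0)}
  map := par2Inv.map
  tgt := quadPotential μ (-1)

theorem T2Inv_isGivenBy (μ : ℝ) :
    IsGivenBy (T2Inv μ) par2Inv {w | 0 < w.1 ∧ (μ = 0 ∨ w.2 ≠ 0)} where
  isOpen := (isOpen_Ioi.preimage continuous_fst).inter
    ((isOpen_quad_dom μ).preimage continuous_snd)
  nonempty := ⟨(1, 1), by simp⟩
  dom := rfl
  src := fun x => ⟨fun hx => ⟨1, one_pos, hx⟩, fun ⟨t, ht⟩ => ht.2⟩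
  tgt := fun y => by
    constructor
    · intro hy
      exact ⟨1 / 4, y, ⟨by norm_num, hy⟩, by simp [Par.X, par2Inv]⟩
    · rintro ⟨t, x, ⟨-, hx⟩, rfl⟩
      simp only [Par.X, par2Inv, add_zero]
      exact mul_mem_quad_dom (Real.exp_pos _).ne' hx
  map := fun z _ => rfl
  good := fun t _ h => par2Inv_good h.1
  rel := fun t x h => by
    rw [par2Inv_Q h.1]
    change par2Inv.a t ^ 2 * (μ / (par2Inv.a t * x + 0) ^ 2
      + -1 * (par2Inv.a t * x + 0) ^ 2) = μ / x ^ 2 + 0 * x ^ 2 + _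
    rw [add_zero, quad_scale (x := x) (par2Inv_good h.1).a_ne h.2]
    ring

theorem T3_isGivenBy : IsGivenBy T3 par3 univ where
  isOpen := isOpen_univ
  nonempty := univ_nonempty
  dom := by simp [T3]
  src := fun x => by simp [T3, linPotential]
  tgt := fun y => by
    constructor
    · intro _
      exact ⟨0, y, trivial, by simp [Par.X, par3]⟩
    · intro _; trivial
  map := fun z _ => by
    simp only [T3, Par.map, Par.mapAff, Par.X, Par.P, par3]
    refine Prod.ext rfl (Prod.ext (by simp) ?_)
    simp only [add_zero, one_mul, zero_mul, zero_add]
    congr 2; ring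
  good := fun t _ _ => par3_good t
  rel := fun t x _ => by
    rw [par3_Q]
    simp [T3, linPotential]

/-- The inverse of `T3`. -/
def T3Inv : Triple where
  src := linPotential 0
  dom := univ
  map := par3Inv.map
  tgt := linPotential 1

theorem T3Inv_isGivenBy : IsGivenBy T3Inv par3Inv univ where
  isOpen := isOpen_univ
  nonempty := univ_nonempty
  dom := by simp [T3Inv]
  src := fun x => by simp [T3Inv, linPotential]
  tgt := fun y => by
    constructor
    · intro _
      exact ⟨0, y, trivial, by simp [Par.X, par3Inv]⟩
    · intro _; trivial
  map := fun z _ => rfl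
  good := fun t _ _ => par3Inv_good t
  rel := fun t x _ => by
    rw [par3Inv_Q]
    simp only [T3Inv, linPotential, Par.X, par3Inv]
    ring

theorem par1Inv_comp_par1 (t : ℝ) : (par1Inv.comp par1).IsId t := by
  have h2 : ∀ s : ℝ, 2 * (s / 2) = s := fun s => by ring
  have h0 := cos_arctan_ne (2 * t)
  refine ⟨?_, ?_, ?_, ?_, ?_, ?_⟩
  · simp only [Par.comp, par1, par1Inv, h2, Real.tan_arctan]; ring
  · simp only [Par.comp, par1, par1Inv, h2]; exact inv_mul_cancel₀ h0
  · simp [Par.comp, par1, par1Inv]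
  · simp only [Par.comp, par1Inv_a_sq]
    simp only [par1, par1Inv, h2, Real.tan_arctan]
    field_simp; ring
  · simp [Par.comp, par1, par1Inv]
  · simp only [Par.comp, par1, par1Inv, h2]; ring

theorem par2Inv_comp_par2 {t : ℝ} (ht : 0 < t) : (par2Inv.comp par2).IsId t := by
  have h4 : ∀ s : ℝ, 4 * (s / 4) = s := fun s => by ring
  refine ⟨?_, ?_, ?_, ?_, ?_, ?_⟩
  · simp only [Par.comp, par2, par2Inv, h4, Real.exp_log (show 0 < 4 * t by positivity)]; ring
  · simp only [Par.comp, par2, par2Inv, ← Real.exp_add]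
    rw [Real.exp_eq_one_iff]; ring
  · simp [Par.comp, par2, par2Inv]
  · simp only [Par.comp, par2Inv_a_sq ht]
    simp only [par2, par2Inv]
    field_simp; ring
  · simp [Par.comp, par2, par2Inv]
  · simp only [Par.comp, par2, par2Inv]; ring

theorem par3Inv_comp_par3 (t : ℝ) : (par3Inv.comp par3).IsId t := by
  refine ⟨?_, ?_, ?_, ?_, ?_, ?_⟩ <;> simp only [Par.comp, par3, par3Inv] <;> ring

theorem T1_isInverse (μ : ℝ) : IsInverse (T1 μ) (T1Inv μ) :=
  (T1_isGivenBy μ).isInverse (T1Inv_isGivenBy μ) rfl rfl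
    (fun t x h => by
      refine ⟨?_, ?_⟩
      · simp only [Par.pt, par1Inv]
        rw [show 2 * (Real.arctan (2 * t) / 2) = Real.arctan (2 * t) by ring]
        exact cos_arctan_ne _
      · simp only [Par.pt, Par.X, par1Inv, add_zero]
        exact mul_mem_quad_dom (cos_arctan_ne _) h)
    fun t _ _ => par1Inv_comp_par1 t

theorem T2_isInverse (μ : ℝ) : IsInverse (T2 μ) (T2Inv μ) :=
  (T2_isGivenBy μ).isInverse (T2Inv_isGivenBy μ) rfl rfl
    (fun t x h => by
      simp only [Par.pt, Par.X, par2Inv, add_zero]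
      exact mul_mem_quad_dom (Real.exp_pos _).ne' h.2)
    fun t _ h => par2Inv_comp_par2 h.1

theorem T3_isInverse : IsInverse T3 T3Inv :=
  T3_isGivenBy.isInverse T3Inv_isGivenBy rfl rfl (fun _ _ _ => trivial)
    fun t _ _ => par3Inv_comp_par3 t

theorem T1_mem (μ : ℝ) : T1 μ ∈ generatingSet := Or.inl (Or.inl ⟨μ, rfl⟩)
theorem T2_mem (μ : ℝ) : T2 μ ∈ generatingSet := Or.inl (Or.inr ⟨μ, rfl⟩)
theorem T3_mem : T3 ∈ generatingSet := Or.inr rfl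

theorem mem_generators {T : Triple} (h : T ∈ generatingSet) : T ∈ generators := Or.inl (Or.inl h)

theorem inv_mem_generators {T T' : Triple} (h : T ∈ generatingSet) (h' : IsInverse T T') :
    T' ∈ generators := Or.inl (Or.inr ⟨T, h, h'⟩)

theorem generatingSet_subset : generatingSet ⊆ equivGroupoid := by
  rintro T ((⟨μ, rfl⟩ | ⟨μ, rfl⟩) | rfl)
  · exact (T1_isGivenBy μ).isAdmissible
  · exact (T2_isGivenBy μ).isAdmissible
  · exact T3_isGivenBy.isAdmissible

/-- The function `μ / x² + b x²`. -/
def V (μ b : ℝ) (x : ℝ) : ℝ := μ / x ^ 2 + b * x ^ 2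

theorem smoothNear_V {μ b x : ℝ} (hx : μ = 0 ∨ x ≠ 0) : SmoothNear (V μ b) x :=
  (quadPotential μ b).smoothNear hx

section

variable {μ : ℝ} {q : ℝ × ℝ}

theorem genRel_par1 (hc : Real.cos (2 * q.1) ≠ 0) (hx : μ = 0 ∨ q.2 ≠ 0) :
    GenRel par1 (V μ 1) (V μ 0) q :=
  (T1_isGivenBy μ).genRel (mem_generators (T1_mem μ)) ⟨hc, hx⟩

theorem genRel_par1Inv (hx : μ = 0 ∨ q.2 ≠ 0) : GenRel par1Inv (V μ 0) (V μ 1) q :=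
  (T1Inv_isGivenBy μ).genRel (inv_mem_generators (T1_mem μ) (T1_isInverse μ)) hx

theorem genRel_par2 (hx : μ = 0 ∨ q.2 ≠ 0) : GenRel par2 (V μ (-1)) (V μ 0) q :=
  (T2_isGivenBy μ).genRel (mem_generators (T2_mem μ)) hx

theorem genRel_par2Inv (ht : 0 < q.1) (hx : μ = 0 ∨ q.2 ≠ 0) :
    GenRel par2Inv (V μ 0) (V μ (-1)) q :=
  (T2Inv_isGivenBy μ).genRel (inv_mem_generators (T2_mem μ) (T2_isInverse μ)) ⟨ht, hx⟩

theorem genRel_par3 : GenRel par3 (fun x => 1 * x) (V 0 0) q :=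
  (T3_isGivenBy.genRel (mem_generators T3_mem) (mem_univ q)).congr_pot
    (Eventually.of_forall fun _ => rfl)
    (Eventually.of_forall fun x => by simp [T3, linPotential, V])

theorem genRel_par3Inv : GenRel par3Inv (V 0 0) (fun x => 1 * x) q :=
  (T3Inv_isGivenBy.genRel (inv_mem_generators T3_mem T3_isInverse) (mem_univ q)).congr_pot
    (Eventually.of_forall fun x => by simp [T3Inv, linPotential, V])
    (Eventually.of_forall fun _ => rfl)

end

/-! ### Polynomial identities on open sets -/

theorem poly_eq_zero {P : Polynomial ℝ} {x₀ : ℝ} (h : ∀ᶠ x in 𝓝 x₀, P.eval x = 0) : P = 0 :=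
  P.eq_zero_of_infinite_isRoot (infinite_of_mem_nhds x₀ h)

theorem poly_coeffs {c₀ c₁ c₂ c₃ c₄ c₅ c₆ x₀ : ℝ}
    (h : ∀ᶠ x in 𝓝 x₀, c₀ + c₁ * x + c₂ * x ^ 2 + c₃ * x ^ 3 + c₄ * x ^ 4 + c₅ * x ^ 5
      + c₆ * x ^ 6 = 0) :
    c₀ = 0 ∧ c₁ = 0 ∧ c₂ = 0 ∧ c₃ = 0 ∧ c₄ = 0 ∧ c₅ = 0 ∧ c₆ = 0 := by
  open Polynomial in
  have hP : (C c₀ + C c₁ * X + C c₂ * X ^ 2 + C c₃ * X ^ 3 + C c₄ * X ^ 4 + C c₅ * X ^ 5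
      + C c₆ * X ^ 6 : Polynomial ℝ) = 0 :=
    poly_eq_zero (x₀ := x₀) (h.mono fun x hx => by simpa using hx)
  have hc := fun n : ℕ => congrArg (fun P : Polynomial ℝ => P.coeff n) hP
  refine ⟨?_, ?_, ?_, ?_, ?_, ?_, ?_⟩
  · simpa [Polynomial.coeff_X, Polynomial.coeff_C, Polynomial.coeff_X_pow] using hc 0
  · simpa [Polynomial.coeff_X, Polynomial.coeff_C, Polynomial.coeff_X_pow] using hc 1
  · simpa [Polynomial.coeff_X, Polynomial.coeff_C, Polynomial.coeff_X_pow] using hc 2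
  · simpa [Polynomial.coeff_X, Polynomial.coeff_C, Polynomial.coeff_X_pow] using hc 3
  · simpa [Polynomial.coeff_X, Polynomial.coeff_C, Polynomial.coeff_X_pow] using hc 4
  · simpa [Polynomial.coeff_X, Polynomial.coeff_C, Polynomial.coeff_X_pow] using hc 5
  · simpa [Polynomial.coeff_X, Polynomial.coeff_C, Polynomial.coeff_X_pow] using hc 6

theorem quadratic_coeffs {c₀ c₁ c₂ x₀ : ℝ}
    (h : ∀ᶠ x in 𝓝 x₀, c₂ * x ^ 2 + c₁ * x + c₀ = 0) : c₀ = 0 ∧ c₁ = 0 ∧ c₂ = 0 := by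
  obtain ⟨h0, h1, h2, -⟩ := poly_coeffs (c₀ := c₀) (c₁ := c₁) (c₂ := c₂) (c₃ := 0) (c₄ := 0)
    (c₅ := 0) (c₆ := 0) (h.mono fun x hx => by linear_combination hx)
  exact ⟨h0, h1, h2⟩

theorem eventually_curry {P : ℝ × ℝ → Prop} {q : ℝ × ℝ} (h : ∀ᶠ w in 𝓝 q, P w) :
    ∀ᶠ t in 𝓝 q.1, ∀ᶠ x in 𝓝 q.2, P (t, x) :=
  Filter.Eventually.curry_nhds (x := q.1) (y := q.2) h

/-! ### Transformations of `μ / x²` to itself -/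

/-- The coefficients of `Q`. -/
def Par.q2 (p : Par) (t : ℝ) : ℝ := deriv p.A t + 4 * p.A t ^ 2
def Par.q1 (p : Par) (t : ℝ) : ℝ := deriv p.B t + 4 * p.A t * p.B t
def Par.q0 (p : Par) (t : ℝ) : ℝ := deriv p.H t + p.B t ^ 2 - 2 * p.A t

theorem Par.Q_eq (p : Par) (t x : ℝ) : p.Q t x = p.q2 t * x ^ 2 + p.q1 t * x + p.q0 t := rfl

/-- The projective transformations of time. -/
def parRot (β : ℝ) : Par := (par1Inv.comp (affPar 1 β 0 0 0)).comp par1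

/-- The Galilean boosts. -/
def parBoost (β : ℝ) : Par := (par3Inv.comp (affPar 1 β 0 0 0)).comp par3

section Symmetry

variable {μ : ℝ} {q : ℝ × ℝ}

theorem cos_arctan_add (t β : ℝ) : Real.cos (Real.arctan (2 * t) + 2 * β)
    = Real.cos (Real.arctan (2 * t)) * (Real.cos (2 * β) - 2 * t * Real.sin (2 * β)) := by
  have h := Real.tan_arctan (2 * t)
  rw [Real.tan_eq_sin_div_cos, div_eq_iff (cos_arctan_ne _)] at h
  rw [Real.cos_add, h]; ring

/-- Conjugating a time shift by the tangent substitution gives a rotation in the projective group of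
time, and this is its denominator. Up to a constant factor, every nonzero affine function of `t` is
such a denominator. -/
theorem parRot_a (β t : ℝ) :
    (parRot β).a t = (Real.cos (2 * β) - 2 * t * Real.sin (2 * β))⁻¹ := by
  simp only [parRot, Par.comp, par1, par1Inv, affPar]
  rw [show 2 * (1 ^ 2 * (Real.arctan (2 * t) / 2) + β) = Real.arctan (2 * t) + 2 * β by ring,
    cos_arctan_add, mul_inv]
  have := cos_arctan_ne (2 * t)
  field_simp

theorem parRot_c (β t : ℝ) : (parRot β).c t = 0 := by
  simp [parRot, Par.comp, par1, par1Inv, affPar]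

/-- The potential `μ/x² + x²` is stationary, so it admits the time shift by `β`; transporting the
shift with `T1 μ` and its inverse gives the transformation. The condition on `β` says that the
shifted time avoids the zeros of the cosine. -/
theorem genRel_parRot {β : ℝ} (hβ : Real.cos (2 * β) - 2 * q.1 * Real.sin (2 * β) ≠ 0)
    (hx : μ = 0 ∨ q.2 ≠ 0) : GenRel (parRot β) (V μ 0) (V μ 0) q := by
  have h1 : GenRel par1Inv (V μ 0) (V μ 1) q := genRel_par1Inv hx
  have hx1 : μ = 0 ∨ (par1Inv.pt q).2 ≠ 0 := by
    simp only [Par.pt, Par.X, par1Inv, add_zero]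
    exact mul_mem_quad_dom (cos_arctan_ne _) hx
  have h2 : GenRel (affPar 1 β 0 0 0) (V μ 1) (V μ 1) (par1Inv.pt q) :=
    genRel_affine one_ne_zero (smoothNear_V hx1) (smoothNear_V (by simpa using hx1))
      (Eventually.of_forall fun x => by simp)
  refine (h1.comp h2).comp (genRel_par1 ?_ ?_)
  · simp only [Par.pt, Par.comp, affPar, par1Inv]
    rw [show 2 * (1 ^ 2 * (Real.arctan (2 * q.1) / 2) + β)
      = Real.arctan (2 * q.1) + 2 * β by ring, cos_arctan_add]
    exact mul_ne_zero (cos_arctan_ne _) hβ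
  · simp only [Par.pt, Par.comp_X]
    simpa [affPar, Par.X, Par.pt] using hx1

theorem parBoost_a (β t : ℝ) : (parBoost β).a t = 1 := by
  simp [parBoost, Par.comp, par3, par3Inv, affPar]

theorem parBoost_c (β t : ℝ) : (parBoost β).c t = 2 * β * t + β ^ 2 := by
  simp only [parBoost, Par.comp, par3, par3Inv, affPar]; ring

/-- Time shifts of the equation with potential `x`, conjugated by `T3`, act on the free heat
equation with `c` linear in `t`. -/
theorem genRel_parBoost (β : ℝ) : GenRel (parBoost β) (V 0 0) (V 0 0) q := by
  have hs : ∀ x, SmoothNear (fun x : ℝ => 1 * x) x := fun x =>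
    Eventually.of_forall fun y => by fun_prop
  have h2 : GenRel (affPar 1 β 0 0 0) (fun x => 1 * x) (fun x => 1 * x) (par3Inv.pt q) :=
    genRel_affine one_ne_zero (hs _) (hs _) (Eventually.of_forall fun x => by simp)
  exact ((genRel_par3Inv (q := q)).comp h2).comp genRel_par3

theorem exists_polar (m n : ℝ) : ∃ ρ β, n = ρ * Real.cos (2 * β) ∧ m = ρ * Real.sin (2 * β) := by
  refine ⟨‖(⟨n, m⟩ : ℂ)‖, Complex.arg ⟨n, m⟩ / 2, ?_, ?_⟩
  · rw [mul_div_cancel₀ _ two_ne_zero]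
    exact (Complex.norm_mul_cos_arg ⟨n, m⟩).symm
  · rw [mul_div_cancel₀ _ two_ne_zero]
    exact (Complex.norm_mul_sin_arg ⟨n, m⟩).symm

/-- The equations for the parameters of a transformation of `μ / x²` to itself. -/
theorem Rel.symmetry_eqs {s : Par} (h : Rel s (V μ 0) (V μ 0) q) (hx : μ = 0 ∨ q.2 ≠ 0)
    (hx' : μ = 0 ∨ s.X q.1 q.2 ≠ 0) :
    ∀ᶠ t in 𝓝 q.1, s.q2 t = 0 ∧ s.q1 t = 0 ∧ (μ ≠ 0 → s.c t = 0) := by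
  by_cases hμ : μ = 0
  · filter_upwards [eventually_curry h.rel] with t ht
    have := quadratic_coeffs (c₂ := s.q2 t) (c₁ := s.q1 t) (c₀ := s.q0 t)
      (ht.mono fun x hx => by
        rw [Par.Q_eq] at hx
        simp only [V, hμ] at hx
        linear_combination -hx)
    exact ⟨this.2.2, this.2.1, fun h => absurd hμ h⟩
  · have e1 : ∀ᶠ w : ℝ × ℝ in 𝓝 q, w.2 ≠ 0 :=
      eventually_snd (isOpen_ne.mem_nhds (hx.resolve_left hμ))
    have e2 : ∀ᶠ w : ℝ × ℝ in 𝓝 q, s.X w.1 w.2 ≠ 0 :=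
      h.eventually_tgt (isOpen_ne.mem_nhds (hx'.resolve_left hμ))
    filter_upwards [eventually_curry ((h.rel.and e1).and e2), h.good] with t ht hg
    have hane := hg.a_ne
    -- After the denominators are cleared, both sides are polynomials of degree at most six. The
    -- constant coefficient `c² μ` forces `c = 0`; then the coefficients of `x⁵` and `x⁶` give the
    -- rest.
    have key : ∀ᶠ x in 𝓝 q.2, μ * s.a t ^ 2 * x ^ 2
        = (s.a t * x + s.c t) ^ 2 * (μ + s.q2 t * x ^ 4 + s.q1 t * x ^ 3 + s.q0 t * x ^ 2) := by
      filter_upwards [ht] with x hx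
      obtain ⟨⟨h1, h2⟩, h3⟩ := hx
      rw [Par.Q_eq] at h1
      simp only [V, Par.X] at h1 h2 h3
      field_simp at h1
      linear_combination h1
    have hc : s.c t = 0 := by
      have := poly_coeffs (c₀ := s.c t ^ 2 * μ) (c₁ := 2 * s.a t * s.c t * μ)
        (c₂ := s.a t ^ 2 * μ + s.c t ^ 2 * s.q0 t - μ * s.a t ^ 2)
        (c₃ := 2 * s.a t * s.c t * s.q0 t + s.c t ^ 2 * s.q1 t)
        (c₄ := s.a t ^ 2 * s.q0 t + 2 * s.a t * s.c t * s.q1 t + s.c t ^ 2 * s.q2 t)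
        (c₅ := s.a t ^ 2 * s.q1 t + 2 * s.a t * s.c t * s.q2 t)
        (c₆ := s.a t ^ 2 * s.q2 t) (key.mono fun x hx => by linear_combination -hx)
      simpa [hμ] using this.1
    have h2 := poly_coeffs (c₀ := 0) (c₁ := 0) (c₂ := 0) (c₃ := 0) (c₄ := s.a t ^ 2 * s.q0 t)
      (c₅ := s.a t ^ 2 * s.q1 t) (c₆ := s.a t ^ 2 * s.q2 t) (key.mono fun x hx => by
        rw [hc] at hx; linear_combination -hx)
    obtain ⟨-, -, -, -, -, h5, h6⟩ := h2
    have ha2 : s.a t ^ 2 ≠ 0 := pow_ne_zero 2 hane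
    exact ⟨(mul_eq_zero.1 h6).resolve_left ha2, (mul_eq_zero.1 h5).resolve_left ha2, fun _ => hc⟩

theorem exists_const_of_hasDerivAt_zero {g : ℝ → ℝ} {x₀ : ℝ} (h : ∀ᶠ y in 𝓝 x₀, HasDerivAt g 0 y) :
    ∃ k, ∀ᶠ y in 𝓝 x₀, g y = k := ⟨g x₀, const_of_eventually_hasDerivAt_zero h⟩

/-- Every transformation of `μ / x²` to itself is generated. -/
theorem Rel.genRel_symmetry {s : Par} (h : Rel s (V μ 0) (V μ 0) q) (hx : μ = 0 ∨ q.2 ≠ 0)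
    (hx' : μ = 0 ∨ s.X q.1 q.2 ≠ 0) : GenRel s (V μ 0) (V μ 0) q := by
  have heq := h.symmetry_eqs hx hx'
  -- The derivative of `A/a` is `(A' + 4A²)/a`, which vanishes.
  obtain ⟨m, hm⟩ : ∃ m, ∀ᶠ t in 𝓝 q.1, s.A t / s.a t = m := by
    refine exists_const_of_hasDerivAt_zero ?_
    filter_upwards [heq, h.good] with t ht hg
    refine (hg.dA.div hg.da hg.a_ne).congr_deriv ?_
    have h2 := ht.1
    unfold Par.q2 at h2
    rw [div_eq_zero_iff]; left
    linear_combination s.a t * h2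
  -- The derivative of `1/a` is `4A/a = 4m`, so `1/a` is affine in `t`.
  obtain ⟨n, hn⟩ : ∃ n, ∀ᶠ t in 𝓝 q.1, (s.a t)⁻¹ - 4 * m * t = n := by
    refine exists_const_of_hasDerivAt_zero ?_
    filter_upwards [hm, h.good] with t ht hg
    refine ((hg.da.inv hg.a_ne).sub ((hasDerivAt_id t).const_mul (4 * m))).congr_deriv ?_
    have := hg.a_ne
    rw [← ht]; field_simp; ring
  -- Polar coordinates turn `n + 4mt` into `ρ (cos 2β - 2t sin 2β)`, so up to the scale `ρ⁻¹` the
  -- function `a` is that of a rotation.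
  obtain ⟨ρ, β, e1, e2⟩ := exists_polar (-(2 * m)) n
  have hinv : ∀ᶠ t in 𝓝 q.1,
      (s.a t)⁻¹ = ρ * (Real.cos (2 * β) - 2 * t * Real.sin (2 * β)) := by
    filter_upwards [hn] with t ht
    linear_combination ht + e1 - 2 * t * e2
  have h0 : (s.a q.1)⁻¹ ≠ 0 := inv_ne_zero h.good.self_of_nhds.a_ne
  rw [hinv.self_of_nhds, mul_ne_zero_iff] at h0
  have hrot : GenRel (parRot β) (V μ 0) (V μ 0) q := genRel_parRot h0.2 hx
  have ha : ∀ᶠ t in 𝓝 q.1, s.a t = ρ⁻¹ * (parRot β).a t := by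
    filter_upwards [hinv] with t ht
    rw [parRot_a, ← mul_inv, ← ht, inv_inv]
  by_cases hμ : μ = 0
  · subst hμ
    obtain ⟨K, hK⟩ : ∃ K, ∀ᶠ t in 𝓝 q.1, s.B t / s.a t = K := by
      refine exists_const_of_hasDerivAt_zero ?_
      filter_upwards [heq, h.good] with t ht hg
      refine (hg.dB.div hg.da hg.a_ne).congr_deriv ?_
      have h2 := ht.2.1
      unfold Par.q1 at h2
      rw [div_eq_zero_iff]; left
      linear_combination s.a t * h2
    -- With `B = K a` and `a = ρ⁻¹ a_rot`, the equation for `c` reads `c' = -2K a² = -2K ρ⁻²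
    -- τ_rot'`, so `c` is affine in the new time of the rotation.
    obtain ⟨κ, hκ⟩ : ∃ κ, ∀ᶠ t in 𝓝 q.1, s.c t + 2 * K * ρ⁻¹ ^ 2 * (parRot β).τ t = κ := by
      refine exists_const_of_hasDerivAt_zero ?_
      filter_upwards [hK, h.good, hrot.rel.good, ha] with t ht hg hr hat
      refine (hg.dc.add (hr.dτ.const_mul (2 * K * ρ⁻¹ ^ 2))).congr_deriv ?_
      have hB : s.B t = K * s.a t := by rw [← ht, div_mul_cancel₀ _ hg.a_ne]
      rw [hB, hat]; ring
    -- The boost after the rotation, scaled by `ρ⁻¹`, must contribute `-2K ρ⁻² τ_rot`, which fixes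
    -- its parameter as `-K ρ⁻¹`; its constant term `β²`, also scaled by `ρ⁻¹`, is subtracted in
    -- `κ`.
    refine GenRel.of_affine (k := ρ⁻¹) (κ := κ - ρ⁻¹ * (K * ρ⁻¹) ^ 2) h
      (hrot.comp (genRel_parBoost (-(K * ρ⁻¹)))) ?_ ?_
    · filter_upwards [ha] with t ht
      simp only [Par.comp, parBoost_a, one_mul, ht]
    · filter_upwards [hκ] with t ht
      simp only [Par.comp, parBoost_a, parBoost_c, parRot_c]
      linear_combination ht
  · refine GenRel.of_affine (k := ρ⁻¹) (κ := 0) h hrot ha ?_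
    filter_upwards [heq] with t ht
    rw [ht.2.2 hμ, parRot_c]; ring

end Symmetry

/-! ### Reduction of potentials to `μ / x²` -/

/-- `r` and its inverse are generated. -/
structure IsoRel (r r' : Par) (C C₁ : ℝ → ℝ) (q : ℝ × ℝ) : Prop where
  fwd : GenRel r C C₁ q
  bwd : GenRel r' C₁ C (r.pt q)
  inv : ∀ᶠ t in 𝓝 q.1, r'.τ (r.τ t) = t ∧ r'.a (r.τ t) * r.a t = 1 ∧
    r'.a (r.τ t) * r.c t + r'.c (r.τ t) = 0

section Iso

variable {r r' s s' : Par} {C C₁ C₂ : ℝ → ℝ} {q : ℝ × ℝ}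

theorem IsoRel.pt_pt (h : IsoRel r r' C C₁ q) : r'.pt (r.pt q) = q := by
  obtain ⟨h1, h2, h3⟩ := h.inv.self_of_nhds
  refine Prod.ext h1 ?_
  simp only [Par.pt, Par.X]
  linear_combination q.2 * h2 + h3

theorem Par.comp_pt (p r : Par) (q : ℝ × ℝ) : (p.comp r).pt q = r.pt (p.pt q) :=
  Prod.ext rfl (p.comp_X r _ _)

theorem IsoRel.trans (h : IsoRel r r' C C₁ q) (h' : IsoRel s s' C₁ C₂ (r.pt q)) :
    IsoRel (r.comp s) (s'.comp r') C C₂ q := by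
  refine ⟨h.fwd.comp h'.fwd, ?_, ?_⟩
  · rw [Par.comp_pt]
    refine h'.bwd.comp ?_
    rw [h'.pt_pt]
    exact h.bwd
  · have hτ : ContinuousAt r.τ q.1 := h.fwd.rel.good.self_of_nhds.sτ.continuousAt
    filter_upwards [h.inv, hτ.eventually h'.inv] with t h1 h2
    obtain ⟨h1, h3, h5⟩ := h1
    obtain ⟨h2, h4, h6⟩ := h2
    simp only [Par.comp, h2]
    refine ⟨h1, ?_, ?_⟩
    · linear_combination h3 + r'.a (r.τ t) * r.a t * h4
    · linear_combination h5 + r'.a (r.τ t) * r.c t * h4 + r'.a (r.τ t) * h6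

theorem isoRel_affine {k b κ D : ℝ} (hk : k ≠ 0) (hC : SmoothNear C q.2)
    (hC₁ : SmoothNear C₁ (k * q.2 + κ))
    (hrel : ∀ᶠ x in 𝓝 q.2, k ^ 2 * C₁ (k * x + κ) = C x + D) :
    IsoRel (affPar k b κ D 0) (affPar k⁻¹ (-b / k ^ 2) (-κ / k) (-D / k ^ 2) 0) C C₁ q := by
  have e : k⁻¹ * (k * q.2 + κ) + -κ / k = q.2 := by field_simp; ring
  refine ⟨genRel_affine hk hC hC₁ hrel, genRel_affine (inv_ne_zero hk) hC₁ ?_ ?_,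
    Eventually.of_forall fun t => ⟨?_, ?_, ?_⟩⟩
  · simp only [Par.pt, Par.X, affPar, e]; exact hC
  · have ht : Tendsto (fun y => k⁻¹ * y + -κ / k) (𝓝 (k * q.2 + κ)) (𝓝 q.2) := by
      have hcont : Continuous fun y => k⁻¹ * y + -κ / k := by fun_prop
      have := hcont.tendsto (k * q.2 + κ)
      rwa [e] at this
    filter_upwards [ht.eventually hrel] with y hy
    have e' : k * (k⁻¹ * y + -κ / k) + κ = y := by field_simp; ring
    rw [e'] at hy
    field_simp
    field_simp at hy
    linear_combination -hy
  · simp only [affPar]; field_simp; ring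
  · simp only [affPar]; field_simp
  · simp only [affPar]; field_simp; ring

end Iso

section

variable {μ : ℝ} {q : ℝ × ℝ}

/-- The inverse uses the principal branch of the arctangent, which undoes `par1` only for `2t` in
`(-π/2, π/2)`. Hence the base time is placed at 0. -/
theorem isoRel_par1 (ht : q.1 = 0) (hx : μ = 0 ∨ q.2 ≠ 0) :
    IsoRel par1 par1Inv (V μ 1) (V μ 0) q := by
  have hcos : Real.cos (2 * q.1) ≠ 0 := by simp [ht]
  refine ⟨genRel_par1 hcos hx, genRel_par1Inv ?_, ?_⟩
  · simp only [Par.pt, Par.X, par1, add_zero]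
    exact mul_mem_quad_dom (inv_ne_zero hcos) hx
  · rw [ht]
    have hpi := Real.pi_pos
    filter_upwards [Ioo_mem_nhds (show -(Real.pi / 4) < 0 by linarith)
      (show 0 < Real.pi / 4 by linarith)] with t ht
    have e : Real.arctan (2 * (Real.tan (2 * t) / 2)) = 2 * t := by
      rw [mul_div_cancel₀ _ two_ne_zero,
        Real.arctan_tan (by linarith [ht.1]) (by linarith [ht.2])]
    have hc : Real.cos (2 * t) ≠ 0 :=
      (Real.cos_pos_of_mem_Ioo ⟨by linarith [ht.1], by linarith [ht.2]⟩).ne'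
    simp only [par1, par1Inv, e]
    refine ⟨by ring, mul_inv_cancel₀ hc, by ring⟩

theorem isoRel_par2 (hx : μ = 0 ∨ q.2 ≠ 0) : IsoRel par2 par2Inv (V μ (-1)) (V μ 0) q := by
  refine ⟨genRel_par2 hx, genRel_par2Inv (by simp only [Par.pt, par2]; positivity) ?_,
    Eventually.of_forall fun t => ?_⟩
  · simp only [Par.pt, Par.X, par2, add_zero]
    exact mul_mem_quad_dom (Real.exp_pos _).ne' hx
  · have e : Real.log (4 * (Real.exp (4 * t) / 4)) = 4 * t := by
      rw [mul_div_cancel₀ _ four_ne_zero, Real.log_exp]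
    simp only [par2, par2Inv, e]
    refine ⟨by ring, ?_, by ring⟩
    rw [← Real.exp_add, Real.exp_eq_one_iff]
    ring

theorem isoRel_par3 : IsoRel par3 par3Inv (fun x => 1 * x) (V 0 0) q :=
  ⟨genRel_par3, genRel_par3Inv, Eventually.of_forall fun t => by simp [par3, par3Inv]⟩

/-- Near `x`, the potential has the form `μ / (y - k)² + b (y - k)² + D`, or the form
`e y + d` with `e ≠ 0`. -/
def Normalizable (μ : ℝ) (C : ℝ → ℝ) (x : ℝ) : Prop :=
  (∃ k b D, (μ = 0 ∨ x ≠ k) ∧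
    ∀ᶠ y in 𝓝 x, C y = μ / (y - k) ^ 2 + b * (y - k) ^ 2 + D) ∨
  (μ = 0 ∧ ∃ e d, e ≠ 0 ∧ ∀ᶠ y in 𝓝 x, C y = e * y + d)

theorem exists_pow_three (e : ℝ) : ∃ k : ℝ, k ^ 3 = e := by
  have : Function.Surjective fun x : ℝ => x ^ 3 := by
    refine Continuous.surjective (by fun_prop) (tendsto_pow_atTop three_ne_zero) ?_
    have := (tendsto_neg_atTop_atBot).comp
      ((tendsto_pow_atTop (α := ℝ) three_ne_zero).comp tendsto_neg_atBot_atTop)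
    refine this.congr fun x => ?_
    simp only [Function.comp]; ring
  exact this e

/-- A scaling changes the coefficient of `x²` by a positive fourth power, so only its sign is
essential; this is why both families `T1` and `T2` are needed. -/
theorem exists_scale (b : ℝ) : ∃ K β : ℝ, K ≠ 0 ∧ (β = 0 ∨ β = 1 ∨ β = -1) ∧ β * K ^ 4 = b := by
  by_cases hb : b = 0
  · exact ⟨1, 0, one_ne_zero, .inl rfl, by simp [hb]⟩
  have h4 : √(√|b|) ^ 4 = |b| := by
    rw [show √(√|b|) ^ 4 = (√(√|b|) ^ 2) ^ 2 by ring, Real.sq_sqrt (by positivity),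
      Real.sq_sqrt (by positivity)]
  have hne : √(√|b|) ≠ 0 := by
    intro h; rw [h] at h4; simp [eq_comm, hb] at h4
  rcases abs_cases b with h | h
  · exact ⟨_, 1, hne, .inr (.inl rfl), by rw [h4, h.1, one_mul]⟩
  · exact ⟨_, -1, hne, .inr (.inr rfl), by rw [h4, h.1]; ring⟩

/-- An affine change centres the singularity, removes the constant and scales the coefficient of
`x²` to 0, 1 or -1 (or the slope to 1, through a cube root); `T1`, `T2` or `T3` removes what is
left. The time shift by `-K² q.1` brings the base point to `t = 0`, as `isoRel_par1` requires. -/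
theorem Normalizable.exists_isoRel {C : ℝ → ℝ} (h : Normalizable μ C q.2) (hC : SmoothNear C q.2) :
    ∃ r r', IsoRel r r' C (V μ 0) q ∧ (μ = 0 ∨ r.X q.1 q.2 ≠ 0) := by
  rcases h with ⟨k, b, D, hk, h⟩ | ⟨rfl, e, d, he, h⟩
  · obtain ⟨K, β, hK, hβ, hb⟩ := exists_scale b
    have hx : ∀ y, (μ = 0 ∨ y ≠ k) → (μ = 0 ∨ K * y + -(K * k) ≠ 0) := by
      intro y hy
      have := mul_mem_quad_dom (μ := μ) hK (hy.imp_right sub_ne_zero.2)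
      rwa [show K * (y - k) = K * y + -(K * k) by ring] at this
    obtain ⟨r', key⟩ : ∃ r', IsoRel (affPar K (-(K ^ 2 * q.1)) (-(K * k)) (-D) 0) r' C
        (V μ β) q := by
      refine ⟨_, isoRel_affine hK hC (smoothNear_V (hx _ hk)) ?_⟩
      have hne : ∀ᶠ y in 𝓝 q.2, μ = 0 ∨ y ≠ k := by
        rcases hk with hk | hk
        · exact Eventually.of_forall fun _ => .inl hk
        · filter_upwards [isOpen_ne.mem_nhds hk] with y hy using .inr hy
      filter_upwards [h, hne] with y hy hyk
      have := quad_scale (b := β) hK (hyk.imp_right sub_ne_zero.2)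
      rw [hy, ← hb, V, show K * y + -(K * k) = K * (y - k) by ring, this]
      ring
    have hpt : (affPar K (-(K ^ 2 * q.1)) (-(K * k)) (-D) 0).pt q = (0, K * q.2 + -(K * k)) := by
      simp [Par.pt, Par.X, affPar]
    have hX : (affPar K (-(K ^ 2 * q.1)) (-(K * k)) (-D) 0).X q.1 q.2 = K * q.2 + -(K * k) := rfl
    rcases hβ with rfl | rfl | rfl
    · exact ⟨_, _, key, by rw [hX]; exact hx _ hk⟩
    · refine ⟨_, _, key.trans (isoRel_par1 ?_ ?_), ?_⟩
      · rw [hpt]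
      · rw [hpt]; exact hx _ hk
      · rw [Par.comp_X, hX]
        simp only [Par.X, par1, affPar, add_zero]
        exact mul_mem_quad_dom (inv_ne_zero (by simp)) (hx _ hk)
    · refine ⟨_, _, key.trans (isoRel_par2 ?_), ?_⟩
      · rw [hpt]; exact hx _ hk
      · rw [Par.comp_X, hX]
        simp only [Par.X, par2, affPar, add_zero]
        exact mul_mem_quad_dom (Real.exp_pos _).ne' (hx _ hk)
  · obtain ⟨k, hk⟩ := exists_pow_three e
    have hk0 : k ≠ 0 := by rintro rfl; exact he (by rw [← hk]; simp)
    obtain ⟨r', key⟩ : ∃ r', IsoRel (affPar k 0 0 (-d) 0) r' C (fun x => 1 * x) q := by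
      refine ⟨_, isoRel_affine hk0 hC (Eventually.of_forall fun y => by fun_prop) ?_⟩
      filter_upwards [h] with y hy
      rw [hy, ← hk]; ring
    exact ⟨_, _, key.trans isoRel_par3, .inl rfl⟩

/-- Conjugation by the normalizations turns `p` into a self-transformation of `μ/x²`, which is
generated. Undoing the conjugation reproduces `a` and `c` of `p`, and by `GenRel.of_affine` nothing
more has to be compared. -/
theorem Rel.genRel_of_normalizable {p : Par} {C C' : ℝ → ℝ} (h : Rel p C C' q)
    (hC : Normalizable μ C q.2) (hC' : Normalizable μ C' (p.X q.1 q.2)) : GenRel p C C' q := by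
  obtain ⟨r, r', hr, hx⟩ := hC.exists_isoRel h.src
  obtain ⟨s, s', hs, hx'⟩ := Normalizable.exists_isoRel (q := p.pt q) hC' h.tgt
  have hsym : Rel ((r'.comp p).comp s) (V μ 0) (V μ 0) (r.pt q) := by
    refine Rel.comp (C' := C') (hr.bwd.rel.comp ?_) ?_
    · rw [hr.pt_pt]; exact h
    · rw [Par.comp_pt, hr.pt_pt]; exact hs.fwd.rel
  have hgen := hsym.genRel_symmetry hx (by
    change μ = 0 ∨ (((r'.comp p).comp s).pt (r.pt q)).2 ≠ 0
    rw [Par.comp_pt, Par.comp_pt, hr.pt_pt]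
    exact hx')
  have hfin : GenRel ((r.comp ((r'.comp p).comp s)).comp s') C C' q := by
    refine (hr.fwd.comp hgen).comp ?_
    rw [Par.comp_pt, Par.comp_pt, Par.comp_pt, hr.pt_pt]
    exact hs.bwd
  have hτ : ContinuousAt p.τ q.1 := h.good.self_of_nhds.sτ.continuousAt
  refine GenRel.of_affine (k := 1) (κ := 0) h hfin ?_ ?_
  · filter_upwards [hr.inv, hτ.eventually hs.inv] with t h1 h2
    simp only [Par.comp, h1.1]
    linear_combination -p.a t * h1.2.1
      - (r'.a (r.τ t) * p.a t * r.a t) * h2.2.1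
  · filter_upwards [hr.inv, hτ.eventually hs.inv] with t h1 h2
    simp only [Par.comp, h1.1]
    linear_combination -p.a t * h1.2.2 - h2.2.2
      - (p.a t * (r'.a (r.τ t) * r.c t + r'.c (r.τ t)) + p.c t) * h2.2.1

end

/-! ### Classification of potentials admitting essential transformations -/

theorem poly_shift_coeffs {c₀ c₁ c₂ c₃ k x₀ : ℝ}
    (h : ∀ᶠ x in 𝓝 x₀, c₀ + c₁ * (x - k) + c₂ * (x - k) ^ 2 + c₃ * (x - k) ^ 3 = 0) :
    c₀ = 0 ∧ c₁ = 0 ∧ c₂ = 0 ∧ c₃ = 0 := by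
  have ht : Tendsto (fun y : ℝ => y + k) (𝓝 (x₀ - k)) (𝓝 x₀) := by
    have := (continuous_add_const k).tendsto (x₀ - k)
    rwa [sub_add_cancel] at this
  obtain ⟨h0, h1, h2, h3, -⟩ := poly_coeffs (c₀ := c₀) (c₁ := c₁) (c₂ := c₂) (c₃ := c₃)
    (c₄ := 0) (c₅ := 0) (c₆ := 0) ((ht.eventually h).mono fun x hx => by
      rw [add_sub_cancel_right] at hx; linear_combination hx)
  exact ⟨h0, h1, h2, h3⟩

theorem exists_eq_add_const {F G g : ℝ → ℝ} {x : ℝ} (hF : ∀ᶠ y in 𝓝 x, HasDerivAt F (g y) y)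
    (hG : ∀ᶠ y in 𝓝 x, HasDerivAt G (g y) y) : ∃ k, ∀ᶠ y in 𝓝 x, F y = G y + k := by
  obtain ⟨k, hk⟩ := exists_const_of_hasDerivAt_zero (g := fun y => F y - G y) (x₀ := x) (by
    filter_upwards [hF, hG] with y h1 h2
    exact (h1.sub h2).congr_deriv (sub_self _))
  exact ⟨k, hk.mono fun y hy => by linarith⟩

/-- Near `x`, the potential is the sum of `μ / (y - k)²` and of a cubic polynomial. -/
def HasForm (C : ℝ → ℝ) (x μ k b₃ b₂ b₁ b₀ : ℝ) : Prop :=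
  (μ = 0 ∨ x ≠ k) ∧ ∀ᶠ y in 𝓝 x,
    C y = μ / (y - k) ^ 2 + b₃ * (y - k) ^ 3 + b₂ * (y - k) ^ 2 + b₁ * (y - k) + b₀

section

variable {p : Par} {C C' : ℝ → ℝ} {q : ℝ × ℝ}

/-- The operator `∂_t + (4Ax + 2B) ∂_x` annihilates `x̃ = a x + c`. Applied to `a² C'(x̃) = C + Q`,
it only differentiates `a²`, giving the factor `-8A`; the relation itself then eliminates `C'`. -/
theorem Rel.classifying (h : Rel p C C' q) : ∀ᶠ w : ℝ × ℝ in 𝓝 q,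
    (4 * p.A w.1 * w.2 + 2 * p.B w.1) * deriv C w.2 + 8 * p.A w.1 * C w.2
      = -(deriv p.q2 w.1 * w.2 ^ 2 + deriv p.q1 w.1 * w.2 + deriv p.q0 w.1)
        - 8 * p.A w.1 * p.Q w.1 w.2
        - (4 * p.A w.1 * w.2 + 2 * p.B w.1) * (2 * p.q2 w.1 * w.2 + p.q1 w.1) := by
  filter_upwards [h.rel.eventually_nhds, eventually_fst h.good, eventually_snd h.src,
    h.eventually_tgt h.tgt] with w hw hg hs ht
  obtain ⟨t, x⟩ := w
  simp only at hw hg hs ht ⊢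
  have dC : HasDerivAt C (deriv C x) x := (hs.differentiableAt (by simp)).hasDerivAt
  have dC' : HasDerivAt C' (deriv C' (p.X t x)) (p.X t x) :=
    (ht.differentiableAt (by simp)).hasDerivAt
  have dA := contDiffAt_deriv hg.sA
  have dB := contDiffAt_deriv hg.sB
  have dH := contDiffAt_deriv hg.sH
  have sm : ∀ {g : ℝ → ℝ}, ContDiffAt ℝ ∞ g t → HasDerivAt g (deriv g t) t := fun hg =>
    (hg.differentiableAt (by simp)).hasDerivAt
  have d2 : HasDerivAt p.q2 (deriv p.q2 t) t :=
    sm (dA.add (contDiffAt_const.mul (hg.sA.pow 2)))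
  have d1 : HasDerivAt p.q1 (deriv p.q1 t) t :=
    sm (dB.add ((contDiffAt_const.mul hg.sA).mul hg.sB))
  have d0 : HasDerivAt p.q0 (deriv p.q0 t) t :=
    sm ((dH.add (hg.sB.pow 2)).sub (contDiffAt_const.mul hg.sA))
  have et := ((tendsto_slice_left t x).eventually hw)
  have ex := ((tendsto_slice_right t x).eventually hw)
  have hX : HasDerivAt (fun s => p.X s x) (-4 * p.a t * p.A t * x + -2 * p.a t * p.B t) t :=
    (hg.da.mul_const x).add hg.dc
  have hX' : HasDerivAt (fun y => p.X t y) (p.a t) x :=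
    (((hasDerivAt_id x).const_mul (p.a t)).add_const (p.c t)).congr_deriv (by simp)
  have eqt := ((((hg.da.pow 2).mul (dC'.comp t hX)).congr_of_eventuallyEq
    (EventuallyEq.symm et))).unique
    ((((d2.mul_const (x ^ 2)).add (d1.mul_const x)).add d0).const_add (C x))
  have eqx := (((dC'.comp x hX').const_mul (p.a t ^ 2)).congr_of_eventuallyEq
    (EventuallyEq.symm ex)).unique
    (dC.add (((((hasDerivAt_id x).pow 2).const_mul (p.q2 t)).add
      ((hasDerivAt_id x).const_mul (p.q1 t))).add_const (p.q0 t)))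
  have e0 := hw.self_of_nhds
  simp at eqt eqx e0
  linear_combination -eqt - (4 * p.A t * x + 2 * p.B t) * eqx - 8 * p.A t * e0

/-- The form of a potential that admits a transformation with non-constant scale or shift. -/
theorem Rel.exists_hasForm (h : Rel p C C' q) (hne : ∃ᶠ t in 𝓝 q.1, p.A t ≠ 0 ∨ p.B t ≠ 0) :
    ∃ μ k b₃ b₂ b₁ b₀, HasForm C q.2 μ k b₃ b₂ b₁ b₀ ∧ (μ = 0 ∨ b₃ = 0) := by
  -- A single time with `(A, B) ≠ 0` suffices: with `t` frozen, the classifying equation is a linear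
  -- ODE for `C` in `x`.
  obtain ⟨t, hne, ht⟩ := (hne.and_eventually (eventually_curry h.classifying)).exists
  simp only [Par.Q_eq] at ht
  have dC : ∀ᶠ x in 𝓝 q.2, HasDerivAt C (deriv C x) x :=
    h.src.mono fun x hx => (hx.differentiableAt (by simp)).hasDerivAt
  set A := p.A t
  set B := p.B t
  by_cases hA : A = 0
  · have hB : B ≠ 0 := hne.resolve_left fun h => h hA
    obtain ⟨α₂, α₁, α₀, hα⟩ : ∃ α₂ α₁ α₀, ∀ᶠ x in 𝓝 q.2,
        deriv C x = α₂ * x ^ 2 + α₁ * x + α₀ := by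
      refine ⟨-(deriv p.q2 t) / (2 * B), (-(deriv p.q1 t) - 4 * B * p.q2 t) / (2 * B),
        (-(deriv p.q0 t) - 2 * B * p.q1 t) / (2 * B), ?_⟩
      filter_upwards [ht] with x hx
      rw [hA] at hx
      field_simp
      linear_combination hx
    -- For `A = 0` the derivative of `C` is quadratic, so `C` is a cubic polynomial.
    obtain ⟨c, hc⟩ := exists_eq_add_const (F := C)
      (G := fun x => α₂ / 3 * x ^ 3 + α₁ / 2 * x ^ 2 + α₀ * x) dC (by
        filter_upwards [hα] with x hx
        refine (((((hasDerivAt_id x).pow 3).const_mul (α₂ / 3)).add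
          (((hasDerivAt_id x).pow 2).const_mul (α₁ / 2))).add
          ((hasDerivAt_id x).const_mul α₀)).congr_deriv ?_
        rw [hx]; simp; ring)
    refine ⟨0, 0, α₂ / 3, α₁ / 2, α₀, c, ⟨.inl rfl, hc.mono fun x hx => ?_⟩, .inl rfl⟩
    rw [hx]; simp
  · set k := -B / (2 * A) with hk
    have hB : B = -(2 * A * k) := by rw [hk]; field_simp
    -- For `A ≠ 0` the equation is divided by `4A` and its right side expanded around the zero `k`
    -- of `4Ax + 2B`.
    obtain ⟨β₂, β₁, β₀, hβ⟩ : ∃ β₂ β₁ β₀, ∀ᶠ x in 𝓝 q.2,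
        (x - k) * deriv C x + 2 * C x = β₂ * (x - k) ^ 2 + β₁ * (x - k) + β₀ := by
      refine ⟨(-deriv p.q2 t - 16 * A * p.q2 t) / (4 * A),
        ((-deriv p.q1 t - 12 * A * p.q1 t - 4 * B * p.q2 t)
          + 2 * k * (-deriv p.q2 t - 16 * A * p.q2 t)) / (4 * A),
        ((-deriv p.q0 t - 8 * A * p.q0 t - 2 * B * p.q1 t)
          + k * (-deriv p.q1 t - 12 * A * p.q1 t - 4 * B * p.q2 t)
          + k ^ 2 * (-deriv p.q2 t - 16 * A * p.q2 t)) / (4 * A), ?_⟩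
      filter_upwards [ht] with x hx
      field_simp
      rw [hB] at hx ⊢
      linear_combination hx
    -- The integrating factor `x - k` makes the left side the derivative of `(x - k)² C`; the
    -- constant of integration is `μ`.
    obtain ⟨μ, hμ⟩ := exists_eq_add_const (F := fun x => (x - k) ^ 2 * C x)
      (G := fun x => β₂ / 4 * (x - k) ^ 4 + β₁ / 3 * (x - k) ^ 3 + β₀ / 2 * (x - k) ^ 2)
      (g := fun x => (x - k) * (β₂ * (x - k) ^ 2 + β₁ * (x - k) + β₀)) (x := q.2)
      (by
        filter_upwards [hβ, dC] with x hx hd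
        refine ((((hasDerivAt_id x).sub_const k).pow 2).mul hd).congr_deriv ?_
        rw [← hx]; simp; ring)
      (Eventually.of_forall fun x => by
        have hd := (hasDerivAt_id x).sub_const k
        refine ((((hd.pow 4).const_mul (β₂ / 4)).add ((hd.pow 3).const_mul (β₁ / 3))).add
          ((hd.pow 2).const_mul (β₀ / 2))).congr_deriv ?_
        simp; ring)
    refine ⟨μ, k, 0, β₂ / 4, β₁ / 3, β₀ / 2, ?_, .inr rfl⟩
    -- Smoothness of `C` at its own centre leaves no singular part: evaluation at `k` gives `μ = 0`,
    -- and the value at `k` itself is recovered by continuity.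
    by_cases hx : q.2 = k
    · have h0 := hμ.self_of_nhds
      simp only [hx, sub_self] at h0
      have hμ0 : μ = 0 := by simpa using h0.symm
      refine ⟨.inl hμ0, ?_⟩
      have hc : ContinuousAt C q.2 := dC.self_of_nhds.continuousAt
      have hne : ∀ᶠ x in 𝓝[≠] q.2, C x = β₂ / 4 * (x - k) ^ 2 + β₁ / 3 * (x - k) + β₀ / 2 := by
        filter_upwards [hμ.filter_mono nhdsWithin_le_nhds, self_mem_nhdsWithin] with x h1 h2
        have hxk : x - k ≠ 0 := sub_ne_zero.2 fun e => h2 (e.trans hx.symm)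
        have : (x - k) ^ 2 ≠ 0 := pow_ne_zero 2 hxk
        refine mul_left_cancel₀ this ?_
        rw [h1, hμ0]; ring
      have hself : C q.2 = β₂ / 4 * (q.2 - k) ^ 2 + β₁ / 3 * (q.2 - k) + β₀ / 2 := by
        refine tendsto_nhds_unique_of_eventuallyEq (l := 𝓝[≠] q.2)
          (hc.tendsto.mono_left nhdsWithin_le_nhds) ?_ hne
        have : Continuous fun x => β₂ / 4 * (x - k) ^ 2 + β₁ / 3 * (x - k) + β₀ / 2 := by
          fun_prop
        exact (this.tendsto q.2).mono_left nhdsWithin_le_nhds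
      rw [eventually_nhdsWithin_iff] at hne
      filter_upwards [hne] with x h1
      by_cases e : x = q.2
      · rw [e, hself, hμ0]; simp
      · rw [h1 e, hμ0]; simp
    · refine ⟨.inr hx, ?_⟩
      filter_upwards [hμ, isOpen_ne.mem_nhds hx] with x h1 h2
      have hxk : x - k ≠ 0 := sub_ne_zero.2 h2
      field_simp
      linear_combination 24 * h1

/-- At the frozen time `q.1` the relation is an affine change of `x` plus a quadratic polynomial. It
therefore keeps `μ` and divides the cubic coefficient by `a⁵`. -/
theorem Rel.hasForm_tgt (h : Rel p C C' q) {μ k b₃ b₂ b₁ b₀ : ℝ}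
    (hf : HasForm C q.2 μ k b₃ b₂ b₁ b₀) : ∃ β₂ β₁ β₀,
    HasForm C' (p.X q.1 q.2) μ (p.a q.1 * k + p.c q.1) (b₃ / p.a q.1 ^ 5) β₂ β₁ β₀ := by
  have ha := h.good.self_of_nhds.a_ne
  set a := p.a q.1 with ea
  set c := p.c q.1 with ec
  refine ⟨(b₂ + p.q2 q.1) / a ^ 4, (b₁ + 2 * k * p.q2 q.1 + p.q1 q.1) / a ^ 3,
    (b₀ + k ^ 2 * p.q2 q.1 + k * p.q1 q.1 + p.q0 q.1) / a ^ 2, ?_, ?_⟩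
  · refine hf.1.imp_right fun hx e => hx ?_
    simp only [Par.X] at e
    exact mul_left_cancel₀ ha (add_right_cancel e)
  · have ht : Tendsto (fun y => (y - c) / a) (𝓝 (p.X q.1 q.2)) (𝓝 q.2) := by
      have hcont : Continuous fun y => (y - c) / a := by fun_prop
      have := hcont.tendsto (p.X q.1 q.2)
      rwa [show (p.X q.1 q.2 - c) / a = q.2 by simp only [Par.X, ← ea, ← ec]; field_simp; ring]
        at this
    have hr := (eventually_curry h.rel).self_of_nhds
    have hne : ∀ᶠ y in 𝓝 (p.X q.1 q.2), μ = 0 ∨ (y - c) / a ≠ k := by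
      rcases hf.1 with hμ | hx
      · exact Eventually.of_forall fun _ => .inl hμ
      · filter_upwards [ht.eventually (isOpen_ne.mem_nhds hx)] with y hy using .inr hy
    filter_upwards [ht.eventually hr, ht.eventually hf.2, hne] with y h1 h2 h3
    obtain ⟨x, rfl⟩ : ∃ x, y = a * x + c := ⟨(y - c) / a, by field_simp; ring⟩
    rw [show (a * x + c - c) / a = x by field_simp; ring] at h1 h2 h3
    rw [h2, Par.Q_eq] at h1
    simp only [Par.X, ← ea, ← ec] at h1
    rw [show a * x + c - (a * k + c) = a * (x - k) by ring]
    have e : C' (a * x + c) = (μ / (x - k) ^ 2 + b₃ * (x - k) ^ 3 + b₂ * (x - k) ^ 2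
        + b₁ * (x - k) + b₀ + (p.q2 q.1 * x ^ 2 + p.q1 q.1 * x + p.q0 q.1)) / a ^ 2 := by
      rw [← h1]; field_simp
    rw [e]
    rcases h3 with rfl | h3
    · simp only [zero_div]; field_simp; ring
    · have := sub_ne_zero.2 h3
      field_simp; ring

/-- Completing the square when `b₂ ≠ 0`; otherwise the potential is constant or affine. -/
theorem HasForm.normalizable_zero {x k b₂ b₁ b₀ : ℝ} (h : HasForm C x 0 k 0 b₂ b₁ b₀) :
    Normalizable 0 C x := by
  have h := h.2
  by_cases h2 : b₂ = 0
  · by_cases h1 : b₁ = 0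
    · exact .inl ⟨0, 0, b₀, .inl rfl, h.mono fun y hy => by rw [hy, h1, h2]; simp⟩
    · exact .inr ⟨rfl, b₁, b₀ - b₁ * k, h1, h.mono fun y hy => by rw [hy, h2]; simp; ring⟩
  · refine .inl ⟨k - b₁ / (2 * b₂), b₂, b₀ - b₁ ^ 2 / (4 * b₂), .inl rfl, h.mono fun y hy => ?_⟩
    rw [hy]; simp only [zero_div]; field_simp; ring

/-- A positive power of `a` is constant, so `a' = -4aA` vanishes, and `a ≠ 0`. -/
theorem Rel.A_eq_zero (h : Rel p C C' q) {n : ℕ} {β b : ℝ} (hβ : β ≠ 0)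
    (hk : ∀ᶠ t in 𝓝 q.1, β * p.a t ^ (n + 1) = b) : ∀ᶠ t in 𝓝 q.1, p.A t = 0 := by
  filter_upwards [h.good, hk.eventually_nhds] with t h1 h2
  have := ((h1.da.pow (n + 1)).const_mul β).unique
    ((hasDerivAt_const t b).congr_of_eventuallyEq h2)
  have hn : (n : ℝ) + 1 ≠ 0 := by positivity
  simpa [h1.a_ne, hβ, hn] using this

theorem Rel.B_eq_zero (h : Rel p C C' q) {κ : ℝ} (hk : ∀ᶠ t in 𝓝 q.1, p.c t = κ) :
    ∀ᶠ t in 𝓝 q.1, p.B t = 0 := by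
  filter_upwards [h.good, hk.eventually_nhds] with t h1 h2
  have := h1.dc.unique ((hasDerivAt_const t κ).congr_of_eventuallyEq h2)
  simpa [h1.a_ne] using this

/-- The coefficients of both potentials are constants while `a`, `c` and `Q` vary with `t`, so
comparing powers of `x` at each nearby `t` constrains these functions. -/
theorem Rel.rel_hasForm (h : Rel p C C' q) {μ k b₃ b₂ b₁ b₀ μ' k' β₃ β₂ β₁ β₀ : ℝ}
    (hf : HasForm C q.2 μ k b₃ b₂ b₁ b₀)
    (hf' : HasForm C' (p.X q.1 q.2) μ' k' β₃ β₂ β₁ β₀) :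
    ∀ᶠ t in 𝓝 q.1, ∀ᶠ x in 𝓝 q.2, (μ = 0 ∨ x - k ≠ 0) ∧ (μ' = 0 ∨ p.a t * x + p.c t - k' ≠ 0) ∧
      p.a t ^ 2 * (μ' / (p.a t * x + p.c t - k') ^ 2 + β₃ * (p.a t * x + p.c t - k') ^ 3
        + β₂ * (p.a t * x + p.c t - k') ^ 2 + β₁ * (p.a t * x + p.c t - k') + β₀)
      = μ / (x - k) ^ 2 + b₃ * (x - k) ^ 3 + b₂ * (x - k) ^ 2 + b₁ * (x - k) + b₀
        + (p.q2 t * x ^ 2 + p.q1 t * x + p.q0 t) := by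
  have hne : ∀ {μ k x : ℝ}, (μ = 0 ∨ x ≠ k) → ∀ᶠ y in 𝓝 x, μ = 0 ∨ y - k ≠ 0 := by
    intro μ k x hx
    rcases hx with hμ | hx
    · exact Eventually.of_forall fun _ => .inl hμ
    · filter_upwards [isOpen_ne.mem_nhds hx] with y hy using .inr (sub_ne_zero.2 hy)
  refine eventually_curry (P := fun w => (μ = 0 ∨ w.2 - k ≠ 0) ∧
    (μ' = 0 ∨ p.X w.1 w.2 - k' ≠ 0) ∧ p.a w.1 ^ 2 * (μ' / (p.X w.1 w.2 - k') ^ 2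
      + β₃ * (p.X w.1 w.2 - k') ^ 3 + β₂ * (p.X w.1 w.2 - k') ^ 2 + β₁ * (p.X w.1 w.2 - k') + β₀)
      = μ / (w.2 - k) ^ 2 + b₃ * (w.2 - k) ^ 3 + b₂ * (w.2 - k) ^ 2 + b₁ * (w.2 - k) + b₀
        + (p.q2 w.1 * w.2 ^ 2 + p.q1 w.1 * w.2 + p.q0 w.1)) ?_
  filter_upwards [h.rel, eventually_snd hf.2, h.eventually_tgt hf'.2, eventually_snd (hne hf.1),
    h.eventually_tgt (hne hf'.1)] with w h1 h2 h3 h4 h5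
  rw [h2, h3, Par.Q_eq] at h1
  exact ⟨h4, h5, h1⟩

/-- A transformation of a potential with an inverse square singularity fixes the singularity. -/
theorem Rel.center_eq (h : Rel p C C' q) {μ k b₂ b₁ b₀ k' β₂ β₁ β₀ : ℝ} (hμ : μ ≠ 0)
    (hf : HasForm C q.2 μ k 0 b₂ b₁ b₀) (hf' : HasForm C' (p.X q.1 q.2) μ k' 0 β₂ β₁ β₀) :
    ∀ᶠ t in 𝓝 q.1, p.a t * k + p.c t = k' := by
  filter_upwards [h.rel_hasForm hf hf'] with t ht
  set a := p.a t
  set c := p.c t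
  -- With denominators cleared, the identity extends from a neighbourhood of `q.2` to the whole line
  -- and can be evaluated at the singular point `x = k`, where only `μ (a k + c - k')² = 0`
  -- survives.
  have hP : (Polynomial.C (a ^ 2) * (Polynomial.X - Polynomial.C k) ^ 2 * (Polynomial.C μ
      + (Polynomial.C a * Polynomial.X + Polynomial.C c - Polynomial.C k') ^ 2
        * (Polynomial.C β₂ * (Polynomial.C a * Polynomial.X + Polynomial.C c - Polynomial.C k') ^ 2
          + Polynomial.C β₁ * (Polynomial.C a * Polynomial.X + Polynomial.C c - Polynomial.C k')
          + Polynomial.C β₀))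
      - (Polynomial.C a * Polynomial.X + Polynomial.C c - Polynomial.C k') ^ 2 * (Polynomial.C μ
        + (Polynomial.X - Polynomial.C k) ^ 2
          * (Polynomial.C b₂ * (Polynomial.X - Polynomial.C k) ^ 2
            + Polynomial.C b₁ * (Polynomial.X - Polynomial.C k) + Polynomial.C b₀
            + (Polynomial.C (p.q2 t) * Polynomial.X ^ 2 + Polynomial.C (p.q1 t) * Polynomial.X
              + Polynomial.C (p.q0 t)))) : Polynomial ℝ) = 0 := by
    refine poly_eq_zero (x₀ := q.2) (ht.mono fun x hx => ?_)
    obtain ⟨h1, h2, h3⟩ := hx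
    have h1 := h1.resolve_left hμ
    have h2 := h2.resolve_left hμ
    simp only [Polynomial.eval_sub, Polynomial.eval_mul, Polynomial.eval_pow, Polynomial.eval_add,
      Polynomial.eval_C, Polynomial.eval_X]
    generalize hX : a * x + c - k' = Y at *
    generalize hx : x - k = ξ at *
    field_simp at h3
    linear_combination h3
  have := congrArg (Polynomial.eval k) hP
  simp [hμ] at this
  linarith

/-- Potentials related by a transformation with non-constant scale or shift are normalizable. -/
theorem Rel.exists_normalizable (h : Rel p C C' q) (hne : ∃ᶠ t in 𝓝 q.1, p.A t ≠ 0 ∨ p.B t ≠ 0) :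
    ∃ μ, Normalizable μ C q.2 ∧ Normalizable μ C' (p.X q.1 q.2) := by
  have hnot : (∀ᶠ t in 𝓝 q.1, p.A t = 0) → (∀ᶠ t in 𝓝 q.1, p.B t = 0) → False := by
    intro hA hB
    refine hne ?_
    filter_upwards [hA, hB] with t h1 h2
    simp [h1, h2]
  obtain ⟨μ, k, b₃, b₂, b₁, b₀, hf, hb⟩ := h.exists_hasForm hne
  obtain ⟨β₂, β₁, β₀, hf'⟩ := h.hasForm_tgt hf
  have hrel := h.rel_hasForm hf hf'
  have ha := h.good.self_of_nhds.a_ne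
  set k' := p.a q.1 * k + p.c q.1
  by_cases hμ : μ = 0
  · subst hμ
    by_cases h3 : b₃ = 0
    · subst h3
      rw [zero_div] at hf'
      exact ⟨0, hf.normalizable_zero, hf'.normalizable_zero⟩
    exfalso
    set β₃ := b₃ / p.a q.1 ^ 5
    have hβ₃ : β₃ ≠ 0 := div_ne_zero h3 (pow_ne_zero 5 ha)
    -- The coefficients of `(x - k)³` and `(x - k)²`. The cubic one makes `a⁵` constant, since `Q`
    -- has no cubic term.
    have key : ∀ᶠ t in 𝓝 q.1, β₃ * p.a t ^ (4 + 1) = b₃ ∧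
        p.a t ^ 4 * (3 * β₃ * (p.a t * k + p.c t - k') + β₂) = b₂ + p.q2 t := by
      filter_upwards [hrel] with t ht
      set a := p.a t
      set δ := p.a t * k + p.c t - k' with hδ
      obtain ⟨-, -, h2, h3⟩ := poly_shift_coeffs (k := k) (x₀ := q.2)
        (c₀ := a ^ 2 * (β₃ * δ ^ 3 + β₂ * δ ^ 2 + β₁ * δ + β₀) - b₀
          - (k ^ 2 * p.q2 t + k * p.q1 t + p.q0 t))
        (c₁ := a ^ 2 * (3 * β₃ * a * δ ^ 2 + 2 * β₂ * a * δ + β₁ * a) - b₁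
          - (2 * k * p.q2 t + p.q1 t))
        (c₂ := a ^ 4 * (3 * β₃ * δ + β₂) - b₂ - p.q2 t) (c₃ := β₃ * a ^ 5 - b₃)
        (ht.mono fun x hx => by
          have := hx.2.2
          simp only [zero_div, zero_add] at this
          rw [hδ]
          linear_combination this)
      exact ⟨by linear_combination h3, by linear_combination h2⟩
    have hA := h.A_eq_zero hβ₃ (key.mono fun t ht => ht.1)
    obtain ⟨a, hac⟩ : ∃ a, ∀ᶠ t in 𝓝 q.1, p.a t = a := by
      refine exists_const_of_hasDerivAt_zero ?_
      filter_upwards [hA, h.good] with t h1 h2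
      exact h2.da.congr_deriv (by rw [h1]; ring)
    have ha0 : a ≠ 0 := by rw [← hac.self_of_nhds]; exact ha
    -- With `A = 0` the coefficient `q2` vanishes and `a` is constant; the quadratic coefficient can
    -- be solved for `c`, so `c` is constant too and `B = 0`, a contradiction.
    refine hnot hA (h.B_eq_zero (κ := k' - a * k + (b₂ / a ^ 4 - β₂) / (3 * β₃)) ?_)
    filter_upwards [key, hA.eventually_nhds, hac] with t h1 h2 h4
    have hq2 : p.q2 t = 0 := by
      rw [Par.q2, EventuallyEq.deriv_eq h2, h2.self_of_nhds]; simp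
    have h1 := h1.2
    rw [hq2, h4] at h1
    field_simp
    linear_combination h1
  · have hb₃ : b₃ = 0 := hb.resolve_left hμ
    subst hb₃
    rw [zero_div] at hf' hrel
    have hcen := h.center_eq hμ hf hf'
    -- Differentiation of `a k + c = k'`.
    have hB : ∀ᶠ t in 𝓝 q.1, p.B t = -2 * k * p.A t := by
      filter_upwards [hcen.eventually_nhds, h.good] with t h1 h2
      have := ((h2.da.mul_const k).add h2.dc).unique
        ((hasDerivAt_const t k').congr_of_eventuallyEq h1)
      refine mul_left_cancel₀ h2.a_ne ?_
      linear_combination -this / 2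
    -- From `B = -2kA` follows `q1 = -2k q2`, so `Q` has no linear term around `k` and the
    -- coefficients of `x - k` give `β₁ a³ = b₁`.
    have key : ∀ᶠ t in 𝓝 q.1, β₁ * p.a t ^ (2 + 1) = b₁ := by
      filter_upwards [hrel, hcen, hB.eventually_nhds, h.good] with t ht hk hBt hg
      have hq1 : p.q1 t = -2 * k * p.q2 t := by
        rw [Par.q1, Par.q2, EventuallyEq.deriv_eq hBt, hBt.self_of_nhds, deriv_const_mul_field]
        ring
      have ha := hg.a_ne
      obtain ⟨-, h1, -⟩ := poly_shift_coeffs (k := k) (x₀ := q.2)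
        (c₀ := p.a t ^ 2 * β₀ - b₀ - (k ^ 2 * p.q2 t + k * p.q1 t + p.q0 t))
        (c₁ := p.a t ^ 3 * β₁ - b₁) (c₂ := p.a t ^ 4 * β₂ - b₂ - p.q2 t) (c₃ := 0)
        (ht.mono fun x hx => by
          obtain ⟨h1, -, h3⟩ := hx
          have h1 := h1.resolve_left hμ
          rw [show p.a t * x + p.c t - k' = p.a t * (x - k) by rw [← hk]; ring] at h3
          have e : p.a t ^ 2 * (μ / (p.a t * (x - k)) ^ 2) = μ / (x - k) ^ 2 := by field_simp
          linear_combination h3 - e + (x - k) * hq1)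
      linear_combination h1
    -- A nonzero linear term would make `a` constant, hence `A = 0` and with it `B = 0`.
    have hβ₁ : β₁ = 0 := by
      by_contra hβ
      have hA := h.A_eq_zero hβ key
      refine hnot hA ?_
      filter_upwards [hA, hB] with t h1 h2
      rw [h2, h1, mul_zero]
    have hb₁ : b₁ = 0 := by rw [← key.self_of_nhds, hβ₁, zero_mul]
    subst hβ₁ hb₁
    exact ⟨μ, .inl ⟨k, b₂, b₀, hf.1, hf.2.mono fun x hx => by rw [hx]; ring⟩,
      .inl ⟨k', β₂, β₀, hf'.1, hf'.2.mono fun x hx => by rw [hx]; ring⟩⟩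

/-- Every transformation between two equations of the class is generated. -/
theorem Rel.genRel (h : Rel p C C' q) : GenRel p C C' q := by
  by_cases hne : ∃ᶠ t in 𝓝 q.1, p.A t ≠ 0 ∨ p.B t ≠ 0
  · obtain ⟨μ, h1, h2⟩ := h.exists_normalizable hne
    exact h.genRel_of_normalizable h1 h2
  have hAB : ∀ᶠ t in 𝓝 q.1, p.A t = 0 ∧ p.B t = 0 := by
    filter_upwards [not_frequently.1 hne] with t ht
    simpa using ht
  obtain ⟨k, hk⟩ : ∃ k, ∀ᶠ t in 𝓝 q.1, p.a t = k := by
    refine exists_const_of_hasDerivAt_zero ?_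
    filter_upwards [hAB, h.good] with t h1 h2
    exact h2.da.congr_deriv (by rw [h1.1]; ring)
  obtain ⟨κ, hκ⟩ : ∃ κ, ∀ᶠ t in 𝓝 q.1, p.c t = κ := by
    refine exists_const_of_hasDerivAt_zero ?_
    filter_upwards [hAB, h.good] with t h1 h2
    exact h2.dc.congr_deriv (by rw [h1.2]; ring)
  have hid : GenRel (affPar 1 0 0 0 0) C C q :=
    genRel_affine one_ne_zero h.src (by simpa using h.src) (Eventually.of_forall fun x => by simp)
  -- Constant `a` and `c` are an affine change of those of the identity.
  refine GenRel.of_affine (k := k) (κ := κ) h hid ?_ ?_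
  · filter_upwards [hk] with t ht
    simp [affPar, ht]
  · filter_upwards [hκ] with t ht
    simp [affPar, ht]

end

/-! ### The families generate the equivalence groupoid -/

section

variable {T : Triple} {p : Par} {σ : ℝ} {f : ℝ → ℝ → ℝ} {z : Space}

theorem tendsto_planar (z : Space) :
    Tendsto (fun y : Space => (y.1, y.2.1)) (𝓝 z) (𝓝 (z.1, z.2.1)) :=
  Continuous.tendsto (by fun_prop) z

theorem tendsto_lift (z : Space) :
    Tendsto (fun w : ℝ × ℝ => ((w.1, w.2, z.2.2) : Space)) (𝓝 (z.1, z.2.1)) (𝓝 z) :=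
  Continuous.tendsto (f := fun w : ℝ × ℝ => ((w.1, w.2, z.2.2) : Space)) (by fun_prop)
    (z.1, z.2.1)

theorem IsFormAt.eventually {Φ : Space → Space} (h : IsFormAt Φ p σ f z) :
    ∀ᶠ y in 𝓝 z, IsFormAt Φ p σ f y := by
  filter_upwards [h.map_eq.eventually_nhds,
    continuous_fst.continuousAt.eventually h.good.eventually_nhds,
    (tendsto_planar z).eventually h.smooth.eventually_nhds] with y h1 h2 h3
  exact ⟨h.σ_ne, h1, h2, h3⟩

theorem IsAdmissible.rel_near (hT : IsAdmissible T) (hz : z ∈ T.dom)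
    (hf : IsFormAt T.map p σ f z) : Rel p T.src.fn T.tgt.fn (z.1, z.2.1) := by
  refine ⟨hf.good, T.src.smoothNear (by rw [hT.src_dom]; exact ⟨z, hz, rfl⟩),
    T.tgt.smoothNear ?_, ?_⟩
  · rw [hT.tgt_dom]
    exact ⟨z, hz, by simp only [hf.map_eq.self_of_nhds]; rfl⟩
  · filter_upwards [(tendsto_lift z).eventually (hf.eventually.and
      (hT.point.isOpen.mem_nhds hz))] with w hw
    exact (hT.rel_of_form hw.2 hw.1).1

/-- The map factors into the superposition with `f`, the parametrized transformation, and the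
multiplication of `u` by `σ`. The last is kept apart because `σ` may be negative and `exp H` cannot
absorb it. -/
theorem gen_of_rel {C C' : ℝ → ℝ} {q : ℝ × ℝ} (h : Rel p C C' q) (hσ : σ ≠ 0)
    (hf : ∀ᶠ w : ℝ × ℝ in 𝓝 q, ContDiffAt ℝ ∞ (fun w : ℝ × ℝ => f w.1 w.2) w)
    (hs : ∀ᶠ w : ℝ × ℝ in 𝓝 q, pdt f w.1 w.2 = pdx (pdx f) w.1 w.2 + C w.2 * f w.1 w.2) :
    Gen (p.mapAff σ f) C C' q := by
  have hscale : Gen ((affPar 1 0 0 0 0).mapAff σ fun _ _ => 0) C' C' (p.pt q) :=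
    gen_affine one_ne_zero hσ h.tgt (Eventually.of_forall fun x => by simp)
  have h1 : Gen (((affPar 1 0 0 0 0).mapAff σ fun _ _ => 0) ∘ p.map) C C' q :=
    Gen.comp one_ne_zero h.good (Eventually.of_forall fun _ => contDiffAt_const)
      h.genRel.gen hscale
  have hpt : (affPar 1 0 0 0 0).pt q = q := by simp [Par.pt, Par.X, affPar]
  refine (Gen.comp one_ne_zero (Eventually.of_forall fun t => affPar_good one_ne_zero t) hf
    (gen_lin h.src hf hs) (by rwa [hpt])).congr (Eventually.of_forall fun w u => ?_)
    (Eventually.of_forall fun _ => rfl) (Eventually.of_forall fun _ _ => rfl)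
  simp [Par.map, Par.mapAff, Par.X, Par.P, affPar, mul_assoc]

theorem isGenerating_generatingSet : IsGenerating essLinGroupoid generatingSet := by
  refine ⟨generatingSet_subset, fun T hT z hz => ?_⟩
  obtain ⟨p, σ, f, hf⟩ := IsAdmissible.exists_form hT hz
  have hs : ∀ᶠ w : ℝ × ℝ in 𝓝 (z.1, z.2.1),
      pdt f w.1 w.2 = pdx (pdx f) w.1 w.2 + T.src.fn w.2 * f w.1 w.2 := by
    filter_upwards [(tendsto_lift z).eventually (hf.eventually.and
      (hT.point.isOpen.mem_nhds hz))] with w hw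
    exact (hT.rel_of_form hw.2 hw.1).2
  obtain ⟨N, hN, hgen⟩ := gen_of_rel (hT.rel_near hz hf) hf.σ_ne hf.smooth hs
  obtain ⟨W, hW, ho, hzW⟩ := mem_nhds_iff.1 (inter_mem (hT.point.isOpen.mem_nhds hz)
    (inter_mem hf.eventually ((tendsto_planar z).eventually hN)))
  have hform : ∀ y ∈ W, IsFormAt T.map p σ f y := fun y hy => (hW hy).2.1
  have hmap : ∀ y ∈ W, T.map y = p.mapAff σ f y := fun y hy => (hform y hy).map_eq.self_of_nhds
  obtain ⟨T₀, h1, h2, h3, h4, h5, h6, h7⟩ := hgen W ho ⟨z, hzW⟩ fun y hy => (hW hy).2.2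
  have hmap₀ : ∀ y ∈ W, T₀.map y = T.map y := fun y hy => (h3 hy).trans (hmap y hy).symm
  have htgt : T₀.tgt.dom = (fun y : Space => (T.map y).2.1) '' W :=
    h6.trans (image_congr fun y hy => by rw [hmap y hy])
  -- On `W` the composition has the same map and potential values as `T`, so it inherits the local
  -- form and the relations that imply admissibility.
  have hT₀ : IsAdmissible T₀ := by
    refine isAdmissible_of_form (by rwa [h2]) (by rw [h2]; exact ⟨z, hzW⟩) (by rw [h2, h4])
      (by rw [h2, htgt]; exact image_congr fun y hy => by rw [hmap₀ y hy]) fun y hy => ?_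
    rw [h2] at hy
    have hr := hT.rel_of_form (hW hy).1 (hform y hy)
    refine ⟨p, σ, f, ⟨hf.σ_ne, ?_, (hform y hy).good, (hform y hy).smooth⟩, ?_, ?_⟩
    · filter_upwards [ho.mem_nhds hy] with v hv using h3 hv
    · rw [h5 y hy, ← hr.1]
      congr 1
      exact h7 y hy
    · rw [h5 y hy]; exact hr.2
  refine ⟨T₀, ⟨hT₀, ?_, ?_, ⟨?_, ?_⟩, ?_, ?_⟩, by rw [h2]; exact hzW, h1⟩
  · rw [h2]; exact fun y hy => (hW hy).1
  · rw [h2]; exact hmap₀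
  · rw [h4, hT.src_dom]; exact image_mono fun y hy => (hW hy).1
  · rw [h4]; rintro _ ⟨y, hy, rfl⟩; exact h5 y hy
  · rw [htgt, hT.tgt_dom]; exact image_mono fun y hy => (hW hy).1
  · rw [h6]; rintro _ ⟨y, hy, rfl⟩; exact h7 y hy

end

/-! ### The equivalence group acts by affine changes of `x` -/

/-- After multiplication by `(y - k)²` the left side has degree six and the right side at most five.
-/
theorem not_hasForm_pow_four {x μ k b₃ b₂ b₁ b₀ : ℝ} :
    ¬ HasForm (fun y => y ^ 4) x μ k b₃ b₂ b₁ b₀ := by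
  rintro ⟨hx, h⟩
  have hne : ∀ᶠ y in 𝓝 x, μ = 0 ∨ y - k ≠ 0 := by
    rcases hx with hμ | hx
    · exact Eventually.of_forall fun _ => .inl hμ
    · filter_upwards [isOpen_ne.mem_nhds hx] with y hy using .inr (sub_ne_zero.2 hy)
  have key : ∀ᶠ y in 𝓝 x, (y - k) ^ 2 * y ^ 4 = μ + b₃ * (y - k) ^ 5 + b₂ * (y - k) ^ 4
      + b₁ * (y - k) ^ 3 + b₀ * (y - k) ^ 2 := by
    filter_upwards [h, hne] with y hy hk
    rw [hy]
    rcases hk with rfl | hk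
    · simp only [zero_div]; ring
    · field_simp
  have h6 := (poly_coeffs (x₀ := x) (c₆ := 1) (c₅ := -2 * k - b₃)
    (c₄ := k ^ 2 + 5 * b₃ * k - b₂) (c₃ := -10 * b₃ * k ^ 2 + 4 * b₂ * k - b₁)
    (c₂ := 10 * b₃ * k ^ 3 - 6 * b₂ * k ^ 2 + 3 * b₁ * k - b₀)
    (c₁ := -5 * b₃ * k ^ 4 + 4 * b₂ * k ^ 3 - 3 * b₁ * k ^ 2 + 2 * b₀ * k)
    (c₀ := -μ + b₃ * k ^ 5 - b₂ * k ^ 4 + b₁ * k ^ 3 - b₀ * k ^ 2)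
    (key.mono fun y hy => by linear_combination hy)).2.2.2.2.2.2
  exact one_ne_zero h6

/-- An equivalence transformation must act on every potential given over its range of `x`, and the
map is the same for all of them. The test potential `x⁴` is not of the form forced by nonzero `A` or
`B`, so `A = B = 0` for the transformation. -/
theorem affine_of_mem_actionGroupoid {T : Triple} (hT : T ∈ actionGroupoid) {z : Space}
    (hz : z ∈ T.dom) : ∃ a c D : ℝ, a ≠ 0 ∧ (T.map z).2.1 = a * z.2.1 + c ∧
      ∀ᶠ x in 𝓝 z.2.1, a ^ 2 * T.tgt.fn (a * x + c) = T.src.fn x + D := by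
  obtain ⟨hadm, E, hE, -, -, hTE⟩ := hT
  obtain ⟨p, σ, f, hf⟩ := IsAdmissible.exists_form hadm hz
  have hrel := IsAdmissible.rel_near hadm hz hf
  have hmap : T.map = E.map := by rw [hTE]; rfl
  have hzE : z ∈ E.dom := by rw [hTE] at hz; exact hz.1
  let P : Potential := mkPot ((fun z : Space => z.2.1) '' E.dom) (fun y => y ^ 4)
    (isOpenMap_projX _ hE.point.isOpen) (hE.point.nonempty.image _) (by fun_prop)
  obtain ⟨P', -, hP⟩ := hE.preserves P Subset.rfl
  have hzP : z ∈ (E.triple P P').dom := ⟨hzE, z, hzE, rfl⟩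
  have hrelP : Rel p P.fn P'.fn (z.1, z.2.1) :=
    IsAdmissible.rel_near (T := E.triple P P') hP hzP (by rw [hmap] at hf; exact hf)
  have hrelP' : Rel p (fun y => y ^ 4) P'.fn (z.1, z.2.1) := by
    refine hrelP.congr_pot ?_ (Eventually.of_forall fun _ => rfl)
    filter_upwards [P.isOpen_dom.mem_nhds ⟨z, hzE, rfl⟩] with y hy
    exact indicator_of_mem hy _
  have hAB : ∀ᶠ t in 𝓝 z.1, p.A t = 0 ∧ p.B t = 0 := by
    by_contra hne
    obtain ⟨μ, k, b₃, b₂, b₁, b₀, h, -⟩ := hrelP'.exists_hasForm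
      ((not_eventually.1 hne).mono fun t ht => by
        by_contra h0
        exact ht (by simpa using h0))
    exact not_hasForm_pow_four h
  refine ⟨p.a z.1, p.c z.1, p.q0 z.1, hf.good.self_of_nhds.a_ne, ?_, ?_⟩
  · rw [hf.map_eq.self_of_nhds]; rfl
  · have hA : p.q2 z.1 = 0 := by
      rw [Par.q2, EventuallyEq.deriv_eq (hAB.mono fun t ht => ht.1), hAB.self_of_nhds.1]; simp
    have hB : p.q1 z.1 = 0 := by
      rw [Par.q1, EventuallyEq.deriv_eq (hAB.mono fun t ht => ht.2), hAB.self_of_nhds.2]; simp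
    filter_upwards [(eventually_curry hrel.rel).self_of_nhds] with x hx
    rw [Par.Q_eq, hA, hB] at hx
    simp only [Par.X] at hx
    linear_combination hx

theorem affine_of_mem_essLinGroupoid {T : Triple} (hT : T ∈ essLinGroupoid) {z : Space}
    (hz : z ∈ T.dom) : ∃ a c D : ℝ, a ≠ 0 ∧ (T.map z).2.1 = a * z.2.1 + c ∧
      ∀ᶠ x in 𝓝 z.2.1, a ^ 2 * T.tgt.fn (a * x + c) = T.src.fn x + D := by
  obtain ⟨-, T₁, h₁, T₂, ⟨-, htgt, f, -, hmap⟩, hc, rfl⟩ := hT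
  obtain ⟨a, c, D, ha, h1, h2⟩ := affine_of_mem_actionGroupoid h₁ hz.1
  have hc' : T₁.tgt = T₂.tgt := Eq.trans hc htgt.symm
  refine ⟨a, c, D, ha, ?_, ?_⟩
  · change (T₂.map (T₁.map z)).2.1 = _
    rw [hmap _ hz.2]; exact h1
  · change ∀ᶠ x in 𝓝 z.2.1, a ^ 2 * T₂.tgt.fn (a * x + c) = T₁.src.fn x + D
    rw [← hc']; exact h2

/-- Near `x`, the function `C` differs from the potential `P` by an affine change of variables. -/
def AffEq (P : Potential) (C : ℝ → ℝ) (x : ℝ) : Prop :=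
  ∃ a c D : ℝ, a ≠ 0 ∧ a * x + c ∈ P.dom ∧ ∀ᶠ y in 𝓝 x, a ^ 2 * P.fn (a * y + c) = C y + D

theorem AffEq.congr {P : Potential} {C C' : ℝ → ℝ} {x : ℝ} (h : AffEq P C x)
    (he : ∀ᶠ y in 𝓝 x, C y = C' y) : AffEq P C' x := by
  obtain ⟨a, c, D, ha, hx, h⟩ := h
  exact ⟨a, c, D, ha, hx, by filter_upwards [h, he] with y h1 h2; rw [← h2, h1]⟩

theorem AffEq.refl {P : Potential} {x : ℝ} (hx : x ∈ P.dom) : AffEq P P.fn x :=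
  ⟨1, 0, 0, one_ne_zero, by simpa using hx, Eventually.of_forall fun y => by simp⟩

/-- Equivalence transformations act affinely on potentials and superposition does not change them,
so affine classes are preserved. -/
theorem AffEq.map_essLin {P : Potential} {T : Triple} (hT : T ∈ essLinGroupoid) {z : Space}
    (hz : z ∈ T.dom) (h : AffEq P T.src.fn z.2.1) : AffEq P T.tgt.fn (T.map z).2.1 := by
  obtain ⟨a, c, D, ha, hx, h⟩ := h
  obtain ⟨k, κ, d, hk, h1, h2⟩ := affine_of_mem_essLinGroupoid hT hz
  refine ⟨a / k, c - a * κ / k, (D - d) / k ^ 2, div_ne_zero ha hk, ?_, ?_⟩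
  · rw [h1]
    convert hx using 1
    field_simp; ring
  · have ht : Tendsto (fun y => (y - κ) / k) (𝓝 (T.map z).2.1) (𝓝 z.2.1) := by
      have hcont : Continuous fun y => (y - κ) / k := by fun_prop
      have := hcont.tendsto (T.map z).2.1
      rwa [show ((T.map z).2.1 - κ) / k = z.2.1 by rw [h1]; field_simp; ring] at this
    filter_upwards [ht.eventually h, ht.eventually h2] with y h3 h4
    rw [show k * ((y - κ) / k) + κ = y by field_simp; ring] at h4
    rw [show a / k * y + (c - a * κ / k) = a * ((y - κ) / k) + c by ring]
    generalize P.fn (a * ((y - κ) / k) + c) = Y at *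
    field_simp
    linear_combination h3 - h4

/-! ### The potentials of the three families -/

/-- The potential `μ / x² + α x² + β x` from the list of the sources and the targets. -/
structure IsModel (P : Potential) (μ α β : ℝ) : Prop where
  dom : P.dom = {x | μ = 0 ∨ x ≠ 0}
  fn : ∀ x, P.fn x = μ / x ^ 2 + α * x ^ 2 + β * x
  α_eq : α = 0 ∨ α = 1 ∨ α = -1
  β_eq : β = 0 ∨ β = 1 ∧ α = 0

/-- Clearing denominators gives a polynomial identity of degree six. Its leading coefficient
compares `α` with `α'`, and the next one `β` with `β'` when `α = 0`. -/
theorem affine_model {μ α β μ' α' β' a c D x₀ : ℝ} (ha : a ≠ 0) (hx : μ = 0 ∨ x₀ ≠ 0)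
    (hx' : μ' = 0 ∨ a * x₀ + c ≠ 0)
    (h : ∀ᶠ x in 𝓝 x₀, a ^ 2 * (μ' / (a * x + c) ^ 2 + α' * (a * x + c) ^ 2 + β' * (a * x + c))
      = μ / x ^ 2 + α * x ^ 2 + β * x + D) :
    μ' = μ ∧ α' * a ^ 4 = α ∧ (α = 0 → β' * a ^ 3 = β) := by
  have ht : Tendsto (fun x => a * x + c) (𝓝 x₀) (𝓝 (a * x₀ + c)) :=
    Continuous.tendsto (by fun_prop) x₀
  have key : ∀ᶠ x in 𝓝 x₀, a ^ 2 * x ^ 2 * (μ' + α' * (a * x + c) ^ 4 + β' * (a * x + c) ^ 3)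
      = (a * x + c) ^ 2 * (μ + D * x ^ 2 + β * x ^ 3 + α * x ^ 4) := by
    filter_upwards [h, (isOpen_quad_dom μ).mem_nhds hx,
      ht.eventually ((isOpen_quad_dom μ').mem_nhds hx')] with x h1 h2 h3
    generalize a * x + c = Y at *
    have e : μ / x ^ 2 * x ^ 2 = μ := by
      rcases h2 with rfl | h2
      · simp
      · field_simp
    have e' : μ' / Y ^ 2 * Y ^ 2 = μ' := by
      rcases h3 with rfl | h3
      · simp
      · field_simp
    linear_combination x ^ 2 * Y ^ 2 * h1 - a ^ 2 * x ^ 2 * e' + Y ^ 2 * e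
  obtain ⟨e0, e1, e2, e3, e4, e5, e6⟩ := poly_coeffs (x₀ := x₀) (c₀ := -(c ^ 2 * μ))
    (c₁ := -(2 * a * c * μ))
    (c₂ := a ^ 2 * μ' + a ^ 2 * (α' * c ^ 4 + β' * c ^ 3) - (a ^ 2 * μ + c ^ 2 * D))
    (c₃ := a ^ 2 * (4 * α' * a * c ^ 3 + 3 * β' * a * c ^ 2) - (2 * a * c * D + c ^ 2 * β))
    (c₄ := a ^ 2 * (6 * α' * a ^ 2 * c ^ 2 + 3 * β' * a ^ 2 * c)
      - (a ^ 2 * D + 2 * a * c * β + c ^ 2 * α))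
    (c₅ := a ^ 2 * (4 * α' * a ^ 3 * c + β' * a ^ 3) - (a ^ 2 * β + 2 * a * c * α))
    (c₆ := a ^ 2 * (α' * a ^ 4) - a ^ 2 * α) (key.mono fun x hx => by linear_combination hx)
  have ha2 : a ^ 2 ≠ 0 := pow_ne_zero 2 ha
  have hα : α' * a ^ 4 = α := mul_left_cancel₀ ha2 (by linear_combination e6)
  refine ⟨?_, hα, fun h0 => ?_⟩
  · by_cases hc : c = 0
    · subst hc
      exact mul_left_cancel₀ ha2 (by linear_combination e2)
    · have hμ : μ = 0 := by simpa [hc] using e0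
      -- This combination of the coefficients is `a⁶` times the polynomial at `x = -c/a`, the zero
      -- of the shifted variable, where only the term with `μ'` remains.
      have : a ^ 6 * c ^ 2 * μ' = 0 := by
        linear_combination a ^ 6 * e0 - a ^ 5 * c * e1 + a ^ 4 * c ^ 2 * e2 - a ^ 3 * c ^ 3 * e3
          + a ^ 2 * c ^ 4 * e4 - a * c ^ 5 * e5 + c ^ 6 * e6
      rw [hμ]
      simpa [ha, hc] using this
  · have hα' : α' = 0 := by simpa [h0, ha] using hα
    subst hα' h0
    exact mul_left_cancel₀ ha2 (by linear_combination e5)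

section

variable {P P' : Potential} {μ α β μ' α' β' : ℝ}

/-- The parameter `μ` is an affine invariant, the sign of `α` is preserved since `a⁴ > 0`, and for
`α = 0` so is the vanishing of `β`; the models carry one representative of each case. -/
theorem IsModel.eq_of_affEq (h : IsModel P μ α β) (h' : IsModel P' μ' α' β') {x : ℝ}
    (hx : x ∈ P.dom) (he : AffEq P' P.fn x) : μ' = μ ∧ α' = α ∧ β' = β := by
  obtain ⟨a, c, D, ha, hx', he⟩ := he
  rw [h.dom] at hx
  rw [h'.dom] at hx'
  simp only [h.fn, h'.fn] at he
  obtain ⟨e1, e2, e3⟩ := affine_model ha hx hx' he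
  have ha4 : 0 < a ^ 4 := by positivity
  have hα : α' = α := by
    rcases h.α_eq with h1 | h1 | h1 <;> rcases h'.α_eq with h2 | h2 | h2 <;>
      first
      | (rw [h1, h2]; done)
      | (exfalso; rw [h1, h2] at e2; linarith)
  refine ⟨e1, hα, ?_⟩
  rcases h.β_eq with h1 | ⟨h1, h0⟩
  · rcases h'.β_eq with h2 | ⟨h2, h0⟩
    · rw [h1, h2]
    · rw [← hα, h0, h1] at e3
      simpa [ha, h1] using e3 rfl
  · rcases h'.β_eq with h2 | ⟨h2, -⟩
    · have := e3 h0
      rw [h1, h2] at this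
      simp at this
    · rw [h1, h2]

theorem IsModel.eq (h : IsModel P μ α β) (h' : IsModel P' μ α β) : P = P' :=
  Potential.ext_on (h.dom.trans h'.dom.symm) fun x _ => (h.fn x).trans (h'.fn x).symm

theorem isModel_quad (μ : ℝ) {α : ℝ} (hα : α = 0 ∨ α = 1 ∨ α = -1) :
    IsModel (quadPotential μ α) μ α 0 :=
  ⟨rfl, fun x => by simp [quadPotential], hα, .inl rfl⟩

theorem isModel_lin {β : ℝ} (hβ : β = 0 ∨ β = 1) : IsModel (linPotential β) 0 0 β :=
  ⟨by simp [linPotential], fun x => by simp [linPotential], .inl rfl, by simpa using hβ⟩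

end

/-- Every element of the generating set is determined by its source, which is one of the potentials
with `α ≠ 0` or `β ≠ 0`, whereas in its target both coefficients vanish. -/
theorem isModel_of_mem {T : Triple} (hT : T ∈ generatingSet) :
    (∃ μ α β, IsModel T.src μ α β ∧ (α ≠ 0 ∨ β ≠ 0) ∧
      ∀ T' ∈ generatingSet, IsModel T'.src μ α β → T' = T) ∧ ∃ μ, IsModel T.tgt μ 0 0 := by
  have huniq : ∀ {P : Potential} {μ α β μ' α' β' : ℝ}, IsModel P μ α β → IsModel P μ' α' β' →
      μ' = μ ∧ α' = α ∧ β' = β := fun {P} _ _ _ _ _ _ h h' => by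
    obtain ⟨x, hx⟩ := P.nonempty_dom
    exact h.eq_of_affEq h' hx (.refl hx)
  have m1 : ∀ μ, IsModel (T1 μ).src μ 1 0 := fun μ => isModel_quad μ (by simp)
  have m2 : ∀ μ, IsModel (T2 μ).src μ (-1) 0 := fun μ => isModel_quad μ (by simp)
  have m3 : IsModel T3.src 0 0 1 := isModel_lin (by simp)
  have m0 : ∀ μ, IsModel (quadPotential μ 0) μ 0 0 := fun μ => isModel_quad μ (by simp)
  rcases hT with (⟨μ, rfl⟩ | ⟨μ, rfl⟩) | rfl
  · refine ⟨⟨μ, 1, 0, m1 μ, by simp, ?_⟩, μ, m0 μ⟩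
    rintro T' ((⟨ν, rfl⟩ | ⟨ν, rfl⟩) | rfl) h
    · rw [(huniq h (m1 ν)).1]
    · have := (huniq h (m2 ν)).2.1; norm_num at this
    · have := (huniq h m3).2.1; norm_num at this
  · refine ⟨⟨μ, -1, 0, m2 μ, by simp, ?_⟩, μ, m0 μ⟩
    rintro T' ((⟨ν, rfl⟩ | ⟨ν, rfl⟩) | rfl) h
    · have := (huniq h (m1 ν)).2.1; norm_num at this
    · rw [(huniq h (m2 ν)).1]
    · have := (huniq h m3).2.1; norm_num at this
  · refine ⟨⟨0, 0, 1, m3, by simp, ?_⟩, 0, isModel_lin (by simp)⟩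
    rintro T' ((⟨ν, rfl⟩ | ⟨ν, rfl⟩) | rfl) h
    · have := (huniq h (m1 ν)).2.1; norm_num at this
    · have := (huniq h (m2 ν)).2.1; norm_num at this
    · rfl

/-! ### Self-consistency and minimality -/

theorem isModel_src_tgt {T : Triple} (hT : T ∈ generatingSet ∪ inverses generatingSet) :
    (∃ μ α β, IsModel T.src μ α β) ∧ ∃ μ α β, IsModel T.tgt μ α β := by
  rcases hT with hT | ⟨T', hT', -, hs, ht, -⟩
  · obtain ⟨⟨μ, α, β, h, -⟩, ν, h'⟩ := isModel_of_mem hT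
    exact ⟨⟨μ, α, β, h⟩, ν, 0, 0, h'⟩
  · obtain ⟨⟨μ, α, β, h, -⟩, ν, h'⟩ := isModel_of_mem hT'
    rw [hs, ht]
    exact ⟨⟨ν, 0, 0, h'⟩, μ, α, β, h⟩

/-- Only the right factor `T₂` matters: it links the target of `T` to the source of `T'` by an
affine change, and affinely equivalent models coincide. -/
theorem isSelfConsistent_generatingSet : IsSelfConsistent essLinGroupoid generatingSet := by
  rintro T hT T' hT' ⟨S, ⟨T₁, -, T₂, hT₂, -, hc, rfl⟩, hc'⟩
  obtain ⟨-, μ, α, β, h⟩ := isModel_src_tgt hT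
  obtain ⟨⟨μ', α', β', h'⟩, -⟩ := isModel_src_tgt hT'
  have hc' : T₂.tgt = T'.src := hc'
  have hadm : IsAdmissible T₂ := hT₂.1
  obtain ⟨z, hz⟩ := hadm.point.nonempty
  have hx : z.2.1 ∈ T₂.src.dom := by rw [hadm.src_dom]; exact ⟨z, hz, rfl⟩
  obtain ⟨a, c, D, ha, h1, h2⟩ := affine_of_mem_essLinGroupoid hT₂ hz
  have hx' : a * z.2.1 + c ∈ T₂.tgt.dom := by rw [hadm.tgt_dom, ← h1]; exact ⟨z, hz, rfl⟩
  rw [← hc] at hx h2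
  rw [hc'] at hx' h2
  obtain ⟨rfl, rfl, rfl⟩ := h.eq_of_affEq h' hx ⟨a, c, D, ha, hx', h2⟩
  exact h.eq h'

/-- If each building block keeps potentials in the affine class of `P`, so do restrictions and
compositions; the class is a local invariant, so shrinking the domains is harmless. -/
theorem IsComposition.affEq {M : Set Triple} {P : Potential}
    (hM : ∀ T ∈ M, ∀ z ∈ T.dom, AffEq P T.src.fn z.2.1 → AffEq P T.tgt.fn (T.map z).2.1)
    {T : Triple} (h : IsComposition M T) :
    ∀ z ∈ T.dom, AffEq P T.src.fn z.2.1 → AffEq P T.tgt.fn (T.map z).2.1 := by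
  induction h with
  | @of T T₀ hT h =>
    obtain ⟨hadm, hd, hmap, hs, ht⟩ := h
    intro z hz he
    have hzs : z.2.1 ∈ T₀.src.dom := by rw [hadm.src_dom]; exact ⟨z, hz, rfl⟩
    have hzt : (T₀.map z).2.1 ∈ T₀.tgt.dom := by rw [hadm.tgt_dom]; exact ⟨z, hz, rfl⟩
    have h1 := hM T hT z (hd hz) (he.congr (by
      filter_upwards [T₀.src.isOpen_dom.mem_nhds hzs] with y hy using hs.2 hy))
    rw [← hmap hz] at h1
    refine h1.congr ?_
    filter_upwards [T₀.tgt.isOpen_dom.mem_nhds hzt] with y hy using (ht.2 hy).symm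
  | @comp T T' _ _ hc ih ih' =>
    rintro z ⟨hz, hz'⟩ he
    refine ih' _ hz' ?_
    rw [← show T.tgt = T'.src from hc]
    exact ih z hz he

theorem not_isGenerating_of_ssubset {B : Set Triple} (hB : B ⊂ generatingSet) :
    ¬ IsGenerating essLinGroupoid B := by
  intro hgen
  obtain ⟨T, hT, hTB⟩ := exists_of_ssubset hB
  obtain ⟨⟨μ, α, β, hm, hne, huniq⟩, ν, hm'⟩ := isModel_of_mem hT
  have hadm : IsAdmissible T := generatingSet_subset hT
  obtain ⟨z, hz⟩ := hadm.point.nonempty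
  obtain ⟨T₀, ⟨hadm₀, hd, hmap, hs, ht⟩, hz₀, hcomp⟩ := hgen.2 T hadm z hz
  have hmem : ∀ {T : Triple} {z : Space}, IsAdmissible T → z ∈ T.dom → z.2.1 ∈ T.src.dom :=
    fun h hz => by rw [h.src_dom]; exact ⟨_, hz, rfl⟩
  have hmem' : ∀ {T : Triple} {z : Space}, IsAdmissible T → z ∈ T.dom →
      (T.map z).2.1 ∈ T.tgt.dom := fun h hz => by rw [h.tgt_dom]; exact ⟨_, hz, rfl⟩
  have key := hcomp.affEq (P := T.src) (by
    -- A remaining generator whose source lies in the class of `T.src` would be `T` itself; an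
    -- inverse starts at some `μ/x²`, outside the class since `α` or `β` is nonzero; elements of
    -- `essLinGroupoid` preserve the class.
    rintro T' ((h | ⟨S, hS, hinv⟩) | h) y hy he
    · obtain ⟨⟨μ', α', β', h', -⟩, -⟩ := isModel_of_mem (hB.1 h)
      obtain ⟨rfl, rfl, rfl⟩ := h'.eq_of_affEq hm (hmem (generatingSet_subset (hB.1 h)) hy) he
      exact absurd (huniq T' (hB.1 h) h' ▸ h) hTB
    · obtain ⟨-, ν', h'⟩ := isModel_of_mem (hB.1 hS)
      rw [← hinv.2.1] at h'
      obtain ⟨-, h1, h2⟩ := h'.eq_of_affEq hm (hmem hinv.1 hy) he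
      exact absurd hne (by simp [h1, h2])
    · exact he.map_essLin h hy) z hz₀ ((AffEq.refl (hmem hadm hz)).congr (by
        filter_upwards [T₀.src.isOpen_dom.mem_nhds (hmem hadm₀ hz₀)] with y hy
        exact (hs.2 hy).symm))
  have key' : AffEq T.src T.tgt.fn (T₀.map z).2.1 := key.congr (by
    filter_upwards [T₀.tgt.isOpen_dom.mem_nhds (hmem' hadm₀ hz₀)] with y hy using ht.2 hy)
  rw [hmap hz₀] at key'
  obtain ⟨-, h1, h2⟩ := hm'.eq_of_affEq hm (hmem' hadm hz) key'
  exact absurd hne (by simp [h1, h2])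

end

end HeatPot

theorem mainTheorem4 :
    HeatPot.IsMinimalSelfConsistentGenerating HeatPot.essLinGroupoid HeatPot.generatingSet :=
  ⟨HeatPot.isGenerating_generatingSet, HeatPot.isSelfConsistent_generatingSet,
    fun _ hB => HeatPot.not_isGenerating_of_ssubset hB⟩
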